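/- Let $\mathscr S_2=SL_2(\mathbb R)/SL_2(\mathbb Z)$ be the space of unimodular lattices of $\mathbb R^2$ (the class of $M$ being the lattice $M\mathbb Z^2$), with its $SL_2(\mathbb R)$-invariant probability measure $\mu_2$. Let $\tilde\mu_2$ be a probability measure on $\mathscr S_2$ with a bounded measurable density $\sigma\ge 0$ with respect to $\mu_2$. For $i\in\{1,2\}$ let $\|L\|_i$ be the smallest $r>0$ such that the closed Euclidean ball of radius $r$ centred at $0$ contains $i$ linearly independent vectors of $L$. For almost every $L$ there is a unique vector $e_i(L)\in L$ with positive first coordinate and norm $\|L\|_i$. Let $\Pi$ be the set of $k=(k_1,k_2)\in\mathbb Z^2$ with $k_1,k_2$ coprime, $k_1\ge 0$, and $k_2=1$ if $k_1=0$. Write $e_k(L)=k_1e_1(L)+k_2e_2(L)$ and, for $A>0$, $\Pi_A(L)=\{k\in\Pi : \|e_k(L)\|\le A\}$. Let $\gamma$ be a simple closed regular analytic curve with nowhere vanishing curvature which is the boundary of a compact strictly convex set containing $0$. For $\xi\in\mathbb R^2\setminus\{0\}$ let $\rho_\gamma(\xi)$ be the radius of curvature of $\gamma$ at the point where the outer unit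 normal is $\xi/\|\xi\|$. Let $(\tilde Z_k)_{k\in\Pi}$ be independent identically distributed real random variables on a probability space $(\Omega,\mathbb P)$, whose common law is symmetric, compactly supported and not the Dirac mass at $0$. Consider the sums $$\tilde S_A(\omega,L)=\sum_{k\in\Pi_A(L)}\frac{\rho_\gamma(e_k(L))\,\tilde Z_k(\omega)}{\|e_k(L)\|^{3/2}},\qquad \tilde S_A(\omega_1,\omega_2,L)=\sum_{k\in\Pi_A(L)}\frac{\rho_\gamma(e_k(L))\,\tilde Z_k(\omega_1)+\rho_\gamma(-e_k(L))\,\tilde Z_k(\omega_2)}{\|e_k(L)\|^{3/2}}$$ on $\Omega\times\mathscr S_2$ with the measure $\mathbb P\otimes\tilde\mu_2$ and on $\Omega\times\Omega\times\mathscr S_2$ with the measure $\mathbb P\otimes\mathbb P\otimes\tilde\mu_2$, respectively. Then, for each of the two types of sums: 1. as $A\to\infty$ the sums converge almost surely; 2. the law of the limit $S$ is symmetric, and $S$ is integrable with expectation $0$; 3. $\mathbb E|S|^{1+\kappa}<\infty$ for every $0\le\kappa<\frac13$; 4. if there are $m>0$ and $\alpha>0$ with $\sigma(L)\ge m$ for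 all $L$ with $\|L\|_1<\alpha$, then $\mathbb E|S|^{4/3}=\infty$; 5. if there is $\alpha>0$ with $\tilde\mu_2(\{L:\|L\|_1<\alpha\})=0$, then $\mathbb E|S|^{p}<\infty$ for every $1\le p<\infty$. -/

import Mathlib

open MeasureTheory ProbabilityTheory Filter Topology Matrix

/-- The Euclidean plane. -/
abbrev Plane : Type := EuclideanSpace ℝ (Fin 2)

/-! ### The space of unimodular lattices -/

/-- `SL₂(ℤ)` as a subgroup of `SL₂(ℝ)`. -/
def sl2Int : Subgroup (Matrix.SpecialLinearGroup (Fin 2) ℝ) :=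
  (Matrix.SpecialLinearGroup.map (n := Fin 2) (Int.castRingHom ℝ)).range

/-- The space `SL₂(ℝ) / SL₂(ℤ)` of unimodular lattices of the plane; the class of `M` stands
for the lattice `M ℤ²`. -/
def LatticeSpace : Type := Matrix.SpecialLinearGroup (Fin 2) ℝ ⧸ sl2Int

namespace LatticeSpace

/-- The class of a matrix. -/
def mk (M : Matrix.SpecialLinearGroup (Fin 2) ℝ) : LatticeSpace :=
  QuotientGroup.mk (s := sl2Int) M

/-- The quotient topology. -/
instance : TopologicalSpace LatticeSpace :=
  inferInstanceAs (TopologicalSpace (Matrix.SpecialLinearGroup (Fin 2) ℝ ⧸ sl2Int))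

/-- The action of `SL₂(ℝ)` by left translations. -/
instance : MulAction (Matrix.SpecialLinearGroup (Fin 2) ℝ) LatticeSpace :=
  inferInstanceAs (MulAction (Matrix.SpecialLinearGroup (Fin 2) ℝ)
    (Matrix.SpecialLinearGroup (Fin 2) ℝ ⧸ sl2Int))

/-- The Borel σ-algebra of the quotient topology. -/
instance : MeasurableSpace LatticeSpace := borel LatticeSpace

instance : BorelSpace LatticeSpace := ⟨rfl⟩

/-- The set of vectors of the lattice `L`, that is `M ℤ²` for any matrix `M` of class `L`. -/
def vectors (L : LatticeSpace) : Set Plane :=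
  {v | ∃ M : Matrix.SpecialLinearGroup (Fin 2) ℝ, mk M = L ∧
    ∃ k : Fin 2 → ℤ, v = WithLp.toLp 2 (M.1 *ᵥ fun i => (k i : ℝ))}

/-- The vectors of the lattice can be computed with any representative. -/
theorem vectors_mk (M : Matrix.SpecialLinearGroup (Fin 2) ℝ) :
    vectors (mk M) =
      Set.range fun k : Fin 2 → ℤ => (WithLp.toLp 2 (M.1 *ᵥ fun i => (k i : ℝ)) : Plane) := by
  ext v
  constructor
  · rintro ⟨N, hN, k, rfl⟩
    obtain ⟨g, hg⟩ := QuotientGroup.eq.1 hN.symm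
    have hNM : N = M * Matrix.SpecialLinearGroup.map (Int.castRingHom ℝ) g := by
      rw [hg]; group
    refine ⟨g.1 *ᵥ k, ?_⟩
    have h1 : (fun i => (((g.1 *ᵥ k) i : ℤ) : ℝ)) =
        (Matrix.SpecialLinearGroup.map (Int.castRingHom ℝ) g).1 *ᵥ fun i => (k i : ℝ) := by
      funext i
      simp [Matrix.mulVec, dotProduct]
    simp only [h1, hNM, Matrix.SpecialLinearGroup.coe_mul, Matrix.mulVec_mulVec]
  · rintro ⟨k, rfl⟩
    exact ⟨M, rfl, k, rfl⟩

/-- The successive minimum `‖L‖ᵢ`: the smallest `r > 0` such that the closed ball of radius `r`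
centred at `0` contains `i` linearly independent vectors of `L`. -/
noncomputable def succMin (i : ℕ) (L : LatticeSpace) : ℝ :=
  sInf {r : ℝ | 0 < r ∧ ∃ v : Fin i → Plane, LinearIndependent ℝ v ∧
    ∀ j, v j ∈ vectors L ∧ ‖v j‖ ≤ r}

open Classical in
/-- The vector `eᵢ(L)`: for almost every `L` and `i = 1, 2`, the only vector of `L` with positive
first coordinate and norm `‖L‖ᵢ` (and `0`, by convention, if there is no such unique vector). -/
noncomputable def minVec (i : ℕ) (L : LatticeSpace) : Plane :=
  if h : ∃! v : Plane, v ∈ vectors L ∧ 0 < v 0 ∧ ‖v‖ = succMin i L then h.choose else 0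

/-- The vector `k₁ e₁(L) + k₂ e₂(L)`. -/
noncomputable def combVec (L : LatticeSpace) (k : ℤ × ℤ) : Plane :=
  k.1 • minVec 1 L + k.2 • minVec 2 L

end LatticeSpace

/-- The index set `Π` of the coprime pairs `(k₁, k₂)` with `k₁ ≥ 0`, and `k₂ = 1` if `k₁ = 0`. -/
def PrimIndex : Set (ℤ × ℤ) :=
  {k | IsCoprime k.1 k.2 ∧ 0 ≤ k.1 ∧ (k.1 = 0 → k.2 = 1)}

/-- The set `Π_A(L)` of the `k ∈ Π` with `‖k₁ e₁(L) + k₂ e₂(L)‖ ≤ A`. -/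
def PrimIndexLE (A : ℝ) (L : LatticeSpace) : Set PrimIndex :=
  {k | ‖L.combVec k‖ ≤ A}

/-! ### Ovals and their radius of curvature -/

/-- The determinant of `(c'(s), c''(s))`. -/
noncomputable def curveDet (c : ℝ → Plane) (s : ℝ) : ℝ :=
  deriv c s 0 * deriv (deriv c) s 1 - deriv c s 1 * deriv (deriv c) s 0

/-- The radius of curvature of the curve `c` at the parameter `s`. -/
noncomputable def curvatureRadius (c : ℝ → Plane) (s : ℝ) : ℝ :=
  ‖deriv c s‖ ^ 3 / |curveDet c s|

/-- `c`, of period `T`, is a regular analytic parametrization of a simple closed curve with nowhere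
vanishing curvature, and this curve is the boundary of the compact strictly convex set `D`,
which contains `0`. -/
structure IsAnalyticOval (D : Set Plane) (c : ℝ → Plane) (T : ℝ) : Prop where
  period_pos : 0 < T
  periodic : Function.Periodic c T
  simple : Set.InjOn c (Set.Ico 0 T)
  analytic : AnalyticOnNhd ℝ c Set.univ
  regular : ∀ s, deriv c s ≠ 0
  curved : ∀ s, curveDet c s ≠ 0
  compact : IsCompact D
  strictConvex : StrictConvex ℝ D
  frontier_eq : frontier D = Set.range c
  zero_mem : 0 ∈ D

/-- `u` is an outer unit normal at the point `x` of the convex set `D`. -/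
def IsOuterUnitNormal (D : Set Plane) (x u : Plane) : Prop :=
  ‖u‖ = 1 ∧ ∀ y ∈ D, inner ℝ (y - x) u ≤ 0

open Classical in
/-- The radius of curvature `ρ(ξ)` of the boundary curve `c` of `D` at the point where the outer
unit normal is `ξ / ‖ξ‖`, for `ξ ≠ 0`. -/
noncomputable def normalRadius (D : Set Plane) (c : ℝ → Plane) (ξ : Plane) : ℝ :=
  if h : ∃ s : ℝ, IsOuterUnitNormal D (c s) (‖ξ‖⁻¹ • ξ) then curvatureRadius c h.choose else 0

/-! ### The random sums -/

/-- The sum over `k ∈ Π_A(L)` of `ρ(e) Z_k(ω) / ‖e‖^{3/2}` with `e = k₁ e₁(L) + k₂ e₂(L)`. -/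
noncomputable def symSum {Ω : Type*} (D : Set Plane) (c : ℝ → Plane) (Z : PrimIndex → Ω → ℝ)
    (A : ℝ) (x : Ω × LatticeSpace) : ℝ :=
  ∑ᶠ k ∈ PrimIndexLE A x.2,
    normalRadius D c (x.2.combVec k) * Z k x.1 / ‖x.2.combVec k‖ ^ (3 / 2 : ℝ)

/-- The sum over `k ∈ Π_A(L)` of `(ρ(e) Z_k(ω₁) + ρ(-e) Z_k(ω₂)) / ‖e‖^{3/2}` with
`e = k₁ e₁(L) + k₂ e₂(L)`. -/
noncomputable def nonsymSum {Ω : Type*} (D : Set Plane) (c : ℝ → Plane) (Z : PrimIndex → Ω → ℝ)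
    (A : ℝ) (x : (Ω × Ω) × LatticeSpace) : ℝ :=
  ∑ᶠ k ∈ PrimIndexLE A x.2,
    (normalRadius D c (x.2.combVec k) * Z k x.1.1 +
      normalRadius D c (-x.2.combVec k) * Z k x.1.2) / ‖x.2.combVec k‖ ^ (3 / 2 : ℝ)

/-! For a fixed lattice `L` the sum is a series of independent, centred, bounded variables whose
weights have size `‖e_k‖^{-3/2}`, because the radius of curvature of the oval lies between two
positive constants. Everything then depends on the variance, which is of order `∑ ‖e_k‖^{-3}`. The
pair `(e₁, e₂)` is reduced, so `‖e_k‖² ≥ (k₁²‖e₁‖² + k₂²‖e₂‖²)/2` and `‖e₁‖‖e₂‖ ≥ 1`, whence `‖e_k‖²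
≥ |k₁k₂|`. The indices off the axes and `e₂` thus contribute a bounded amount, and the variance is
at most `C (‖L‖₁^{-3} + 1)` (`exists_sum_norm_combVec_le`). That `e₁, e₂` generate `L` is never
needed.

Square-summable weights give almost sure convergence by the martingale theorem, and sub-Gaussian
bounds control the `p`-th moment given `L` by a multiple of `(‖L‖₁^{-3} + 1)^{p/2}`. Reversing all
signs of the coefficients leaves their law unchanged and changes `S` into `-S`, hence symmetry.
Reversing only the sign of the coefficient of `e₁` changes `S` by twice the term of `e₁`, so a
moment of `S` dominates half of the same moment of that single term (`exists_series_limit`).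

The moment of order `p` is therefore governed by `∫ ‖L‖₁^{-3p/2}` over the cusp. The probability of
`‖L‖₁ < r` is comparable to `r²` (`exists_measure_succMin_lt_bounds`), so the threshold is `3p/2 =
2`, that is `p = 4/3`. The cusp estimate follows from invariance alone: the intensity measure of the
primitive vectors is invariant under `SL₂(ℝ)`; shears translate slopes, so the slopes in a strip
have a law proportional to Lebesgue measure; diagonal matrices rescale cones; and a ball of radius
at most `1` contains at most one pair `±v` of primitive vectors.

The second type of sum is the same series over two copies of `Π`, with weights `ρ(e)` on one copy
and `ρ(-e)` on the other. -/

/-! ### Weighted sums of independent bounded variables -/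

theorem lintegral_rpow_abs_le_of_hasSubgaussianMGF {Ω : Type*} [MeasurableSpace Ω]
    {μ : Measure Ω} [IsProbabilityMeasure μ] {X : Ω → ℝ} {c : NNReal}
    (hX : HasSubgaussianMGF X c μ) {p V : ℝ} (hp : 0 ≤ p) (hV : 0 < V) (hcV : (c : ℝ) ≤ V) :
    ∫⁻ ω, ENNReal.ofReal (|X ω| ^ p) ∂μ ≤
      ENNReal.ofReal (p ^ p * (2 * Real.exp (1 / 2)) * V ^ (p / 2)) := by
  -- At the scale `t = V^{-1/2}` both exponential moments are at most `exp (1/2)`, and the factor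
  -- `(p/t)^p` in `|x|^p ≤ (p/t)^p e^{t|x|}` becomes `p^p V^{p/2}`.
  set t : ℝ := (√V)⁻¹ with ht
  have hsV : 0 < √V := Real.sqrt_pos.2 hV
  have ht0 : 0 < t := inv_pos.2 hsV
  have hmgf : ∀ s : ℝ, s ^ 2 = t ^ 2 → ∫ ω, Real.exp (s * X ω) ∂μ ≤ Real.exp (1 / 2) := by
    intro s hs
    refine (hX.mgf_le s).trans (Real.exp_le_exp.2 ?_)
    rw [hs, ht, inv_pow, Real.sq_sqrt hV.le]
    rw [← div_eq_mul_inv, div_right_comm]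
    have : (c : ℝ) / V ≤ 1 := (div_le_one hV).2 hcV
    rw [div_right_comm]
    linarith
  have hpt : ∀ ω, |X ω| ^ p ≤ (p / t) ^ p * (Real.exp (t * X ω) + Real.exp (-t * X ω)) := by
    intro ω
    have h := ProbabilityTheory.rpow_abs_le_mul_max_exp (X ω) hp ht0.ne'
    rw [abs_of_pos ht0] at h
    refine h.trans (mul_le_mul_of_nonneg_left ?_
      (Real.rpow_nonneg (div_nonneg hp ht0.le) _))
    exact max_le (by linarith [Real.exp_pos (-t * X ω)]) (by linarith [Real.exp_pos (t * X ω)])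
  have hint := ((hX.integrable_exp_mul t).add (hX.integrable_exp_mul (-t))).const_mul ((p / t) ^ p)
  calc ∫⁻ ω, ENNReal.ofReal (|X ω| ^ p) ∂μ
      ≤ ∫⁻ ω, ENNReal.ofReal ((p / t) ^ p * (Real.exp (t * X ω) + Real.exp (-t * X ω))) ∂μ :=
        lintegral_mono fun ω => ENNReal.ofReal_le_ofReal (hpt ω)
    _ = ENNReal.ofReal (∫ ω, (p / t) ^ p * (Real.exp (t * X ω) + Real.exp (-t * X ω)) ∂μ) :=
        (ofReal_integral_eq_lintegral_ofReal hint (ae_of_all _ fun ω =>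
          mul_nonneg (Real.rpow_nonneg (div_nonneg hp ht0.le) _)
            (add_nonneg (Real.exp_pos _).le (Real.exp_pos _).le))).symm
    _ ≤ _ := by
        refine ENNReal.ofReal_le_ofReal ?_
        rw [integral_const_mul, integral_add (hX.integrable_exp_mul t) (hX.integrable_exp_mul (-t))]
        have h1 := hmgf t rfl
        have h2 := hmgf (-t) (by ring)
        have h3 : (p / t) ^ p = p ^ p * V ^ (p / 2) := by
          rw [ht, div_inv_eq_mul, Real.mul_rpow hp hsV.le, Real.sqrt_eq_rpow,
            ← Real.rpow_mul hV.le]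
          ring_nf
        rw [h3]
        have h4 : 0 ≤ p ^ p * V ^ (p / 2) := by positivity
        nlinarith [mul_le_mul_of_nonneg_left (add_le_add h1 h2) h4]

section WeightedSums

variable {ι : Type*} {Ω : Type*} [MeasurableSpace Ω] {P : Measure Ω} [IsProbabilityMeasure P]
  {Z : ι → Ω → ℝ} {K : ℝ}

/-- Hoeffding's lemma on `[-K, K]` gives each variable the parameter `K²`, and independence adds
parameters. Only the `ℓ²` size of the weights then enters the moments of every order. -/
theorem hasSubgaussianMGF_weighted_sum (hZm : ∀ i, Measurable (Z i)) (hZi : iIndepFun Z P)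
    (hZ0 : ∀ i, ∫ ω, Z i ω ∂P = 0) (hZK : ∀ i, ∀ᵐ ω ∂P, |Z i ω| ≤ K)
    (F : Finset ι) (w : ι → ℝ) :
    HasSubgaussianMGF (fun ω => ∑ i ∈ F, w i * Z i ω)
      (∑ i ∈ F, Real.toNNReal (w i ^ 2 * K ^ 2)) P := by
  refine HasSubgaussianMGF.sum_of_iIndepFun (X := fun i ω => w i * Z i ω) ?_ ?_
  · exact hZi.comp (fun i x => w i * x) fun i => by fun_prop
  · intro i _
    have h := hasSubgaussianMGF_of_mem_Icc_of_integral_eq_zero (X := Z i) (a := -K) (b := K)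
      (hZm i).aemeasurable (by filter_upwards [hZK i] with ω h using abs_le.1 h) (hZ0 i)
    have h2 := h.const_mul (w i)
    convert h2 using 1
    ext
    rw [Real.coe_toNNReal _ (by positivity)]
    change _ = w i ^ 2 * (‖K - -K‖ / 2) ^ 2
    rw [Real.norm_eq_abs, div_pow, sq_abs]
    ring

theorem lintegral_rpow_abs_weighted_sum_le (hZm : ∀ i, Measurable (Z i)) (hZi : iIndepFun Z P)
    (hZ0 : ∀ i, ∫ ω, Z i ω ∂P = 0) (hZK : ∀ i, ∀ᵐ ω ∂P, |Z i ω| ≤ K) (hK : 0 < K)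
    (F : Finset ι) (w : ι → ℝ) {B p : ℝ} (hB : 0 < B) (hp : 0 ≤ p) (hw : ∑ i ∈ F, w i ^ 2 ≤ B) :
    ∫⁻ ω, ENNReal.ofReal (|∑ i ∈ F, w i * Z i ω| ^ p) ∂P ≤
      ENNReal.ofReal (p ^ p * (2 * Real.exp (1 / 2)) * (B * K ^ 2) ^ (p / 2)) := by
  refine lintegral_rpow_abs_le_of_hasSubgaussianMGF
    (hasSubgaussianMGF_weighted_sum hZm hZi hZ0 hZK F w) hp (by positivity) ?_
  push_cast
  rw [Finset.sum_congr rfl fun i _ => Real.coe_toNNReal (w i ^ 2 * K ^ 2) (by positivity),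
    ← Finset.sum_mul]
  exact mul_le_mul_of_nonneg_right hw (by positivity)

/-- Along an increasing sequence of finite index sets, the partial sums of a series of independent
centred bounded variables with square-summable weights converge almost surely. -/
theorem ae_exists_tendsto_weighted_sum (hZm : ∀ i, Measurable (Z i)) (hZi : iIndepFun Z P)
    (hZ0 : ∀ i, ∫ ω, Z i ω ∂P = 0) (hZK : ∀ i, ∀ᵐ ω ∂P, |Z i ω| ≤ K) (hK : 0 < K)
    (w : ι → ℝ) {B : ℝ} (hB : 0 < B) (hw : ∀ F : Finset ι, ∑ i ∈ F, w i ^ 2 ≤ B)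
    (F : ℕ → Finset ι) (hF : Monotone F) :
    ∀ᵐ ω ∂P, ∃ l, Tendsto (fun n => ∑ i ∈ F n, w i * Z i ω) atTop (𝓝 l) := by
  classical
  have hle : ∀ i, (inferInstance : MeasurableSpace ℝ).comap (Z i) ≤ ‹MeasurableSpace Ω› :=
    fun i => (hZm i).comap_le
  let ℱ : Filtration ℕ ‹MeasurableSpace Ω› :=
    { seq := fun n => ⨆ i ∈ (F n : Set ι), (inferInstance : MeasurableSpace ℝ).comap (Z i)
      mono' := fun m n hmn => biSup_mono fun i hi => hF hmn hi
      le' := fun n => iSup₂_le fun i _ => hle i }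
  have hZint : ∀ i, Integrable (Z i) P := fun i =>
    Integrable.of_bound (hZm i).aestronglyMeasurable K (by simpa using hZK i)
  have hmeas : ∀ n, ∀ i ∈ F n, Measurable[ℱ n] (Z i) := fun n i hi =>
    Measurable.mono (comap_measurable (Z i))
      (le_iSup₂ (f := fun i (_ : i ∈ (F n : Set ι)) =>
        (inferInstance : MeasurableSpace ℝ).comap (Z i)) i hi) le_rfl
  -- A variable not yet included is independent of the σ-algebra generated by those already
  -- included, so its conditional expectation is its mean `0`. This makes the partial sums a
  -- martingale.
  have hcond : ∀ n, ∀ i ∉ F n, P[Z i | ℱ n] =ᵐ[P] 0 := by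
    intro n i hi
    have hind := indep_iSup_of_disjoint hle hZi.iIndep
      (S := {i}) (T := (F n : Set ι)) (by simpa using hi)
    have h1 : (⨆ j ∈ ({i} : Set ι), (inferInstance : MeasurableSpace ℝ).comap (Z j)) =
        (inferInstance : MeasurableSpace ℝ).comap (Z i) := by simp
    rw [h1] at hind
    have := condExp_indep_eq (hle i) (ℱ.le n)
      (comap_measurable (Z i)).stronglyMeasurable hind
    rw [hZ0 i] at this
    exact this
  have hsint : ∀ G : Finset ι, Integrable (fun ω => ∑ i ∈ G, w i * Z i ω) P := fun G =>
    integrable_finsetSum _ fun i _ => (hZint i).const_mul _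
  have hadp : StronglyAdapted ℱ fun n ω => ∑ i ∈ F n, w i * Z i ω := fun n =>
    (Finset.measurable_fun_sum _ fun i hi =>
      (hmeas n i hi).const_mul (w i)).stronglyMeasurable
  have hmart : Martingale (fun n ω => ∑ i ∈ F n, w i * Z i ω) ℱ P := by
    refine martingale_nat hadp (fun n => hsint _) fun n => ?_
    have hsplit : (fun ω => ∑ i ∈ F (n + 1), w i * Z i ω) =
        (fun ω => ∑ i ∈ F n, w i * Z i ω) + ∑ i ∈ F (n + 1) \ F n, w i • Z i := by
      funext ω
      simp only [Pi.add_apply, Finset.sum_apply, Pi.smul_apply, smul_eq_mul]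
      rw [← Finset.sum_sdiff (hF n.le_succ)]
      exact add_comm _ _
    rw [hsplit]
    have h1 := condExp_add (m := ℱ n) (hsint (F n))
      (integrable_finsetSum' (F (n + 1) \ F n) fun i _ => (hZint i).smul (w i))
    have h2 := condExp_of_stronglyMeasurable (ℱ.le n) (hadp n) (hsint (F n))
    have h3 := condExp_finsetSum (m := ℱ n) (s := F (n + 1) \ F n) (f := fun i => w i • Z i) (μ := P)
      fun i _ => (hZint i).smul (w i)
    have h4 : ∀ᵐ ω ∂P, ∀ i ∈ F (n + 1) \ F n, P[w i • Z i | ℱ n] ω = 0 := by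
      rw [Finset.eventually_all]
      intro i hi
      filter_upwards [condExp_smul (μ := P) (m := ℱ n) (w i) (Z i),
        hcond n i (Finset.mem_sdiff.1 hi).2] with ω h h'
      rw [h]; simp [h']
    filter_upwards [h1, h3, h4] with ω h1 h3 h4
    rw [h1, Pi.add_apply, h2, h3, Finset.sum_apply, Finset.sum_eq_zero h4, add_zero]
  -- The sub-Gaussian bound with `p = 1` provides the uniform `L¹` bound required by the martingale
  -- convergence theorem.
  have hbdd : ∀ n, eLpNorm (fun ω => ∑ i ∈ F n, w i * Z i ω) 1 P ≤
      (Real.toNNReal ((1 : ℝ) ^ (1 : ℝ) * (2 * Real.exp (1 / 2)) *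
        (B * K ^ 2) ^ ((1 : ℝ) / 2)) : NNReal) := by
    intro n
    rw [eLpNorm_one_eq_lintegral_enorm]
    have := lintegral_rpow_abs_weighted_sum_le hZm hZi hZ0 hZK hK (F n) w hB zero_le_one
      (hw (F n))
    refine le_trans (le_of_eq ?_) this
    refine lintegral_congr fun ω => ?_
    rw [Real.rpow_one, ← ofReal_norm, Real.norm_eq_abs]
  filter_upwards [hmart.submartingale.ae_tendsto_limitProcess hbdd] with ω h using ⟨_, h⟩

end WeightedSums

/-! ### Summation in the order of increasing norm -/

/-- The sum of `w i * z i` over the indices `i` with `N i ≤ A`. -/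
noncomputable def truncSum {ι : Type*} (N w z : ι → ℝ) (A : ℝ) : ℝ :=
  ∑ᶠ i ∈ {i | N i ≤ A}, w i * z i

section Deterministic

variable {ι : Type*} {N : ι → ℝ}

theorem truncSum_eq_sum (w z : ι → ℝ) {A : ℝ} {F : Finset ι} (hF : {i | N i ≤ A} = (F : Set ι)) :
    truncSum N w z A = ∑ i ∈ F, w i * z i := by
  rw [truncSum, hF]
  exact finsum_mem_coe_finset _ F

theorem truncSum_eq_of_sublevel_eq (w z : ι → ℝ) {A B : ℝ} (h : {i | N i ≤ A} = {i | N i ≤ B}) :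
    truncSum N w z A = truncSum N w z B := by
  rw [truncSum, truncSum, h]

/-- Only finitely many values of `N` lie below `A + 1`, so the sublevel set is constant just to the
right of `A`. Limits over real `A` thereby reduce to limits over rationals, which is what
measurability requires. -/
theorem exists_rat_sublevel_eq (hN : ∀ A, {i | N i ≤ A}.Finite) (A : ℝ) :
    ∃ q : ℚ, A ≤ q ∧ {i | N i ≤ (q : ℝ)} = {i | N i ≤ A} := by
  have h : ∀ᶠ q in 𝓝[>] A, ∀ i ∈ {i | N i ≤ A + 1}, A < N i → q < N i := by
    rw [(hN (A + 1)).eventually_all]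
    intro i _
    by_cases hi : A < N i
    · filter_upwards [mem_nhdsWithin_of_mem_nhds (Iio_mem_nhds hi)] with q hq _ using hq
    · simp [hi]
  have h1 : ∀ᶠ q in 𝓝[>] A, q ≤ A + 1 :=
    mem_nhdsWithin_of_mem_nhds (Iic_mem_nhds (by linarith))
  obtain ⟨u, hu, hsub⟩ := mem_nhdsGT_iff_exists_Ioo_subset.1 (h.and h1)
  obtain ⟨q, hq1, hq2⟩ := exists_rat_btwn (Set.mem_Ioi.1 hu)
  obtain ⟨h2, h3⟩ := hsub ⟨hq1, hq2⟩
  refine ⟨q, hq1.le, ?_⟩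
  ext i
  refine ⟨fun hi => ?_, fun hi => le_trans hi hq1.le⟩
  by_contra hA
  exact absurd (h2 i (le_trans hi h3) (not_le.1 hA)) (not_lt.2 hi)

theorem tendsto_truncSum_iff_rat (hN : ∀ A, {i | N i ≤ A}.Finite) (w z : ι → ℝ) {l : ℝ} :
    Tendsto (truncSum N w z) atTop (𝓝 l) ↔
      Tendsto (fun q : ℚ => truncSum N w z q) atTop (𝓝 l) := by
  refine ⟨fun h => h.comp (tendsto_ratCast_atTop_iff.2 tendsto_id), fun h => ?_⟩
  choose q hq hq' using exists_rat_sublevel_eq hN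
  have hqt : Tendsto q atTop atTop :=
    tendsto_ratCast_atTop_iff.1 (tendsto_atTop_mono hq tendsto_id)
  exact (h.comp hqt).congr fun A => truncSum_eq_of_sublevel_eq w z (hq' A)

/-- The indices are ranked by the number of indices of strictly smaller norm; `F n` collects the
ranks below `n`, and `n A` is the cardinality of the sublevel set at `A`. Indices of equal norm
enter together, and infinitude of `ι` makes `n A` tend to infinity. -/
theorem exists_exhaustion_of_finite_sublevel [Infinite ι] (hN : ∀ A, {i | N i ≤ A}.Finite) :
    ∃ (F : ℕ → Finset ι) (n : ℝ → ℕ), Monotone F ∧ Tendsto n atTop atTop ∧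
      ∀ A, {i | N i ≤ A} = (F (n A) : Set ι) := by
  have hlt : ∀ A, {i | N i < A}.Finite := fun A => (hN A).subset fun i (hi : N i < A) => hi.le
  have hn : Tendsto (fun A => {i | N i ≤ A}.ncard) atTop atTop := by
    refine tendsto_atTop.2 fun m => ?_
    obtain ⟨G, hG⟩ := Infinite.exists_subset_card_eq ι m
    have hev : ∀ᶠ A in atTop, ∀ i ∈ G, N i ≤ A :=
      (Finset.eventually_all G).2 fun i _ => eventually_ge_atTop (N i)
    filter_upwards [hev] with A hA
    rw [← hG, ← Set.ncard_coe_finset G]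
    exact Set.ncard_le_ncard (fun i hi => hA i hi) (hN A)
  have key : ∀ A i, {j | N j < N i}.ncard < {i | N i ≤ A}.ncard ↔ N i ≤ A := by
    intro A i
    constructor
    · intro h
      by_contra hA
      refine absurd (Set.ncard_le_ncard (fun j (hj : N j ≤ A) => ?_) (hlt (N i))) (not_le.2 h)
      exact lt_of_le_of_lt hj (not_le.1 hA)
    · intro h
      refine Set.ncard_lt_ncard ⟨fun j (hj : N j < N i) => hj.le.trans h, fun hs => ?_⟩ (hN A)
      exact lt_irrefl (N i) (hs (show i ∈ {i | N i ≤ A} from h))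
  have hfin : ∀ n : ℕ, {i | {j | N j < N i}.ncard < n}.Finite := by
    intro n
    obtain ⟨A, hA⟩ := (hn.eventually_ge_atTop n).exists
    exact (hN A).subset fun i hi => (key A i).1 (lt_of_lt_of_le hi hA)
  refine ⟨fun n => (hfin n).toFinset, fun A => {i | N i ≤ A}.ncard, fun m n hmn => ?_, hn, ?_⟩
  · exact Set.Finite.toFinset_subset_toFinset.2 fun i hi => lt_of_lt_of_le hi hmn
  · intro A
    ext i
    simp [key]

end Deterministic

/-- The truncation set varies with the point, so the sum is written as a limit, along all finite
index sets, of sums of measurable cut-off terms; at each point these are eventually constant. -/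
theorem measurable_truncSum {ι Y : Type*} [Countable ι] [MeasurableSpace Y] {N w z : ι → Y → ℝ}
    (hN : ∀ i, Measurable (N i)) (hw : ∀ i, Measurable (w i)) (hz : ∀ i, Measurable (z i))
    (hfin : ∀ y A, {i | N i y ≤ A}.Finite) (A : ℝ) :
    Measurable fun y => truncSum (N · y) (w · y) (z · y) A := by
  classical
  have hm : ∀ i, Measurable fun y => if N i y ≤ A then w i y * z i y else 0 := fun i =>
    Measurable.ite (measurableSet_le (hN i) measurable_const) ((hw i).mul (hz i)) measurable_const
  refine measurable_of_tendsto_metrizable' (atTop : Filter (Finset ι))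
    (f := fun G y => ∑ i ∈ G, if N i y ≤ A then w i y * z i y else 0)
    (fun G => Finset.measurable_fun_sum _ fun i _ => hm i) ?_
  rw [tendsto_pi_nhds]
  intro y
  have hF : {i | N i y ≤ A} = ((hfin y A).toFinset : Set ι) := by simp
  rw [truncSum_eq_sum (w · y) (z · y) hF]
  have : ∑ i ∈ (hfin y A).toFinset, w i y * z i y =
      ∑ i ∈ (hfin y A).toFinset, if N i y ≤ A then w i y * z i y else 0 :=
    Finset.sum_congr rfl fun i hi => by rw [if_pos (by simpa using hi)]
  rw [this]
  refine tendsto_const_nhds.congr' ?_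
  filter_upwards [eventually_ge_atTop (hfin y A).toFinset] with G hG
  exact Finset.sum_subset hG fun i _ hi => if_neg (by simpa using hi)

/-! ### Random series with random weights -/

section Core

variable {ι X : Type*} [Infinite ι] [MeasurableSpace X]

theorem ae_exists_tendsto_truncSum {Ω : Type*} [MeasurableSpace Ω] {P : Measure Ω}
    [IsProbabilityMeasure P] {Z : ι → Ω → ℝ} {K : ℝ}
    (hZm : ∀ i, Measurable (Z i)) (hZi : iIndepFun Z P)
    (hZ0 : ∀ i, ∫ ω, Z i ω ∂P = 0) (hZK : ∀ i, ∀ᵐ ω ∂P, |Z i ω| ≤ K) (hK : 0 < K)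
    {N w : ι → ℝ} (hN : ∀ A, {i | N i ≤ A}.Finite) {B : ℝ} (hB : 0 < B)
    (hw : ∀ F : Finset ι, ∑ i ∈ F, w i ^ 2 ≤ B) :
    ∀ᵐ ω ∂P, ∃ l, Tendsto (truncSum N w (Z · ω)) atTop (𝓝 l) := by
  obtain ⟨F, n, hF, hn, hA⟩ := exists_exhaustion_of_finite_sublevel hN
  filter_upwards [ae_exists_tendsto_weighted_sum hZm hZi hZ0 hZK hK w hB hw F hF] with ω ⟨l, hl⟩
  exact ⟨l, (hl.comp hn).congr fun A => (truncSum_eq_sum w (Z · ω) (hA A)).symm⟩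

/-- Random series on the canonical space of the coefficients. -/
theorem exists_series_limit_canonical [Countable ι] {Q : Measure (ι → ℝ)} [IsProbabilityMeasure Q] {K : ℝ}
    (hK : 0 < K) (hQi : iIndepFun (fun (i : ι) (z : ι → ℝ) => z i) Q)
    (hQ0 : ∀ i, ∫ z, z i ∂Q = 0) (hQK : ∀ i, ∀ᵐ z ∂Q, |z i| ≤ K)
    (hflip : ∀ ε : ι → ℝ, (∀ i, ε i = 1 ∨ ε i = -1) → Q.map (fun z i => ε i * z i) = Q)
    {ν : Measure X} [IsProbabilityMeasure ν] {N w : ι → X → ℝ} {B : X → ℝ}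
    (hN : ∀ i, Measurable (N i)) (hw : ∀ i, Measurable (w i))
    (hfin : ∀ L A, {i | N i L ≤ A}.Finite) (hB : ∀ L, 0 < B L)
    (hwB : ∀ L, ∀ F : Finset ι, ∑ i ∈ F, w i L ^ 2 ≤ B L) :
    ∃ S : (ι → ℝ) × X → ℝ, Measurable S ∧
      (∀ᵐ x ∂Q.prod ν, Tendsto (truncSum (N · x.2) (w · x.2) x.1) atTop (𝓝 (S x))) ∧
      (Q.prod ν).map S = (Q.prod ν).map (fun x => -S x) ∧
      (∀ p : ℝ, 0 ≤ p → ∫⁻ x, ENNReal.ofReal (|S x| ^ p) ∂Q.prod ν ≤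
        ∫⁻ L, ENNReal.ofReal (p ^ p * (2 * Real.exp (1 / 2)) * (B L * K ^ 2) ^ (p / 2)) ∂ν) ∧
      (∀ i, ∀ p : ℝ, 0 ≤ p → ∫⁻ x, ENNReal.ofReal (|w i x.2 * x.1 i| ^ p) ∂Q.prod ν ≤
        2 * ∫⁻ x, ENNReal.ofReal (|S x| ^ p) ∂Q.prod ν) := by
  have hTm : ∀ A : ℝ, Measurable fun x : (ι → ℝ) × X => truncSum (N · x.2) (w · x.2) x.1 A := by
    intro A
    exact measurable_truncSum (Y := (ι → ℝ) × X) (N := fun i x => N i x.2)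
      (w := fun i x => w i x.2) (z := fun i x => x.1 i)
      (fun i => (hN i).comp measurable_snd) (fun i => (hw i).comp measurable_snd)
      (fun i => by fun_prop) (fun x A => hfin x.2 A) A
  have hset : MeasurableSet {x : (ι → ℝ) × X |
      ∃ l, Tendsto (truncSum (N · x.2) (w · x.2) x.1) atTop (𝓝 l)} := by
    have := StronglyMeasurable.measurableSet_exists_tendsto (l := (atTop : Filter ℚ))
      (f := fun (q : ℚ) (x : (ι → ℝ) × X) => truncSum (N · x.2) (w · x.2) x.1 q)
      fun q => (hTm q).stronglyMeasurable
    convert this using 2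
    ext x
    exact exists_congr fun l => tendsto_truncSum_iff_rat (hfin x.2) _ _
  -- By Fubini it suffices to have convergence for each fixed `L` and almost every coefficient
  -- sequence; this is why the convergence set had to be measurable.
  have hconv : ∀ᵐ x ∂Q.prod ν,
      ∃ l, Tendsto (truncSum (N · x.2) (w · x.2) x.1) atTop (𝓝 l) := by
    rw [Measure.ae_prod_iff_ae_ae hset]
    rw [Measure.ae_ae_comm (p := fun z L => ∃ l, Tendsto (truncSum (N · L) (w · L) z) atTop (𝓝 l))
      hset]
    exact ae_of_all _ fun L => ae_exists_tendsto_truncSum (fun i => measurable_pi_apply i) hQi hQ0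
      hQK hK (hfin L) (hB L) (hwB L)
  obtain ⟨S, hSm, hS⟩ := measurable_limit_of_tendsto_metrizable_ae (L := (atTop : Filter ℚ))
    (f := fun (q : ℚ) (x : (ι → ℝ) × X) => truncSum (N · x.2) (w · x.2) x.1 q)
    (fun q => (hTm q).aemeasurable)
    (hconv.mono fun x ⟨l, hl⟩ => ⟨l, (tendsto_truncSum_iff_rat (hfin x.2) _ _).1 hl⟩)
  have hS' : ∀ᵐ x ∂Q.prod ν, Tendsto (truncSum (N · x.2) (w · x.2) x.1) atTop (𝓝 (S x)) :=
    hS.mono fun x hx => (tendsto_truncSum_iff_rat (hfin x.2) _ _).2 hx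
  have hpres : ∀ ε : ι → ℝ, (∀ i, ε i = 1 ∨ ε i = -1) →
      MeasurePreserving (fun x : (ι → ℝ) × X => ((fun i => ε i * x.1 i, x.2) : (ι → ℝ) × X))
        (Q.prod ν) (Q.prod ν) := by
    intro ε hε
    have h1 : MeasurePreserving (fun (z : ι → ℝ) i => ε i * z i) Q Q :=
      ⟨by fun_prop, hflip ε hε⟩
    exact h1.prod (MeasurePreserving.id ν)
  refine ⟨S, hSm, hS', ?_, ?_, ?_⟩
  · have hp := hpres (fun _ => -1) fun _ => Or.inr rfl
    have hae : ∀ᵐ x ∂Q.prod ν, S ((fun i => -1 * x.1 i, x.2) : (ι → ℝ) × X) = -S x := by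
      filter_upwards [hS', hp.quasiMeasurePreserving.ae hS'] with x h1 h2
      refine tendsto_nhds_unique h2 (h1.neg.congr fun A => ?_)
      simp only [truncSum]
      rw [← finsum_mem_neg_distrib]
      · exact finsum_mem_congr rfl fun i _ => by ring
      · exact hfin x.2 A
    calc (Q.prod ν).map S = ((Q.prod ν).map
          (fun x : (ι → ℝ) × X => ((fun i => -1 * x.1 i, x.2) : (ι → ℝ) × X))).map S := by
            rw [hp.map_eq]
      _ = (Q.prod ν).map (fun x => S ((fun i => -1 * x.1 i, x.2) : (ι → ℝ) × X)) :=
            Measure.map_map hSm hp.measurable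
      _ = _ := Measure.map_congr hae
  · intro p hp
    -- The moments of the limit are bounded by Fatou's lemma from those of the partial sums, whose
    -- bounds for fixed `L` do not depend on the truncation.
    have hnat : ∀ᵐ x ∂Q.prod ν, Tendsto (fun n : ℕ =>
        ENNReal.ofReal (|truncSum (N · x.2) (w · x.2) x.1 n| ^ p)) atTop
        (𝓝 (ENNReal.ofReal (|S x| ^ p))) := by
      filter_upwards [hS'] with x hx
      refine ENNReal.tendsto_ofReal ?_
      exact ((hx.comp tendsto_natCast_atTop_atTop).abs).rpow_const (Or.inr hp)
    calc ∫⁻ x, ENNReal.ofReal (|S x| ^ p) ∂Q.prod ν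
        = ∫⁻ x, liminf (fun n : ℕ =>
            ENNReal.ofReal (|truncSum (N · x.2) (w · x.2) x.1 n| ^ p)) atTop ∂Q.prod ν :=
          lintegral_congr_ae (hnat.mono fun x hx => hx.liminf_eq.symm)
      _ ≤ liminf (fun n : ℕ => ∫⁻ x,
            ENNReal.ofReal (|truncSum (N · x.2) (w · x.2) x.1 n| ^ p) ∂Q.prod ν) atTop :=
          lintegral_liminf_le fun n => ((hTm n).abs.pow_const p).ennreal_ofReal
      _ ≤ liminf (fun _ : ℕ => ∫⁻ L, ENNReal.ofReal
            (p ^ p * (2 * Real.exp (1 / 2)) * (B L * K ^ 2) ^ (p / 2)) ∂ν) atTop := by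
          refine liminf_le_liminf (Eventually.of_forall fun n => ?_)
          rw [lintegral_prod_symm' _ ((hTm n).abs.pow_const p).ennreal_ofReal]
          refine lintegral_mono fun L => ?_
          have hF : {i | N i L ≤ (n : ℝ)} = ((hfin L n).toFinset : Set ι) := by simp
          simp only [truncSum_eq_sum (w · L) _ hF]
          exact lintegral_rpow_abs_weighted_sum_le (fun i => measurable_pi_apply i) hQi hQ0
            hQK hK _ (w · L) (hB L) hp (hwB L _)
      _ = _ := by simp
  · intro i p hp
    classical
    -- Reversing the sign of the `i`-th coefficient preserves the measure and changes `S` by exactly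
    -- twice the `i`-th term. Hence `|w_i z_i|` is at most the larger of `|S|` and its reflected
    -- copy, which have the same moments.
    set ε : ι → ℝ := fun j => if j = i then -1 else 1 with hε
    have hp' := hpres ε fun j => by by_cases h : j = i <;> simp [hε, h]
    have hae : ∀ᵐ x ∂Q.prod ν,
        S x - S ((fun j => ε j * x.1 j, x.2) : (ι → ℝ) × X) = 2 * (w i x.2 * x.1 i) := by
      filter_upwards [hS', hp'.quasiMeasurePreserving.ae hS'] with x h1 h2
      refine tendsto_nhds_unique (h1.sub h2) (tendsto_const_nhds.congr' ?_)
      filter_upwards [eventually_ge_atTop (N i x.2)] with A hA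
      have hF : {i | N i x.2 ≤ A} = ((hfin x.2 A).toFinset : Set ι) := by simp
      rw [truncSum_eq_sum _ _ hF, truncSum_eq_sum _ _ hF, ← Finset.sum_sub_distrib,
        Finset.sum_eq_single i]
      · simp [hε]; ring
      · intro j _ hj
        simp [hε, hj]
      · intro hi
        exact absurd (by simpa using hA) hi
    have hpt : ∀ᵐ x ∂Q.prod ν, ENNReal.ofReal (|w i x.2 * x.1 i| ^ p) ≤
        ENNReal.ofReal (|S x| ^ p) +
          ENNReal.ofReal (|S ((fun j => ε j * x.1 j, x.2) : (ι → ℝ) × X)| ^ p) := by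
      filter_upwards [hae] with x hx
      rw [← ENNReal.ofReal_add (by positivity) (by positivity)]
      refine ENNReal.ofReal_le_ofReal ?_
      set s' := S ((fun j => ε j * x.1 j, x.2) : (ι → ℝ) × X)
      have h1 : 2 * |w i x.2 * x.1 i| ≤ |S x| + |s'| := by
        rw [show 2 * |w i x.2 * x.1 i| = |S x - s'| by rw [hx, abs_mul]; norm_num]
        exact abs_sub _ _
      rcases le_total |S x| |s'| with h | h
      · have := Real.rpow_le_rpow (abs_nonneg _) (show |w i x.2 * x.1 i| ≤ |s'| by linarith) hp
        have h0 : 0 ≤ |S x| ^ p := by positivity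
        linarith
      · have := Real.rpow_le_rpow (abs_nonneg _) (show |w i x.2 * x.1 i| ≤ |S x| by linarith) hp
        have h0 : 0 ≤ |s'| ^ p := by positivity
        linarith
    have hm : Measurable fun x : (ι → ℝ) × X => ENNReal.ofReal (|S x| ^ p) :=
      (hSm.abs.pow_const p).ennreal_ofReal
    calc ∫⁻ x, ENNReal.ofReal (|w i x.2 * x.1 i| ^ p) ∂Q.prod ν
        ≤ ∫⁻ x, (ENNReal.ofReal (|S x| ^ p) +
          ENNReal.ofReal (|S ((fun j => ε j * x.1 j, x.2) : (ι → ℝ) × X)| ^ p)) ∂Q.prod ν :=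
          lintegral_mono_ae hpt
      _ = ∫⁻ x, ENNReal.ofReal (|S x| ^ p) ∂Q.prod ν +
          ∫⁻ x, ENNReal.ofReal (|S ((fun j => ε j * x.1 j, x.2) : (ι → ℝ) × X)| ^ p) ∂Q.prod ν :=
          lintegral_add_left hm _
      _ = _ := by
          rw [hp'.lintegral_comp hm, two_mul]

end Core

theorem integral_eq_zero_of_map_neg_eq {Ω : Type*} [MeasurableSpace Ω] {P : Measure Ω} {f : Ω → ℝ}
    (hf : AEMeasurable f P) (h : P.map f = P.map fun ω => -f ω) : ∫ ω, f ω ∂P = 0 := by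
  have h1 : ∫ x, x ∂P.map f = ∫ x, x ∂P.map fun ω => -f ω := by rw [h]
  rw [integral_map hf (by fun_prop), integral_map (φ := fun ω => -f ω) hf.neg (by fun_prop), integral_neg] at h1
  linarith

/-- Random series `∑ w i L * Z i ω` with independent symmetric bounded coefficients `Z i`, summed in
the order of increasing `N i L`: almost sure convergence, symmetry of the law of the limit, and
two-sided control of its moments. -/
theorem exists_series_limit {ι X Ω : Type*} [Countable ι] [Infinite ι] [MeasurableSpace X]
    [MeasurableSpace Ω] {P : Measure Ω} [IsProbabilityMeasure P] {Z : ι → Ω → ℝ} {K : ℝ}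
    (hZm : ∀ i, Measurable (Z i)) (hZi : iIndepFun Z P)
    (hZs : ∀ i, P.map (Z i) = P.map fun ω => -Z i ω)
    (hK : 0 < K) (hZK : ∀ i, ∀ᵐ ω ∂P, |Z i ω| ≤ K)
    {ν : Measure X} [IsProbabilityMeasure ν] {N w : ι → X → ℝ} {B : X → ℝ}
    (hN : ∀ i, AEMeasurable (N i) ν) (hw : ∀ i, AEMeasurable (w i) ν)
    (hfin : ∀ᵐ L ∂ν, ∀ A, {i | N i L ≤ A}.Finite) (hB : ∀ L, 0 < B L)
    (hwB : ∀ᵐ L ∂ν, ∀ F : Finset ι, ∑ i ∈ F, w i L ^ 2 ≤ B L) :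
    ∃ S : Ω × X → ℝ, AEMeasurable S (P.prod ν) ∧
      (∀ᵐ x ∂P.prod ν, Tendsto (truncSum (N · x.2) (w · x.2) (Z · x.1)) atTop (𝓝 (S x))) ∧
      (P.prod ν).map S = (P.prod ν).map (fun x => -S x) ∧
      (∀ p : ℝ, 0 ≤ p → ∫⁻ x, ENNReal.ofReal (|S x| ^ p) ∂P.prod ν ≤
        ∫⁻ L, ENNReal.ofReal (p ^ p * (2 * Real.exp (1 / 2)) * (B L * K ^ 2) ^ (p / 2)) ∂ν) ∧
      (∀ i, ∀ p : ℝ, 0 ≤ p → ∫⁻ x, ENNReal.ofReal (|w i x.2 * Z i x.1| ^ p) ∂P.prod ν ≤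
        2 * ∫⁻ x, ENNReal.ofReal (|S x| ^ p) ∂P.prod ν) := by
  classical
  have hgood : ∀ᵐ L ∂ν, (∀ A, {i | N i L ≤ A}.Finite) ∧
      (∀ F : Finset ι, ∑ i ∈ F, w i L ^ 2 ≤ B L) ∧ (∀ i, N i L = (hN i).mk _ L) ∧
      ∀ i, w i L = (hw i).mk _ L := by
    filter_upwards [hfin, hwB, ae_all_iff.2 fun i => (hN i).ae_eq_mk,
      ae_all_iff.2 fun i => (hw i).ae_eq_mk] with L h1 h2 h3 h4 using ⟨h1, h2, h3, h4⟩
  obtain ⟨E, hE, hEm, hE0⟩ := exists_measurable_superset_of_null (ae_iff.1 hgood)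
  have hgE : ∀ L ∉ E, (∀ A, {i | N i L ≤ A}.Finite) ∧
      (∀ F : Finset ι, ∑ i ∈ F, w i L ^ 2 ≤ B L) ∧ (∀ i, N i L = (hN i).mk _ L) ∧
      ∀ i, w i L = (hw i).mk _ L := fun L hL => by_contra fun h => hL (hE h)
  have hEae : ∀ᵐ L ∂ν, L ∉ E := measure_eq_zero_iff_ae_notMem.1 hE0
  obtain ⟨e, he⟩ := exists_injective_nat ι
  -- On the null set `E` the norms are replaced by an injective enumeration, whose sublevel sets are
  -- finite, and the weights by `0`. The hypotheses then hold everywhere with measurable data, as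
  -- the canonical version demands.
  let N' : ι → X → ℝ := fun i => E.piecewise (fun _ => (e i : ℝ)) ((hN i).mk _)
  let w' : ι → X → ℝ := fun i => E.piecewise (fun _ => 0) ((hw i).mk _)
  have hN'eq : ∀ L ∉ E, (N' · L) = (N · L) := fun L hL => by
    funext i; simp only [N', Set.piecewise_eq_of_notMem _ _ _ hL, (hgE L hL).2.2.1 i]
  have hw'eq : ∀ L ∉ E, (w' · L) = (w · L) := fun L hL => by
    funext i; simp only [w', Set.piecewise_eq_of_notMem _ _ _ hL, (hgE L hL).2.2.2 i]
  have hfin' : ∀ L A, {i | N' i L ≤ A}.Finite := by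
    intro L A
    by_cases hL : L ∈ E
    · have : {i | N' i L ≤ A} = e ⁻¹' {n : ℕ | (n : ℝ) ≤ A} := by
        ext i; simp [N', Set.piecewise_eq_of_mem _ _ _ hL]
      rw [this]
      refine Set.Finite.preimage he.injOn ((Set.finite_Iic ⌊A⌋₊).subset fun n hn => ?_)
      exact Nat.le_floor hn
    · have h : ∀ i, N' i L = N i L := congrFun (hN'eq L hL)
      simp only [h]
      exact (hgE L hL).1 A
  have hwB' : ∀ L, ∀ F : Finset ι, ∑ i ∈ F, w' i L ^ 2 ≤ B L := by
    intro L F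
    by_cases hL : L ∈ E
    · simp [w', Set.piecewise_eq_of_mem _ _ _ hL, (hB L).le]
    · have h : ∀ i, w' i L = w i L := congrFun (hw'eq L hL)
      simp only [h]
      exact (hgE L hL).2.1 F
  have : ∀ i, IsProbabilityMeasure (P.map (Z i)) := fun i =>
    Measure.isProbabilityMeasure_map (hZm i).aemeasurable
  -- Independence says that the joint law is the product law. On this product space a sign reversal
  -- is an actual map, while no such map need exist on `Ω`.
  have hlaw := hZi.map_fun_eq_infinitePi_map hZm
  set Q : Measure (ι → ℝ) := Measure.infinitePi fun i => P.map (Z i) with hQ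
  have hZp : MeasurePreserving (fun ω i => Z i ω) P Q := ⟨by fun_prop, hlaw⟩
  have hev : ∀ i, MeasurePreserving (fun z : ι → ℝ => z i) Q (P.map (Z i)) := fun i =>
    measurePreserving_eval_infinitePi _ i
  have hQi : iIndepFun (fun (i : ι) (z : ι → ℝ) => z i) Q :=
    iIndepFun_infinitePi (P := fun i => P.map (Z i)) (X := fun _ x => x) fun i => measurable_id
  have hQ0 : ∀ i, ∫ z, z i ∂Q = 0 := fun i => by
    have h := integral_map (μ := Q) (φ := fun z : ι → ℝ => z i) (f := fun x : ℝ => x)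
      (measurable_pi_apply i).aemeasurable (by fun_prop)
    rw [(hev i).map_eq, integral_map (hZm i).aemeasurable (by fun_prop)] at h
    rw [← h]
    exact integral_eq_zero_of_map_neg_eq (hZm i).aemeasurable (hZs i)
  have hQK : ∀ i, ∀ᵐ z ∂Q, |z i| ≤ K := fun i => by
    refine (hev i).quasiMeasurePreserving.ae (p := fun x => |x| ≤ K) ?_
    exact (ae_map_iff (hZm i).aemeasurable
      (measurableSet_le (measurable_id (α := ℝ)).abs measurable_const)).2 (hZK i)
  have hflip : ∀ ε : ι → ℝ, (∀ i, ε i = 1 ∨ ε i = -1) → Q.map (fun z i => ε i * z i) = Q := by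
    intro ε hε
    rw [hQ, Measure.infinitePi_map_pi (μ := fun i => P.map (Z i))
      (f := fun i (x : ℝ) => ε i * x) fun i => by fun_prop]
    congr 1
    funext i
    rcases hε i with h | h
    · simp [h]
    · simp only [h, neg_one_mul]
      rw [Measure.map_map (by fun_prop) (hZm i)]
      exact (hZs i).symm
  obtain ⟨S, hSm, hS1, hS2, hS3, hS4⟩ := exists_series_limit_canonical hK hQi hQ0 hQK hflip (ν := ν)
    (N := N') (w := w') (B := B)
    (fun i => Measurable.piecewise hEm measurable_const (hN i).measurable_mk)
    (fun i => Measurable.piecewise hEm measurable_const (hw i).measurable_mk) hfin' hB hwB'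
  have hΦ : MeasurePreserving (fun x : Ω × X => ((fun i => Z i x.1, x.2) : (ι → ℝ) × X))
      (P.prod ν) (Q.prod ν) := hZp.prod (MeasurePreserving.id ν)
  have hEae' : ∀ᵐ x ∂P.prod ν, x.2 ∉ E :=
    Measure.quasiMeasurePreserving_snd.ae hEae
  have hpow : ∀ p : ℝ, ∫⁻ x, ENNReal.ofReal (|S ((fun i => Z i x.1, x.2) : (ι → ℝ) × X)| ^ p)
      ∂P.prod ν = ∫⁻ x, ENNReal.ofReal (|S x| ^ p) ∂Q.prod ν := fun p =>
    hΦ.lintegral_comp (f := fun x => ENNReal.ofReal (|S x| ^ p))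
      ((hSm.abs.pow_const p).ennreal_ofReal)
  refine ⟨fun x => S ((fun i => Z i x.1, x.2) : (ι → ℝ) × X),
    (hSm.comp hΦ.measurable).aemeasurable, ?_, ?_, ?_, ?_⟩
  · filter_upwards [hΦ.quasiMeasurePreserving.ae hS1, hEae'] with x hx hxE
    rw [← hN'eq x.2 hxE, ← hw'eq x.2 hxE]
    exact hx
  · have h1 := Measure.map_map (μ := P.prod ν) hSm hΦ.measurable
    have h2 := Measure.map_map (μ := P.prod ν) hSm.neg hΦ.measurable
    rw [hΦ.map_eq] at h1 h2
    exact h1.symm.trans (hS2.trans h2)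
  · intro p hp
    rw [hpow p]
    exact hS3 p hp
  · intro i p hp
    rw [hpow p]
    refine le_trans (le_of_eq ?_) (hS4 i p hp)
    have hm : Measurable fun x : (ι → ℝ) × X => ENNReal.ofReal (|w' i x.2 * x.1 i| ^ p) := by
      have h1 : Measurable (w' i) :=
        Measurable.piecewise hEm measurable_const (hw i).measurable_mk
      have h2 : Measurable fun x : (ι → ℝ) × X => w' i x.2 * x.1 i :=
        (h1.comp measurable_snd).mul (by fun_prop)
      exact (h2.abs.pow_const p).ennreal_ofReal
    rw [← hΦ.lintegral_comp hm]
    refine lintegral_congr_ae ?_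
    filter_upwards [hEae'] with x hx
    rw [congrFun (hw'eq x.2 hx) i]

/-- Two independent copies of an independent family form an independent family. -/
theorem iIndepFun_sumElim_prod {ι Ω : Type*} [MeasurableSpace Ω] {P : Measure Ω}
    [IsProbabilityMeasure P] {Z : ι → Ω → ℝ} (hZm : ∀ i, Measurable (Z i)) (hZi : iIndepFun Z P) :
    iIndepFun (fun (i : ι ⊕ ι) (x : Ω × Ω) => Sum.elim (Z · x.1) (Z · x.2) i) (P.prod P) := by
  classical
  rw [iIndepFun_iff_measure_inter_preimage_eq_mul]
  intro s sets hs
  have hZ' := iIndepFun_iff_measure_inter_preimage_eq_mul.1 hZi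
  have hset : (⋂ i ∈ s, (fun x : Ω × Ω => Sum.elim (Z · x.1) (Z · x.2) i) ⁻¹' sets i) =
      (⋂ i ∈ s.toLeft, Z i ⁻¹' sets (Sum.inl i)) ×ˢ (⋂ i ∈ s.toRight, Z i ⁻¹' sets (Sum.inr i)) := by
    ext x
    simp [Set.mem_prod]
  have h1 : ∀ i, Measurable fun x : Ω × Ω => Sum.elim (Z · x.1) (Z · x.2) (Sum.inl i : ι ⊕ ι) :=
    fun i => (hZm i).comp measurable_fst
  rw [hset, Measure.prod_prod, hZ' _ (fun i hi => hs (Sum.inl i) (Finset.mem_toLeft.1 hi)),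
    hZ' _ (fun i hi => hs (Sum.inr i) (Finset.mem_toRight.1 hi)),
    ← Finset.toLeft_disjSum_toRight (u := s), Finset.prod_disjSum]
  simp only [Finset.toLeft_disjSum, Finset.toRight_disjSum]
  congr 1
  · refine Finset.prod_congr rfl fun i _ => ?_
    rw [show (fun x : Ω × Ω => Sum.elim (Z · x.1) (Z · x.2) (Sum.inl i : ι ⊕ ι)) ⁻¹' sets (Sum.inl i)
      = (Z i ⁻¹' sets (Sum.inl i)) ×ˢ Set.univ by ext x; simp, Measure.prod_prod]
    simp
  · refine Finset.prod_congr rfl fun i _ => ?_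
    rw [show (fun x : Ω × Ω => Sum.elim (Z · x.1) (Z · x.2) (Sum.inr i : ι ⊕ ι)) ⁻¹' sets (Sum.inr i)
      = Set.univ ×ˢ (Z i ⁻¹' sets (Sum.inr i)) by ext x; simp, Measure.prod_prod]
    simp

/-! ### The radius of curvature as a function of the normal -/

namespace IsAnalyticOval

variable {D : Set Plane} {c : ℝ → Plane} {T : ℝ}

theorem continuous (hD : IsAnalyticOval D c T) : Continuous c :=
  continuousOn_univ.1 hD.analytic.continuousOn

theorem continuous_deriv (hD : IsAnalyticOval D c T) : Continuous (deriv c) :=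
  continuousOn_univ.1 hD.analytic.deriv.continuousOn

theorem continuous_deriv_deriv (hD : IsAnalyticOval D c T) : Continuous (deriv (deriv c)) :=
  continuousOn_univ.1 hD.analytic.deriv.deriv.continuousOn

theorem continuous_curvatureRadius (hD : IsAnalyticOval D c T) :
    Continuous (curvatureRadius c) := by
  have h1 := hD.continuous_deriv
  have h2 := hD.continuous_deriv_deriv
  have h3 : Continuous (curveDet c) := by
    unfold curveDet
    fun_prop
  exact (h1.norm.pow 3).div h3.abs fun s => abs_ne_zero.2 (hD.curved s)

theorem curvatureRadius_pos (hD : IsAnalyticOval D c T) (s : ℝ) : 0 < curvatureRadius c s :=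
  div_pos (pow_pos (norm_pos_iff.2 (hD.regular s)) 3) (abs_pos.2 (hD.curved s))

theorem periodic_curvatureRadius (hD : IsAnalyticOval D c T) :
    Function.Periodic (curvatureRadius c) T := by
  have hper : ∀ f : ℝ → Plane, Function.Periodic f T → Function.Periodic (deriv f) T := by
    intro f hf s
    rw [← deriv_comp_add_const]
    exact congrArg (deriv · s) (funext hf)
  have h1 := hper c hD.periodic
  have h2 := hper _ h1
  intro s
  simp only [curvatureRadius, curveDet, h1 s, h2 s]

theorem exists_mem_Icc (hD : IsAnalyticOval D c T) (s : ℝ) : ∃ t ∈ Set.Icc 0 T,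
    c s = c t ∧ curvatureRadius c s = curvatureRadius c t := by
  obtain ⟨t, ht, h⟩ := Function.Periodic.exists_mem_Ico₀
    (f := fun s => (c s, curvatureRadius c s)) (c := T) (fun s => by
      simp only [hD.periodic s, hD.periodic_curvatureRadius s]) hD.period_pos s
  exact ⟨t, ⟨ht.1, ht.2.le⟩, congrArg Prod.fst h, congrArg Prod.snd h⟩

theorem exists_curvatureRadius_bounds (hD : IsAnalyticOval D c T) :
    ∃ m M : ℝ, 0 < m ∧ ∀ s, m ≤ curvatureRadius c s ∧ curvatureRadius c s ≤ M := by
  have hne : (Set.Icc 0 T).Nonempty := ⟨0, le_rfl, hD.period_pos.le⟩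
  obtain ⟨a, _, ha⟩ := isCompact_Icc.exists_isMinOn hne hD.continuous_curvatureRadius.continuousOn
  obtain ⟨b, _, hb⟩ := isCompact_Icc.exists_isMaxOn hne hD.continuous_curvatureRadius.continuousOn
  refine ⟨curvatureRadius c a, curvatureRadius c b, hD.curvatureRadius_pos a, fun s => ?_⟩
  obtain ⟨t, ht, -, h⟩ := hD.exists_mem_Icc s
  rw [h]
  exact ⟨ha ht, hb ht⟩

/-- A point of `D` maximizing the linear form `⟨·, u⟩` cannot be interior, since a small move along
`u` would increase the form; it therefore lies on the curve. -/
theorem exists_isOuterUnitNormal (hD : IsAnalyticOval D c T) {u : Plane} (hu : ‖u‖ = 1) :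
    ∃ s, IsOuterUnitNormal D (c s) u := by
  obtain ⟨x, hx, hmax⟩ := hD.compact.exists_isMaxOn ⟨0, hD.zero_mem⟩
    (f := fun y : Plane => inner ℝ y u) (by fun_prop)
  have hfr : x ∈ frontier D := by
    refine ⟨subset_closure hx, fun hint => ?_⟩
    have hcont : Tendsto (fun t : ℝ => x + t • u) (𝓝[>] 0) (𝓝 x) := by
      have : Continuous fun t : ℝ => x + t • u := by fun_prop
      simpa using (this.tendsto 0).mono_left nhdsWithin_le_nhds
    obtain ⟨t, ht, ht0⟩ := ((hcont.eventually (mem_interior_iff_mem_nhds.1 hint)).and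
      self_mem_nhdsWithin).exists
    have h := hmax ht
    simp only [Set.mem_ofPred_eq, inner_add_left, inner_smul_left, real_inner_self_eq_norm_sq, hu] at h
    simp only [conj_trivial] at h
    have : (0 : ℝ) < t := ht0
    linarith
  rw [hD.frontier_eq] at hfr
  obtain ⟨s, rfl⟩ := hfr
  refine ⟨s, hu, fun y hy => ?_⟩
  rw [inner_sub_left]
  exact sub_nonpos.2 (hmax hy)

theorem mem (hD : IsAnalyticOval D c T) (s : ℝ) : c s ∈ D := by
  have : c s ∈ frontier D := by rw [hD.frontier_eq]; exact ⟨s, rfl⟩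
  exact hD.compact.isClosed.frontier_subset this

theorem eq_of_isOuterUnitNormal (hD : IsAnalyticOval D c T) {u x y : Plane} (hx : x ∈ D)
    (hy : y ∈ D) (hxu : IsOuterUnitNormal D x u) (hyu : IsOuterUnitNormal D y u) : x = y := by
  by_contra hne
  -- The midpoint of two distinct contact points is interior, so it can be pushed along `u` inside
  -- `D`; adding the two support inequalities there gives a contradiction.
  have hmid := hD.strictConvex hx hy hne (a := 1 / 2) (b := 1 / 2) (by norm_num) (by norm_num)
    (by norm_num)
  set z : Plane := (1 / 2 : ℝ) • x + (1 / 2 : ℝ) • y with hz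
  have hcont : Tendsto (fun t : ℝ => z + t • u) (𝓝[>] 0) (𝓝 z) := by
    have : Continuous fun t : ℝ => z + t • u := by fun_prop
    simpa using (this.tendsto 0).mono_left nhdsWithin_le_nhds
  obtain ⟨t, ht, ht0⟩ := ((hcont.eventually (mem_interior_iff_mem_nhds.1 hmid)).and
    self_mem_nhdsWithin).exists
  have h1 := hxu.2 _ ht
  have h2 := hyu.2 _ ht
  have h3 : (0 : ℝ) < t := ht0
  have h4 : (z + t • u - x) + (z + t • u - y) = (2 * t) • u := by rw [hz]; module
  have h5 : inner ℝ ((2 * t) • u) u ≤ (0 : ℝ) := by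
    rw [← h4, inner_add_left]
    linarith
  rw [inner_smul_left, real_inner_self_eq_norm_sq, hxu.1] at h5
  simp only [conj_trivial] at h5
  linarith

/-- This makes the arbitrary choice of parameter in `normalRadius` harmless: the contact point is
unique, and simplicity of the curve fixes the parameter up to the period. -/
theorem curvatureRadius_eq (hD : IsAnalyticOval D c T) {u : Plane} {s t : ℝ}
    (hs : IsOuterUnitNormal D (c s) u) (ht : IsOuterUnitNormal D (c t) u) :
    curvatureRadius c s = curvatureRadius c t := by
  have h := hD.eq_of_isOuterUnitNormal (hD.mem s) (hD.mem t) hs ht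
  have hper : Function.Periodic (fun s => (c s, curvatureRadius c s)) T := fun s => by
    simp only [hD.periodic s, hD.periodic_curvatureRadius s]
  obtain ⟨s', hs', h1⟩ := hper.exists_mem_Ico₀ hD.period_pos s
  obtain ⟨t', ht', h2⟩ := hper.exists_mem_Ico₀ hD.period_pos t
  simp only [Prod.mk.injEq] at h1 h2
  have : s' = t' := hD.simple hs' ht' (by rw [← h1.1, ← h2.1, h])
  rw [h1.2, h2.2, this]

theorem normalRadius_eq (hD : IsAnalyticOval D c T) {ξ : Plane} {s : ℝ}
    (hs : IsOuterUnitNormal D (c s) (‖ξ‖⁻¹ • ξ)) : normalRadius D c ξ = curvatureRadius c s := by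
  have h : ∃ s : ℝ, IsOuterUnitNormal D (c s) (‖ξ‖⁻¹ • ξ) := ⟨s, hs⟩
  rw [normalRadius, dif_pos h]
  exact hD.curvatureRadius_eq h.choose_spec hs

theorem norm_inv_smul {ξ : Plane} (hξ : ξ ≠ 0) : ‖‖ξ‖⁻¹ • ξ‖ = 1 := by
  rw [norm_smul, norm_inv, norm_norm, inv_mul_cancel₀ (norm_ne_zero_iff.2 hξ)]

theorem normalRadius_zero : normalRadius D c 0 = 0 := by
  rw [normalRadius, dif_neg]
  rintro ⟨s, hs, -⟩
  simp at hs

theorem exists_normalRadius_bounds (hD : IsAnalyticOval D c T) :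
    ∃ m M : ℝ, 0 < m ∧ 0 < M ∧ (∀ ξ ≠ 0, m ≤ normalRadius D c ξ) ∧
      ∀ ξ, 0 ≤ normalRadius D c ξ ∧ normalRadius D c ξ ≤ M := by
  obtain ⟨m, M, hm, h⟩ := hD.exists_curvatureRadius_bounds
  have hM : 0 < M := hm.trans_le ((h 0).1.trans (h 0).2)
  refine ⟨m, M, hm, hM, fun ξ hξ => ?_, fun ξ => ?_⟩
  · obtain ⟨s, hs⟩ := hD.exists_isOuterUnitNormal (norm_inv_smul hξ)
    rw [hD.normalRadius_eq hs]
    exact (h s).1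
  · by_cases hξ : ξ = 0
    · rw [hξ, normalRadius_zero]
      exact ⟨le_rfl, hM.le⟩
    · obtain ⟨s, hs⟩ := hD.exists_isOuterUnitNormal (norm_inv_smul hξ)
      rw [hD.normalRadius_eq hs]
      exact ⟨(hD.curvatureRadius_pos s).le, (h s).2⟩

/-- Without the normalization the condition is visibly closed jointly in the point and in `ξ`. -/
theorem isOuterUnitNormal_iff {x ξ : Plane} (hξ : ξ ≠ 0) :
    IsOuterUnitNormal D x (‖ξ‖⁻¹ • ξ) ↔ ∀ y ∈ D, inner ℝ (y - x) ξ ≤ (0 : ℝ) := by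
  have h0 : 0 < ‖ξ‖⁻¹ := inv_pos.2 (norm_pos_iff.2 hξ)
  refine ⟨fun h y hy => ?_, fun h => ⟨norm_inv_smul hξ, fun y hy => ?_⟩⟩
  · have := h.2 y hy
    rw [inner_smul_right] at this
    exact nonpos_of_mul_nonpos_right this h0
  · rw [inner_smul_right]
    exact mul_nonpos_of_nonneg_of_nonpos h0.le (h y hy)

theorem isClosed_normal_pairs (hD : IsAnalyticOval D c T) (a : ℝ) :
    IsClosed {p : Plane × Set.Icc 0 T | (∀ y ∈ D, inner ℝ (y - c p.2) p.1 ≤ (0 : ℝ)) ∧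
      curvatureRadius c p.2 ≤ a} := by
  have hsnd : Continuous fun p : Plane × Set.Icc 0 T => (p.2 : ℝ) :=
    continuous_subtype_val.comp continuous_snd
  have h1 : IsClosed {p : Plane × Set.Icc 0 T | curvatureRadius c p.2 ≤ a} :=
    isClosed_le (hD.continuous_curvatureRadius.comp hsnd) continuous_const
  have h2 : ∀ y, IsClosed {p : Plane × Set.Icc 0 T | inner ℝ (y - c p.2) p.1 ≤ (0 : ℝ)} := fun y =>
    isClosed_le ((continuous_const.sub (hD.continuous.comp hsnd)).inner continuous_fst)
      continuous_const
  have h3 := (isClosed_biInter fun y (_ : y ∈ D) => h2 y).inter h1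
  convert h3 using 1
  ext p
  simp

theorem measurable_normalRadius (hD : IsAnalyticOval D c T) : Measurable (normalRadius D c) := by
  refine measurable_of_Iic fun a => ?_
  -- Away from `0` a sublevel set of `normalRadius` is the projection of a closed set along the
  -- compact parameter interval, hence closed relative to the complement of `0`.
  have hcl := isClosedMap_fst_of_compactSpace _ (hD.isClosed_normal_pairs a)
  have hset : normalRadius D c ⁻¹' Set.Iic a \ {0} =
      (Prod.fst '' {p : Plane × Set.Icc 0 T | (∀ y ∈ D, inner ℝ (y - c p.2) p.1 ≤ (0 : ℝ)) ∧
        curvatureRadius c p.2 ≤ a}) \ {0} := by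
    ext ξ
    refine and_congr_left fun hξ => ?_
    have hξ : ξ ≠ 0 := hξ
    constructor
    · intro (hu : normalRadius D c ξ ≤ a)
      obtain ⟨s, hs⟩ := hD.exists_isOuterUnitNormal (norm_inv_smul hξ)
      obtain ⟨t, ht, h1, h2⟩ := hD.exists_mem_Icc s
      rw [hD.normalRadius_eq hs, h2] at hu
      rw [h1] at hs
      exact ⟨(ξ, ⟨t, ht⟩), ⟨(isOuterUnitNormal_iff hξ).1 hs, hu⟩, rfl⟩
    · rintro ⟨⟨ξ', t⟩, ⟨h1, h2⟩, rfl⟩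
      change normalRadius D c ξ' ≤ a
      rw [hD.normalRadius_eq ((isOuterUnitNormal_iff hξ).2 h1)]
      exact h2
  have h1 : MeasurableSet (normalRadius D c ⁻¹' Set.Iic a \ {0}) := by
    rw [hset]
    exact hcl.measurableSet.diff (measurableSet_singleton 0)
  have h2 : MeasurableSet (normalRadius D c ⁻¹' Set.Iic a ∩ {0}) :=
    (Set.subsingleton_singleton.anti Set.inter_subset_right).measurableSet
  rw [← Set.sdiff_union_inter (normalRadius D c ⁻¹' Set.Iic a) {0}]
  exact h1.union h2

end IsAnalyticOval

/-! ### Plane determinants and the quotient space of lattices -/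

/-- The determinant of two vectors of the plane. -/
def det2 (v w : Plane) : ℝ := v 0 * w 1 - v 1 * w 0

theorem Plane.inner_eq (v w : Plane) : inner ℝ v w = v 0 * w 0 + v 1 * w 1 := by
  simp [PiLp.inner_apply, Fin.sum_univ_two, mul_comm]

theorem Plane.norm_sq_eq (v : Plane) : ‖v‖ ^ 2 = v 0 ^ 2 + v 1 ^ 2 := by
  rw [← real_inner_self_eq_norm_sq, Plane.inner_eq]; ring

theorem Plane.ext_coord {v w : Plane} (h0 : v 0 = w 0) (h1 : v 1 = w 1) : v = w := by
  ext i; fin_cases i <;> assumption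

theorem det2_sq_add_inner_sq (v w : Plane) :
    det2 v w ^ 2 + (inner ℝ v w) ^ 2 = ‖v‖ ^ 2 * ‖w‖ ^ 2 := by
  rw [Plane.inner_eq, Plane.norm_sq_eq, Plane.norm_sq_eq, det2]; ring

theorem abs_det2_le (v w : Plane) : |det2 v w| ≤ ‖v‖ * ‖w‖ := by
  refine abs_le_of_sq_le_sq ?_ (by positivity)
  have := det2_sq_add_inner_sq v w
  nlinarith [sq_nonneg (inner ℝ v w : ℝ)]

theorem linearIndependent_iff_det2 (v : Fin 2 → Plane) :
    LinearIndependent ℝ v ↔ det2 (v 0) (v 1) ≠ 0 := by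
  have : v = ![v 0, v 1] := by ext i; fin_cases i <;> rfl
  rw [this, LinearIndependent.pair_iff]
  simp only [Matrix.cons_val_zero, Matrix.cons_val_one]
  generalize v 0 = x
  generalize v 1 = y
  constructor
  · intro h hd
    have h1 := h (y 1) (-x 1) (Plane.ext_coord (by simp; unfold det2 at hd; linarith)
      (by simp; ring))
    have h2 := h (y 0) (-x 0) (Plane.ext_coord (by simp; ring)
      (by simp; unfold det2 at hd; linarith))
    have hx : x = 0 := Plane.ext_coord (by simpa using h2.2) (by simpa using h1.2)
    have := h 1 0 (by simp [hx])
    simp at this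
  · intro hd s t hst
    have h0 : s * x 0 + t * y 0 = 0 := by simpa using congrArg (fun v : Plane => v 0) hst
    have h1 : s * x 1 + t * y 1 = 0 := by simpa using congrArg (fun v : Plane => v 1) hst
    constructor
    · have : s * det2 x y = 0 := by unfold det2; linear_combination y 1 * h0 - y 0 * h1
      exact (mul_eq_zero.1 this).resolve_right hd
    · have : t * det2 x y = 0 := by unfold det2; linear_combination x 0 * h1 - x 1 * h0
      exact (mul_eq_zero.1 this).resolve_right hd

theorem det2_ne_zero_left {v w : Plane} (h : det2 v w ≠ 0) : v ≠ 0 := by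
  rintro rfl; simp [det2] at h

theorem det2_ne_zero_right {v w : Plane} (h : det2 v w ≠ 0) : w ≠ 0 := by
  rintro rfl; simp [det2] at h

instance instMeasurableSpaceSL2 : MeasurableSpace (Matrix.SpecialLinearGroup (Fin 2) ℝ) := borel _

instance instBorelSpaceSL2 : BorelSpace (Matrix.SpecialLinearGroup (Fin 2) ℝ) := ⟨rfl⟩

instance instPolishSpaceSL2 : PolishSpace (Matrix.SpecialLinearGroup (Fin 2) ℝ) :=
  have : PolishSpace (Matrix (Fin 2) (Fin 2) ℝ) :=
    inferInstanceAs (PolishSpace (Fin 2 → Fin 2 → ℝ))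
  Matrix.SpecialLinearGroup.isClosedEmbedding_val.polishSpace

namespace LatticeSpace

/-- The point with integer coordinates `k` of the lattice `M ℤ²`. -/
noncomputable def point (M : Matrix.SpecialLinearGroup (Fin 2) ℝ) (k : Fin 2 → ℤ) : Plane :=
  WithLp.toLp 2 (M.1 *ᵥ fun i => (k i : ℝ))

theorem point_apply (M : Matrix.SpecialLinearGroup (Fin 2) ℝ) (k : Fin 2 → ℤ) (i : Fin 2) :
    point M k i = M.1 i 0 * k 0 + M.1 i 1 * k 1 := by
  simp only [point, Matrix.mulVec, dotProduct, Fin.sum_univ_two]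

theorem mem_vectors_mk {M : Matrix.SpecialLinearGroup (Fin 2) ℝ} {v : Plane} :
    v ∈ vectors (mk M) ↔ ∃ k, point M k = v := by
  rw [vectors_mk]; rfl

theorem mk_surjective : Function.Surjective mk := QuotientGroup.mk_surjective

theorem det_eq (M : Matrix.SpecialLinearGroup (Fin 2) ℝ) :
    M.1 0 0 * M.1 1 1 - M.1 0 1 * M.1 1 0 = 1 := by
  rw [← Matrix.det_fin_two]; exact M.2

theorem continuous_point (k : Fin 2 → ℤ) : Continuous fun M => point M k := by
  refine (PiLp.continuous_toLp 2 _).comp ?_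
  exact Continuous.matrix_mulVec continuous_subtype_val continuous_const

theorem point_injective (M : Matrix.SpecialLinearGroup (Fin 2) ℝ) :
    Function.Injective (point M) := by
  intro k l h
  have h0 := congrArg (fun v : Plane => v 0) h
  have h1 := congrArg (fun v : Plane => v 1) h
  simp only [point_apply] at h0 h1
  have hd := det_eq M
  funext i
  fin_cases i
  · have : (k 0 : ℝ) = l 0 := by linear_combination M.1 1 1 * h0 - M.1 0 1 * h1 - (k 0 - l 0) * hd
    exact_mod_cast this
  · have : (k 1 : ℝ) = l 1 := by linear_combination M.1 0 0 * h1 - M.1 1 0 * h0 - (k 1 - l 1) * hd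
    exact_mod_cast this

section Topology

theorem isClosed_sl2Int : IsClosed (sl2Int : Set (Matrix.SpecialLinearGroup (Fin 2) ℝ)) := by
  have h : IsClosedEmbedding (Int.castRingHom ℝ) := Int.isClosedEmbedding_coe_real
  exact h.specialLinearGroup_map.isClosed_range

instance instT1Space : T1Space LatticeSpace :=
  have := isClosed_sl2Int
  inferInstanceAs (T1Space (Matrix.SpecialLinearGroup (Fin 2) ℝ ⧸ sl2Int))

instance instSecondCountableTopology : SecondCountableTopology LatticeSpace :=
  inferInstanceAs (SecondCountableTopology (Matrix.SpecialLinearGroup (Fin 2) ℝ ⧸ sl2Int))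

instance instContinuousSMulSL2 : ContinuousSMul (Matrix.SpecialLinearGroup (Fin 2) ℝ) LatticeSpace :=
  inferInstanceAs (ContinuousSMul (Matrix.SpecialLinearGroup (Fin 2) ℝ)
    (Matrix.SpecialLinearGroup (Fin 2) ℝ ⧸ sl2Int))

theorem continuous_mk : Continuous mk := QuotientGroup.continuous_mk

theorem smul_mk (g M : Matrix.SpecialLinearGroup (Fin 2) ℝ) : g • mk M = mk (g * M) := rfl

/-- The group is Polish and the quotient is T1 and second countable, so the Borel σ-algebra of the
quotient is the one pushed forward by the projection. Measurability of functions of a lattice can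
thus be tested on matrices, where lattice points are continuous functions. -/
theorem measurableSet_iff {s : Set LatticeSpace} : MeasurableSet s ↔ MeasurableSet (mk ⁻¹' s) := by
  have h := continuous_mk.map_eq_borel mk_surjective
  change MeasurableSet[borel LatticeSpace] s ↔ _
  rw [← h]
  rfl

theorem measurable_iff {Y : Type*} [MeasurableSpace Y] {f : LatticeSpace → Y} :
    Measurable f ↔ Measurable fun M => f (mk M) :=
  ⟨fun h => h.comp continuous_mk.measurable, fun h _ hs => measurableSet_iff.2 (h hs)⟩

end Topology

/-! ### Lattice vectors and reduced pairs -/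

section Vectors

variable {L : LatticeSpace}

theorem zsmul_add_zsmul_mem_vectors {v w : Plane} (hv : v ∈ vectors L) (hw : w ∈ vectors L)
    (a b : ℤ) : a • v + b • w ∈ vectors L := by
  obtain ⟨M, rfl⟩ := mk_surjective L
  obtain ⟨k, rfl⟩ := mem_vectors_mk.1 hv
  obtain ⟨l, rfl⟩ := mem_vectors_mk.1 hw
  refine mem_vectors_mk.2 ⟨fun i => a * k i + b * l i, ?_⟩
  apply Plane.ext_coord <;> simp [point_apply] <;> ring

theorem neg_mem_vectors {v : Plane} (hv : v ∈ vectors L) : -v ∈ vectors L := by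
  simpa using zsmul_add_zsmul_mem_vectors hv hv (-1) 0

theorem exists_int_det2_eq {v w : Plane} (hv : v ∈ vectors L) (hw : w ∈ vectors L) :
    ∃ n : ℤ, det2 v w = n := by
  obtain ⟨M, rfl⟩ := mk_surjective L
  obtain ⟨k, rfl⟩ := mem_vectors_mk.1 hv
  obtain ⟨l, rfl⟩ := mem_vectors_mk.1 hw
  refine ⟨k 0 * l 1 - k 1 * l 0, ?_⟩
  simp only [det2, point_apply]
  push_cast
  linear_combination (k 0 * l 1 - k 1 * l 0 : ℝ) * det_eq M

theorem one_le_abs_det2 {v w : Plane} (hv : v ∈ vectors L) (hw : w ∈ vectors L)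
    (h : det2 v w ≠ 0) : 1 ≤ |det2 v w| := by
  obtain ⟨n, hn⟩ := exists_int_det2_eq hv hw
  rw [hn] at h ⊢
  exact_mod_cast Int.one_le_abs (by exact_mod_cast h)

theorem exists_basis (L : LatticeSpace) : ∃ v ∈ vectors L, ∃ w ∈ vectors L, det2 v w = 1 := by
  obtain ⟨M, rfl⟩ := mk_surjective L
  refine ⟨_, mem_vectors_mk.2 ⟨![1, 0], rfl⟩, _, mem_vectors_mk.2 ⟨![0, 1], rfl⟩, ?_⟩
  simp only [det2, point_apply]
  simp only [Matrix.cons_val_zero, Matrix.cons_val_one]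
  push_cast
  linear_combination det_eq M

theorem finite_vectors_norm_le (L : LatticeSpace) (r : ℝ) :
    {v | v ∈ vectors L ∧ ‖v‖ ≤ r}.Finite := by
  obtain ⟨M, rfl⟩ := mk_surjective L
  set p := point M ![1, 0] with hp
  set q := point M ![0, 1] with hq
  -- Cramer's rule in a basis of determinant `1`: the coordinates are determinants, so a bound on
  -- the norm bounds both integers.
  have hk : ∀ k : Fin 2 → ℤ, (k 0 : ℝ) = det2 (point M k) q ∧ (k 1 : ℝ) = det2 p (point M k) := by
    intro k
    simp only [det2, hp, hq, point_apply, Matrix.cons_val_zero, Matrix.cons_val_one]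
    push_cast
    constructor
    · linear_combination -(k 0 : ℝ) * det_eq M
    · linear_combination -(k 1 : ℝ) * det_eq M
  obtain ⟨n, hn⟩ := exists_nat_ge (max (|r| * ‖q‖) (‖p‖ * |r|))
  have hfin : (Set.pi Set.univ fun _ : Fin 2 => Set.Icc (-(n : ℤ)) n).Finite :=
    Set.Finite.pi fun _ => Set.finite_Icc _ _
  refine (hfin.image (point M)).subset ?_
  rintro v ⟨hv, hvr⟩
  obtain ⟨k, rfl⟩ := mem_vectors_mk.1 hv
  have hr : ‖point M k‖ ≤ |r| := hvr.trans (le_abs_self r)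
  have h0 : |(k 0 : ℝ)| ≤ n := by
    rw [(hk k).1]
    exact (abs_det2_le _ _).trans ((mul_le_mul_of_nonneg_right hr (norm_nonneg _)).trans
      ((le_max_left _ _).trans hn))
  have h1 : |(k 1 : ℝ)| ≤ n := by
    rw [(hk k).2]
    exact (abs_det2_le _ _).trans ((mul_le_mul_of_nonneg_left hr (norm_nonneg _)).trans
      ((le_max_right _ _).trans hn))
  refine ⟨k, fun i _ => ?_, rfl⟩
  have h0' : |k 0| ≤ n := by exact_mod_cast h0
  have h1' : |k 1| ≤ n := by exact_mod_cast h1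
  fin_cases i
  · exact abs_le.1 h0'
  · exact abs_le.1 h1'

theorem exists_norm_minimizer (p : Plane → Prop) (h : ∃ v ∈ vectors L, p v) :
    ∃ v ∈ vectors L, p v ∧ ∀ w ∈ vectors L, p w → ‖v‖ ≤ ‖w‖ := by
  obtain ⟨v, hv, hpv⟩ := h
  have hfin : {w | (w ∈ vectors L ∧ ‖w‖ ≤ ‖v‖) ∧ p w}.Finite :=
    (finite_vectors_norm_le L ‖v‖).subset fun w hw => hw.1
  obtain ⟨u, ⟨⟨hu, huv⟩, hpu⟩, hmin⟩ :=
    Set.exists_min_image _ (fun w : Plane => ‖w‖) hfin ⟨v, ⟨hv, le_rfl⟩, hpv⟩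
  refine ⟨u, hu, hpu, fun w hw hpw => ?_⟩
  rcases le_total ‖w‖ ‖v‖ with h | h
  · exact hmin w ⟨⟨hw, h⟩, hpw⟩
  · exact huv.trans h

end Vectors

section Minima

variable {L : LatticeSpace} {e f : Plane}

theorem succMin_one_eq (he : e ∈ vectors L) (he0 : e ≠ 0)
    (hmin : ∀ v ∈ vectors L, v ≠ 0 → ‖e‖ ≤ ‖v‖) : succMin 1 L = ‖e‖ := by
  refine IsLeast.csInf_eq ⟨⟨norm_pos_iff.2 he0, fun _ => e, ?_, fun _ => ⟨he, le_rfl⟩⟩, ?_⟩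
  · exact LinearIndependent.of_subsingleton (v := fun _ : Fin 1 => e) 0 he0
  · rintro r ⟨_, v, hv, h⟩
    exact (hmin _ (h 0).1 (hv.ne_zero 0)).trans (h 0).2

theorem succMin_two_eq (he : e ∈ vectors L) (hmin : ∀ v ∈ vectors L, v ≠ 0 → ‖e‖ ≤ ‖v‖)
    (hf : f ∈ vectors L) (hef : det2 e f ≠ 0)
    (hfmin : ∀ v ∈ vectors L, det2 e v ≠ 0 → ‖f‖ ≤ ‖v‖) : succMin 2 L = ‖f‖ := by
  have hf0 := det2_ne_zero_right hef
  refine IsLeast.csInf_eq ⟨⟨norm_pos_iff.2 hf0, ![e, f], ?_, ?_⟩, ?_⟩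
  · rw [linearIndependent_iff_det2]
    simpa using hef
  · intro j
    fin_cases j
    · exact ⟨he, hmin f hf hf0⟩
    · exact ⟨hf, le_rfl⟩
  · rintro r ⟨_, v, hv, h⟩
    rw [linearIndependent_iff_det2] at hv
    by_cases h0 : det2 e (v 0) = 0
    · by_cases h1 : det2 e (v 1) = 0
      · have he0 := det2_ne_zero_left hef
        exfalso
        apply hv
        -- Two vectors both parallel to `e ≠ 0` are dependent, so one member of any independent pair
        -- competes with `f`.
        have key : ∀ i, e i * det2 (v 0) (v 1) = 0 := by
          intro i
          unfold det2 at *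
          fin_cases i
          · simp only [Fin.zero_eta]
            linear_combination (v 0 0) * h1 - (v 1 0) * h0
          · simp only [Fin.mk_one]
            linear_combination (v 0 1) * h1 - (v 1 1) * h0
        by_contra hne
        exact he0 (Plane.ext_coord ((mul_eq_zero.1 (key 0)).resolve_right hne)
          ((mul_eq_zero.1 (key 1)).resolve_right hne))
      · exact (hfmin _ (h 1).1 h1).trans (h 1).2
    · exact (hfmin _ (h 0).1 h0).trans (h 0).2

theorem exists_reduced_pair (L : LatticeSpace) : ∃ e ∈ vectors L, ∃ f ∈ vectors L,
    det2 e f ≠ 0 ∧ (∀ v ∈ vectors L, v ≠ 0 → ‖e‖ ≤ ‖v‖) ∧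
      ∀ v ∈ vectors L, det2 e v ≠ 0 → ‖f‖ ≤ ‖v‖ := by
  obtain ⟨v, hv, w, hw, hvw⟩ := exists_basis L
  have hvw0 : det2 v w ≠ 0 := by rw [hvw]; exact one_ne_zero
  obtain ⟨e, he, he0, hmin⟩ := exists_norm_minimizer (L := L) (fun v => v ≠ 0)
    ⟨v, hv, det2_ne_zero_left hvw0⟩
  have hex : ∃ u ∈ vectors L, det2 e u ≠ 0 := by
    by_contra! hcon
    have h1 := hcon v hv
    have h2 := hcon w hw
    apply he0
    unfold det2 at hvw h1 h2
    apply Plane.ext_coord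
    · simp only [PiLp.zero_apply]
      linear_combination v 0 * h2 - w 0 * h1 - e 0 * hvw
    · simp only [PiLp.zero_apply]
      linear_combination v 1 * h2 - w 1 * h1 - e 1 * hvw
  obtain ⟨f, hf, hef, hfmin⟩ := exists_norm_minimizer (L := L) (fun v => det2 e v ≠ 0) hex
  exact ⟨e, he, f, hf, hef, hmin, hfmin⟩

theorem exists_norm_eq_succMin_one (L : LatticeSpace) : ∃ e ∈ vectors L, e ≠ 0 ∧
    ‖e‖ = succMin 1 L ∧ ∀ v ∈ vectors L, v ≠ 0 → ‖e‖ ≤ ‖v‖ := by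
  obtain ⟨e, he, f, -, hef, hmin, -⟩ := exists_reduced_pair L
  have he0 := det2_ne_zero_left hef
  exact ⟨e, he, he0, (succMin_one_eq he he0 hmin).symm, hmin⟩

theorem succMin_one_pos (L : LatticeSpace) : 0 < succMin 1 L := by
  obtain ⟨e, -, he0, h, -⟩ := exists_norm_eq_succMin_one L
  rw [← h]
  exact norm_pos_iff.2 he0

theorem succMin_one_le {v : Plane} (hv : v ∈ vectors L) (h0 : v ≠ 0) : succMin 1 L ≤ ‖v‖ := by
  obtain ⟨e, -, -, h, hmin⟩ := exists_norm_eq_succMin_one L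
  rw [← h]
  exact hmin v hv h0

/-- No two lattice vectors have the same norm, up to sign, and no nonzero lattice vector is
vertical. -/
def IsGeneric (L : LatticeSpace) : Prop :=
  (∀ v ∈ vectors L, ∀ w ∈ vectors L, ‖v‖ = ‖w‖ → v = w ∨ v = -w) ∧
    ∀ v ∈ vectors L, v 0 = 0 → v = 0

theorem IsGeneric.existsUnique (hL : IsGeneric L) (he : e ∈ vectors L) (he0 : e ≠ 0) :
    ∃! v : Plane, v ∈ vectors L ∧ 0 < v 0 ∧ ‖v‖ = ‖e‖ := by
  have hpos : ∃ v : Plane, v ∈ vectors L ∧ 0 < v 0 ∧ ‖v‖ = ‖e‖ := by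
    rcases lt_trichotomy (e 0) 0 with h | h | h
    · exact ⟨-e, neg_mem_vectors he, by simpa using h, norm_neg e⟩
    · exact absurd (hL.2 e he h) he0
    · exact ⟨e, he, h, rfl⟩
  obtain ⟨v, hv, hv0, hve⟩ := hpos
  refine ⟨v, ⟨hv, hv0, hve⟩, ?_⟩
  rintro w ⟨hw, hw0, hwe⟩
  rcases hL.1 w hw v hv (hwe.trans hve.symm) with h | h
  · exact h
  · rw [h] at hw0
    simp only [PiLp.neg_apply] at hw0
    linarith

theorem minVec_spec {i : ℕ}
    (h : ∃! v : Plane, v ∈ vectors L ∧ 0 < v 0 ∧ ‖v‖ = succMin i L) :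
    minVec i L ∈ vectors L ∧ 0 < minVec i L 0 ∧ ‖minVec i L‖ = succMin i L := by
  rw [minVec, dif_pos h]
  exact h.choose_spec.1

theorem IsGeneric.existsUnique_succMin (hL : IsGeneric L) {i : ℕ} (hi : i = 1 ∨ i = 2) :
    ∃! v : Plane, v ∈ vectors L ∧ 0 < v 0 ∧ ‖v‖ = succMin i L := by
  obtain ⟨e, he, f, hf, hef, hmin, hfmin⟩ := exists_reduced_pair L
  rcases hi with rfl | rfl
  · rw [succMin_one_eq he (det2_ne_zero_left hef) hmin]
    exact hL.existsUnique he (det2_ne_zero_left hef)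
  · rw [succMin_two_eq he hmin hf hef hfmin]
    exact hL.existsUnique hf (det2_ne_zero_right hef)

/-- This is Gauss reduction. The determinant of two independent lattice vectors is a nonzero
integer, so `‖e‖‖f‖ ≥ 1`; and `f ± e`, which are also independent of `e`, are no shorter than `f`,
which bounds the inner product. Genericity identifies the chosen vectors with `±e` and `±f`. -/
theorem IsGeneric.minVec_reduced (hL : IsGeneric L) :
    0 < ‖minVec 1 L‖ ∧ ‖minVec 1 L‖ ≤ ‖minVec 2 L‖ ∧ 1 ≤ ‖minVec 1 L‖ * ‖minVec 2 L‖ ∧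
      2 * |inner ℝ (minVec 1 L) (minVec 2 L)| ≤ ‖minVec 1 L‖ ^ 2 := by
  obtain ⟨e, he, f, hf, hef, hmin, hfmin⟩ := exists_reduced_pair L
  have he0 := det2_ne_zero_left hef
  have hf0 := det2_ne_zero_right hef
  obtain ⟨ha, ha0, hae⟩ := minVec_spec (hL.existsUnique_succMin (i := 1) (Or.inl rfl))
  obtain ⟨hb, hb0, hbf⟩ := minVec_spec (hL.existsUnique_succMin (i := 2) (Or.inr rfl))
  rw [succMin_one_eq he he0 hmin] at hae
  rw [succMin_two_eq he hmin hf hef hfmin] at hbf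
  set a := minVec 1 L
  set b := minVec 2 L
  have hea : a = e ∨ a = -e := hL.1 a ha e he hae
  have hfb : b = f ∨ b = -f := hL.1 b hb f hf hbf
  have hdet : |det2 a b| = |det2 e f| := by
    have hneg : ∀ x y : Plane, det2 (-x) y = -det2 x y := fun x y => by simp [det2]; ring
    have hneg' : ∀ x y : Plane, det2 x (-y) = -det2 x y := fun x y => by simp [det2]; ring
    rcases hea with h | h <;> rcases hfb with h' | h' <;> simp [h, h', hneg, hneg']
  have hinner : |inner ℝ a b| = |(inner ℝ e f : ℝ)| := by
    rcases hea with h | h <;> rcases hfb with h' | h' <;> simp [h, h']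
  rw [hae, hbf, hinner]
  have h1 := one_le_abs_det2 he hf hef
  refine ⟨norm_pos_iff.2 he0, hmin f hf hf0, h1.trans (abs_det2_le e f), ?_⟩
  have hshift : ∀ n : ℤ, ‖f‖ ^ 2 ≤ ‖n • e + (1 : ℤ) • f‖ ^ 2 := by
    intro n
    have hd : det2 e (n • e + (1 : ℤ) • f) ≠ 0 := by
      have : det2 e (n • e + (1 : ℤ) • f) = det2 e f := by simp [det2]; ring
      rwa [this]
    have := hfmin _ (zsmul_add_zsmul_mem_vectors he hf n 1) hd
    gcongr
  have hp := hshift 1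
  have hm := hshift (-1)
  simp only [one_zsmul, neg_zsmul] at hp hm
  rw [@norm_add_sq_real] at hp hm
  simp only [norm_neg, inner_neg_left] at hm
  have : |(inner ℝ e f : ℝ)| ≤ ‖e‖ ^ 2 / 2 := abs_le.2 ⟨by linarith, by linarith⟩
  linarith

/-- The reduction inequality bounds the cross term by `|k₁k₂|‖e₁‖² ≤ |k₁|‖e₁‖ · |k₂|‖e₂‖`, which
consumes at most half of the diagonal terms. -/
theorem IsGeneric.norm_combVec_sq_ge (hL : IsGeneric L) (k : ℤ × ℤ) :
    ((k.1 : ℝ) ^ 2 * ‖minVec 1 L‖ ^ 2 + (k.2 : ℝ) ^ 2 * ‖minVec 2 L‖ ^ 2) / 2 ≤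
      ‖combVec L k‖ ^ 2 := by
  obtain ⟨ha, hab, -, hinn⟩ := hL.minVec_reduced
  rw [combVec, ← Int.cast_smul_eq_zsmul ℝ, ← Int.cast_smul_eq_zsmul ℝ]
  set a := minVec 1 L
  set b := minVec 2 L
  rw [@norm_add_sq_real, norm_smul, norm_smul, inner_smul_left, inner_smul_right, mul_pow, mul_pow,
    Real.norm_eq_abs, Real.norm_eq_abs, sq_abs, sq_abs]
  simp only [conj_trivial]
  set x : ℝ := (k.1 : ℝ)
  set y : ℝ := (k.2 : ℝ)
  have h1 : -(|x| * |y| * ‖a‖ ^ 2) ≤ 2 * (x * (y * inner ℝ a b)) := by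
    have h2 : |2 * (x * (y * inner ℝ a b))| ≤ |x| * |y| * ‖a‖ ^ 2 := by
      rw [abs_mul, abs_mul, abs_mul]
      have : |(2 : ℝ)| = 2 := by norm_num
      rw [this]
      nlinarith [mul_le_mul_of_nonneg_left hinn (by positivity : 0 ≤ |x| * |y|)]
    exact (abs_le.1 h2).1
  have h3 : |x| * |y| * ‖a‖ ^ 2 ≤ (|x| * ‖a‖) * (|y| * ‖b‖) := by
    have : |x| * |y| * ‖a‖ * ‖a‖ ≤ |x| * |y| * ‖a‖ * ‖b‖ := by gcongr
    nlinarith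
  have h4 : (|x| * ‖a‖) * (|y| * ‖b‖) ≤ ((|x| * ‖a‖) ^ 2 + (|y| * ‖b‖) ^ 2) / 2 := by
    nlinarith [sq_nonneg (|x| * ‖a‖ - |y| * ‖b‖)]
  rw [mul_pow, mul_pow, sq_abs, sq_abs] at h4
  linarith

end Minima

end LatticeSpace

/-! ### Almost every lattice is generic -/

theorem ae_quadratic_ne_zero {a b c : ℝ} (h : a ≠ 0 ∨ b ≠ 0 ∨ c ≠ 0) :
    ∀ᵐ t : ℝ, a + b * t + c * t ^ 2 ≠ 0 := by
  open Polynomial in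
  let p : ℝ[X] := C a + C b * X + C c * X ^ 2
  have hp : p ≠ 0 := by
    intro hp
    have h0 := congrArg (fun q : ℝ[X] => q.coeff 0) hp
    have h1 := congrArg (fun q : ℝ[X] => q.coeff 1) hp
    have h2 := congrArg (fun q : ℝ[X] => q.coeff 2) hp
    simp [p, Polynomial.coeff_X, Polynomial.coeff_C, Polynomial.coeff_X_pow] at h0 h1 h2
    simp_all
  have hfin : {t : ℝ | a + b * t + c * t ^ 2 = 0}.Finite := by
    refine (p.roots.toFinset.finite_toSet).subset fun t ht => ?_
    simp only [Finset.mem_coe, Multiset.mem_toFinset, Polynomial.mem_roots hp, Polynomial.IsRoot.def]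
    simpa [p] using ht
  exact measure_eq_zero_iff_ae_notMem.1 (hfin.measure_zero volume)

/-- The upper triangular unipotent matrix with entry `t`. -/
def shear (t : ℝ) : Matrix.SpecialLinearGroup (Fin 2) ℝ :=
  ⟨!![1, t; 0, 1], by simp⟩

theorem continuous_shear : Continuous shear := by
  refine Continuous.subtype_mk (continuous_matrix fun i j => ?_) _
  fin_cases i <;> fin_cases j <;> simp <;> fun_prop

namespace LatticeSpace

theorem point_mul_apply (g M : Matrix.SpecialLinearGroup (Fin 2) ℝ) (k : Fin 2 → ℤ) (i : Fin 2) :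
    point (g * M) k i = g.1 i 0 * point M k 0 + g.1 i 1 * point M k 1 := by
  simp only [point_apply, Matrix.SpecialLinearGroup.coe_mul, Matrix.mul_apply, Fin.sum_univ_two]
  ring

theorem isGeneric_mk_iff {M : Matrix.SpecialLinearGroup (Fin 2) ℝ} : IsGeneric (mk M) ↔
    (∀ k l, ‖point M k‖ = ‖point M l‖ → point M k = point M l ∨ point M k = -point M l) ∧
      ∀ k, point M k 0 = 0 → point M k = 0 := by
  constructor
  · intro h
    exact ⟨fun k l => h.1 _ (mem_vectors_mk.2 ⟨k, rfl⟩) _ (mem_vectors_mk.2 ⟨l, rfl⟩),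
      fun k => h.2 _ (mem_vectors_mk.2 ⟨k, rfl⟩)⟩
  · rintro ⟨h1, h2⟩
    refine ⟨fun v hv w hw => ?_, fun v hv => ?_⟩
    · obtain ⟨k, rfl⟩ := mem_vectors_mk.1 hv
      obtain ⟨l, rfl⟩ := mem_vectors_mk.1 hw
      exact h1 k l
    · obtain ⟨k, rfl⟩ := mem_vectors_mk.1 hv
      exact h2 k

theorem measurable_point (k : Fin 2 → ℤ) : Measurable fun M => point M k :=
  (continuous_point k).measurable

theorem measurable_point_apply (k : Fin 2 → ℤ) (i : Fin 2) : Measurable fun M => point M k i :=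
  (show Continuous fun v : Plane => v i by fun_prop).measurable.comp (measurable_point k)

theorem measurableSet_isGeneric : MeasurableSet {L | IsGeneric L} := by
  rw [measurableSet_iff]
  have : mk ⁻¹' {L | IsGeneric L} = {M |
    (∀ k l, ‖point M k‖ = ‖point M l‖ → point M k = point M l ∨ point M k = -point M l) ∧
      ∀ k, point M k 0 = 0 → point M k = 0} := by
    ext M; exact isGeneric_mk_iff
  rw [this]
  have hm := measurable_point
  refine MeasurableSet.inter (s₁ := {M | ∀ k l, ‖point M k‖ = ‖point M l‖ →
    point M k = point M l ∨ point M k = -point M l}) ?_ ?_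
  · refine measurableSet_setOfPred.2 (Measurable.forall fun k => Measurable.forall fun l => ?_)
    refine Measurable.imp (measurableSet_setOfPred.1 (measurableSet_eq_fun (hm k).norm (hm l).norm))
      (Measurable.or (measurableSet_setOfPred.1 (measurableSet_eq_fun (hm k) (hm l)))
        (measurableSet_setOfPred.1 (measurableSet_eq_fun (hm k) (hm l).neg)))
  · refine measurableSet_setOfPred.2 (Measurable.forall fun k => ?_)
    exact Measurable.imp
      (measurableSet_setOfPred.1 (measurableSet_eq_fun (measurable_point_apply k 0) measurable_const))
      (measurableSet_setOfPred.1 (measurableSet_eq_fun (hm k) measurable_const))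

/-- Along a shear orbit each forbidden coincidence is a polynomial equation of degree at most two in
`t`. It is nontrivial unless the two vectors agree up to sign, or the vector is zero, and there are
only countably many such equations. -/
theorem ae_isGeneric_shear_smul (L : LatticeSpace) : ∀ᵐ t : ℝ, IsGeneric (shear t • L) := by
  obtain ⟨M, rfl⟩ := mk_surjective L
  have h0 : ∀ t k, point (shear t * M) k 0 = point M k 0 + t * point M k 1 := fun t k => by
    rw [point_mul_apply]; simp [shear]
  have h1 : ∀ t k, point (shear t * M) k 1 = point M k 1 := fun t k => by
    rw [point_mul_apply]; simp [shear]
  simp only [smul_mk, isGeneric_mk_iff]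
  refine Filter.Eventually.and (ae_all_iff.2 fun k => ae_all_iff.2 fun l => ?_)
    (ae_all_iff.2 fun k => ?_)
  · by_cases hp : point M k = point M l
    · refine ae_of_all _ fun t _ => Or.inl ?_
      apply Plane.ext_coord <;> simp [h0, h1, hp]
    by_cases hm : point M k = -point M l
    · refine ae_of_all _ fun t _ => Or.inr ?_
      apply Plane.ext_coord
      · simp [h0, hm]; ring
      · simp [h1, hm]
    set x := point M k 0 with hx
    set y := point M k 1 with hy
    set x' := point M l 0 with hx'
    set y' := point M l 1 with hy'
    have hne : x ^ 2 + y ^ 2 - x' ^ 2 - y' ^ 2 ≠ 0 ∨ 2 * x * y - 2 * x' * y' ≠ 0 ∨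
        y ^ 2 - y' ^ 2 ≠ 0 := by
      by_contra! hcon
      obtain ⟨e1, e2, e3⟩ := hcon
      have hyy : y = y' ∨ y = -y' := sq_eq_sq_iff_eq_or_eq_neg.1 (by linarith)
      have hxx : x = x' ∨ x = -x' := sq_eq_sq_iff_eq_or_eq_neg.1 (by linarith)
      rcases hyy with h | h <;> rcases hxx with h' | h'
      · exact hp (Plane.ext_coord h' h)
      · have : x' * y' = 0 := by rw [h, h'] at e2; linarith
        rcases mul_eq_zero.1 this with h'' | h''
        · exact hp (Plane.ext_coord (by rw [← hx, ← hx', h', h'']; simp) h)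
        · exact hm (Plane.ext_coord h' (by simp [← hy, ← hy', h, h'']))
      · have : x' * y' = 0 := by rw [h, h'] at e2; linarith
        rcases mul_eq_zero.1 this with h'' | h''
        · exact hm (Plane.ext_coord (by simp [← hx, ← hx', h', h'']) h)
        · exact hp (Plane.ext_coord h' (by simp [← hy, ← hy', h, h'']))
      · exact hm (Plane.ext_coord h' h)
    filter_upwards [ae_quadratic_ne_zero hne] with t ht heq
    exfalso
    apply ht
    have h2 : ‖point (shear t * M) k‖ ^ 2 = ‖point (shear t * M) l‖ ^ 2 := by rw [heq]
    rw [Plane.norm_sq_eq, Plane.norm_sq_eq, h0, h0, h1, h1, ← hx, ← hy, ← hx', ← hy'] at h2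
    linear_combination h2
  · by_cases hz : point M k = 0
    · refine ae_of_all _ fun t _ => ?_
      apply Plane.ext_coord <;> simp [h0, h1, hz]
    have hne : point M k 0 ≠ 0 ∨ point M k 1 ≠ 0 ∨ (0 : ℝ) ≠ 0 := by
      by_contra! hcon
      exact hz (Plane.ext_coord (by simpa using hcon.1) (by simpa using hcon.2.1))
    filter_upwards [ae_quadratic_ne_zero hne] with t ht heq
    rw [h0] at heq
    exact absurd (by linear_combination heq) ht

section Invariant

variable {μ : Measure LatticeSpace}
  [SMulInvariantMeasure (Matrix.SpecialLinearGroup (Fin 2) ℝ) LatticeSpace μ]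

theorem measurePreserving_smul_sl2 (g : Matrix.SpecialLinearGroup (Fin 2) ℝ) :
    MeasurePreserving (fun L : LatticeSpace => g • L) μ μ := by
  have hm : Measurable fun L : LatticeSpace => g • L := (continuous_const_smul g).measurable
  refine ⟨hm, ?_⟩
  ext s hs
  rw [Measure.map_apply hm hs]
  exact SMulInvariantMeasure.measure_preimage_smul g hs

theorem ae_isGeneric [SFinite μ] : ∀ᵐ L ∂μ, IsGeneric L := by
  have hmeas : MeasurableSet {x : ℝ × LatticeSpace | IsGeneric (shear x.1 • x.2)} := by
    have hc : Continuous fun x : ℝ × LatticeSpace => shear x.1 • x.2 :=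
      (continuous_shear.comp continuous_fst).smul continuous_snd
    exact hc.measurable measurableSet_isGeneric
  have h := (Measure.ae_ae_comm (μ := (volume : Measure ℝ)) (ν := μ)
    (p := fun t L => IsGeneric (shear t • L)) hmeas).2 (ae_of_all _ ae_isGeneric_shear_smul)
  -- Fubini yields one shear that makes almost every lattice generic; invariance of the measure then
  -- removes the shear.
  obtain ⟨t, ht⟩ := h.exists
  have := (measurePreserving_smul_sl2 (μ := μ) (shear t)⁻¹).quasiMeasurePreserving.ae ht
  filter_upwards [this] with L hL
  simpa using hL

end Invariant

/-! ### Measurability of the minima and of the minimal vectors -/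

theorem succMin_lt_iff {L : LatticeSpace} {i : ℕ} (hi : i = 1 ∨ i = 2) {r : ℝ} :
    succMin i L < r ↔ 0 < r ∧ ∃ v : Fin i → Plane, LinearIndependent ℝ v ∧
      ∀ j, v j ∈ vectors L ∧ ‖v j‖ < r := by
  have hbdd : BddBelow {r : ℝ | 0 < r ∧ ∃ v : Fin i → Plane, LinearIndependent ℝ v ∧
    ∀ j, v j ∈ vectors L ∧ ‖v j‖ ≤ r} := ⟨0, fun r hr => hr.1.le⟩
  have hne : {r : ℝ | 0 < r ∧ ∃ v : Fin i → Plane, LinearIndependent ℝ v ∧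
      ∀ j, v j ∈ vectors L ∧ ‖v j‖ ≤ r}.Nonempty := by
    obtain ⟨e, he, f, hf, hef, hmin, hfmin⟩ := exists_reduced_pair L
    have he0 := det2_ne_zero_left hef
    have hf0 := det2_ne_zero_right hef
    rcases hi with rfl | rfl
    · exact ⟨‖e‖, norm_pos_iff.2 he0, fun _ => e,
        LinearIndependent.of_subsingleton (v := fun _ : Fin 1 => e) 0 he0, fun _ => ⟨he, le_rfl⟩⟩
    · refine ⟨‖f‖, norm_pos_iff.2 hf0, ![e, f], (linearIndependent_iff_det2 _).2 (by simpa using hef),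
        fun j => ?_⟩
      fin_cases j
      · exact ⟨he, hmin f hf hf0⟩
      · exact ⟨hf, le_rfl⟩
  rw [succMin, csInf_lt_iff hbdd hne]
  constructor
  · rintro ⟨s, ⟨hs0, v, hv, h⟩, hsr⟩
    exact ⟨hs0.trans hsr, v, hv, fun j => ⟨(h j).1, (h j).2.trans_lt hsr⟩⟩
  · rintro ⟨hr, v, hv, h⟩
    have h1 : ∀ᶠ s in 𝓝[<] r, ∀ j, ‖v j‖ < s :=
      eventually_all.2 fun j => mem_nhdsWithin_of_mem_nhds (Ioi_mem_nhds (h j).2)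
    have h2 : ∀ᶠ s in 𝓝[<] r, 0 < s := mem_nhdsWithin_of_mem_nhds (Ioi_mem_nhds hr)
    obtain ⟨s, ⟨hs1, hs2⟩, hs3⟩ := ((h1.and h2).and self_mem_nhdsWithin).exists
    exact ⟨s, ⟨hs2, v, hv, fun j => ⟨(h j).1, (hs1 j).le⟩⟩, hs3⟩

theorem measurable_succMin {i : ℕ} (hi : i = 1 ∨ i = 2) : Measurable (succMin i) := by
  refine measurable_of_Iio fun r => ?_
  rw [measurableSet_iff]
  have : mk ⁻¹' (succMin i ⁻¹' Set.Iio r) = ⋃ k : Fin i → Fin 2 → ℤ, {M | 0 < r ∧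
      LinearIndependent ℝ (fun j => point M (k j)) ∧ ∀ j, ‖point M (k j)‖ < r} := by
    ext M
    simp only [Set.mem_preimage, Set.mem_Iio, Set.mem_iUnion]
    rw [succMin_lt_iff hi]
    constructor
    · rintro ⟨hr, v, hv, h⟩
      choose k hk using fun j => mem_vectors_mk.1 (h j).1
      have hkv : (fun j => point M (k j)) = v := funext hk
      exact ⟨k, hr, by rwa [hkv], fun j => by rw [hk j]; exact (h j).2⟩
    · rintro ⟨k, hr, hv, h⟩
      exact ⟨hr, _, hv, fun j => ⟨mem_vectors_mk.2 ⟨k j, rfl⟩, h j⟩⟩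
  rw [this]
  refine MeasurableSet.iUnion fun k => IsOpen.measurableSet ?_
  have hc : Continuous fun M => fun j => point M (k j) :=
    continuous_pi fun j => continuous_point (k j)
  refine IsOpen.inter (s := {_M | 0 < r}) isOpen_const (IsOpen.inter
    (s := {M | LinearIndependent ℝ (fun j => point M (k j))})
    (t := {M | ∀ j, ‖point M (k j)‖ < r})
    (isOpen_setOfPred_linearIndependent.preimage hc) ?_)
  have hI : {M | ∀ j, ‖point M (k j)‖ < r} = ⋂ j, {M | ‖point M (k j)‖ < r} := by ext; simp
  rw [hI]
  exact isOpen_iInter_of_finite fun j => isOpen_lt (continuous_point (k j)).norm continuous_const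

/-- On generic lattices the minimal vector is found by a countable search over integer coordinates,
each of whose conditions is measurable; elsewhere the indicator replaces it by `0`. -/
theorem measurable_indicator_minVec {i : ℕ} (hi : i = 1 ∨ i = 2) :
    Measurable ({L | IsGeneric L}.indicator (minVec i)) := by
  intro B hB
  rw [measurableSet_iff]
  have hG : MeasurableSet (mk ⁻¹' {L | IsGeneric L}) := measurableSet_iff.1 measurableSet_isGeneric
  have : mk ⁻¹' ({L | IsGeneric L}.indicator (minVec i) ⁻¹' B) =
      ((mk ⁻¹' {L | IsGeneric L}) ∩ ⋃ k, {M | point M k ∈ B ∧ 0 < point M k 0 ∧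
        ‖point M k‖ = succMin i (mk M)}) ∪ ((mk ⁻¹' {L | IsGeneric L})ᶜ ∩ {_M | (0 : Plane) ∈ B}) := by
    ext M
    by_cases hM : IsGeneric (mk M)
    · have hex := hM.existsUnique_succMin hi
      have hs := minVec_spec hex
      have h1 : {L | IsGeneric L}.indicator (minVec i) (mk M) = minVec i (mk M) :=
        Set.indicator_of_mem (show mk M ∈ {L | IsGeneric L} from hM) _
      simp only [Set.mem_preimage, h1, Set.mem_union, Set.mem_inter_iff, Set.mem_compl_iff,
        Set.mem_iUnion]
      constructor
      · intro hB
        obtain ⟨k, hk⟩ := mem_vectors_mk.1 hs.1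
        rw [← hk] at hs hB
        exact Or.inl ⟨hM, k, hB, hs.2⟩
      · rintro (⟨_, k, hk, hk'⟩ | ⟨h, _⟩)
        · rwa [hex.unique hs ⟨mem_vectors_mk.2 ⟨k, rfl⟩, hk'⟩]
        · exact absurd hM h
    · have h1 : {L | IsGeneric L}.indicator (minVec i) (mk M) = 0 :=
        Set.indicator_of_notMem (show mk M ∉ {L | IsGeneric L} from hM) _
      simp only [Set.mem_preimage, h1, Set.mem_union, Set.mem_inter_iff, Set.mem_compl_iff]
      constructor
      · exact fun h => Or.inr ⟨hM, h⟩
      · rintro (⟨h, _⟩ | ⟨_, h⟩)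
        · exact absurd h hM
        · exact h
  rw [this]
  refine (hG.inter (MeasurableSet.iUnion fun k => ?_)).union
    (hG.compl.inter (MeasurableSet.const _))
  refine MeasurableSet.inter (s₁ := {M | point M k ∈ B}) (measurable_point k hB)
    (MeasurableSet.inter (s₁ := {M | 0 < point M k 0})
      (measurableSet_lt measurable_const (measurable_point_apply k 0)) ?_)
  exact measurableSet_eq_fun (measurable_point k).norm (measurable_iff.1 (measurable_succMin hi))

theorem aemeasurable_combVec {ν : Measure LatticeSpace} (hν : ∀ᵐ L ∂ν, IsGeneric L) (k : ℤ × ℤ) :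
    AEMeasurable (combVec · k) ν := by
  refine ⟨fun L => k.1 • {L | IsGeneric L}.indicator (minVec 1) L +
    k.2 • {L | IsGeneric L}.indicator (minVec 2) L, ?_, ?_⟩
  · simp only [← Int.cast_smul_eq_zsmul ℝ]
    exact ((measurable_indicator_minVec (Or.inl rfl)).const_smul (k.1 : ℝ)).add
      ((measurable_indicator_minVec (Or.inr rfl)).const_smul (k.2 : ℝ))
  · filter_upwards [hν] with L hL
    rw [Set.indicator_of_mem (show L ∈ {L | IsGeneric L} from hL),
      Set.indicator_of_mem (show L ∈ {L | IsGeneric L} from hL), combVec]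

end LatticeSpace

/-! ### Primitive vectors and their invariant intensity -/

/-- The linear action of `SL₂(ℝ)` on the plane. -/
noncomputable def planeAct (g : Matrix.SpecialLinearGroup (Fin 2) ℝ) (v : Plane) : Plane :=
  WithLp.toLp 2 (g.1 *ᵥ v.ofLp)

theorem planeAct_apply (g : Matrix.SpecialLinearGroup (Fin 2) ℝ) (v : Plane) (i : Fin 2) :
    planeAct g v i = g.1 i 0 * v 0 + g.1 i 1 * v 1 := by
  simp only [planeAct, Matrix.mulVec, dotProduct, Fin.sum_univ_two]

theorem planeAct_inv_planeAct (g : Matrix.SpecialLinearGroup (Fin 2) ℝ) (v : Plane) :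
    planeAct g⁻¹ (planeAct g v) = v := by
  simp only [planeAct, Matrix.mulVec_mulVec, ← Matrix.SpecialLinearGroup.coe_mul, inv_mul_cancel,
    Matrix.SpecialLinearGroup.coe_one, Matrix.one_mulVec]

theorem planeAct_injective (g : Matrix.SpecialLinearGroup (Fin 2) ℝ) :
    Function.Injective (planeAct g) :=
  Function.LeftInverse.injective (planeAct_inv_planeAct g)

theorem planeAct_smul (g : Matrix.SpecialLinearGroup (Fin 2) ℝ) (t : ℝ) (v : Plane) :
    planeAct g (t • v) = t • planeAct g v := by
  apply Plane.ext_coord <;> simp [planeAct_apply] <;> ring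

theorem continuous_planeAct (g : Matrix.SpecialLinearGroup (Fin 2) ℝ) :
    Continuous (planeAct g) :=
  (PiLp.continuous_toLp 2 _).comp
    (Continuous.matrix_mulVec continuous_const (PiLp.continuous_ofLp 2 _))

/-- The diagonal matrix with entries `a` and `a⁻¹`. -/
noncomputable def diagSL (a : ℝ) (ha : 0 < a) : Matrix.SpecialLinearGroup (Fin 2) ℝ :=
  ⟨!![a, 0; 0, a⁻¹], by simp [ha.ne']⟩

/-- The rotation by a right angle. -/
def quarterTurn : Matrix.SpecialLinearGroup (Fin 2) ℝ :=
  ⟨!![0, -1; 1, 0], by simp⟩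

namespace LatticeSpace

theorem planeAct_mem_vectors_smul {g : Matrix.SpecialLinearGroup (Fin 2) ℝ} {L : LatticeSpace}
    {v : Plane} : planeAct g v ∈ vectors (g • L) ↔ v ∈ vectors L := by
  obtain ⟨M, rfl⟩ := mk_surjective L
  have h : ∀ k, point (g * M) k = planeAct g (point M k) := fun k => by
    ext i; rw [point_mul_apply, planeAct_apply]
  rw [smul_mk, mem_vectors_mk, mem_vectors_mk]
  simp only [h, (planeAct_injective g).eq_iff]

/-- The primitive vectors of a lattice. -/
def primVectors (L : LatticeSpace) : Set Plane :=
  {v | v ∈ vectors L ∧ v ≠ 0 ∧ ∀ t : ℝ, 0 < t → t < 1 → t • v ∉ vectors L}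

theorem planeAct_mem_primVectors_smul {g : Matrix.SpecialLinearGroup (Fin 2) ℝ} {L : LatticeSpace}
    {v : Plane} : planeAct g v ∈ primVectors (g • L) ↔ v ∈ primVectors L := by
  have h0 : planeAct g 0 = 0 := by apply Plane.ext_coord <;> simp [planeAct_apply]
  have hne : planeAct g v ≠ 0 ↔ v ≠ 0 := by
    rw [← h0, (planeAct_injective g).ne_iff, h0]
  simp only [primVectors, Set.mem_ofPred_eq, planeAct_mem_vectors_smul, ← planeAct_smul, hne]

theorem primVectors_eq_or_eq_neg {L : LatticeSpace} {v w : Plane} (hv : v ∈ primVectors L)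
    (hw : w ∈ primVectors L) (h : det2 v w = 0) : w = v ∨ w = -v := by
  have key : ∀ x ∈ primVectors L, ∀ y ∈ vectors L, ∀ c : ℝ, c ≠ 0 → y = c • x → 1 ≤ |c| := by
    intro x hx y hy c hc hyx
    by_contra! hlt
    refine hx.2.2 |c| (abs_pos.2 hc) hlt ?_
    rcases abs_choice c with h | h
    · rw [h, ← hyx]; exact hy
    · rw [h, neg_smul, ← hyx]; exact neg_mem_vectors hy
  obtain ⟨c, hc⟩ : ∃ c : ℝ, w = c • v := by
    have hv0 := hv.2.1
    unfold det2 at h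
    by_cases h0 : v 0 = 0
    · have h1 : v 1 ≠ 0 := fun h1 => hv0 (Plane.ext_coord (by simpa using h0) (by simpa using h1))
      refine ⟨w 1 / v 1, Plane.ext_coord ?_ ?_⟩
      · have : w 0 = 0 := by
          rw [h0] at h
          simpa [h1] using h
        simp [this, h0]
      · simp [h1]
    · refine ⟨w 0 / v 0, Plane.ext_coord ?_ ?_⟩
      · simp [h0]
      · simp only [PiLp.smul_apply, smul_eq_mul]
        field_simp
        linarith
  have hc0 : c ≠ 0 := by
    rintro rfl
    exact hw.2.1 (by simpa using hc)
  have h1 := key v hv w hw.1 c hc0 hc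
  have h2 := key w hw v hv.1 c⁻¹ (inv_ne_zero hc0) (by rw [hc, smul_smul, inv_mul_cancel₀ hc0, one_smul])
  rw [abs_inv] at h2
  have h3 : |c| = 1 := le_antisymm (by
    have := (one_le_inv₀ (abs_pos.2 hc0)).1 h2
    exact this) h1
  rcases (abs_eq zero_le_one).1 h3 with h | h
  · exact Or.inl (by rw [hc, h, one_smul])
  · exact Or.inr (by rw [hc, h, neg_one_smul])

theorem mem_primVectors_of_minimal {L : LatticeSpace} {e : Plane} (he : e ∈ vectors L) (he0 : e ≠ 0)
    (hmin : ∀ v ∈ vectors L, v ≠ 0 → ‖e‖ ≤ ‖v‖) : e ∈ primVectors L := by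
  refine ⟨he, he0, fun t ht0 ht1 h => ?_⟩
  have := hmin _ h (smul_ne_zero ht0.ne' he0)
  rw [norm_smul, Real.norm_of_nonneg ht0.le] at this
  nlinarith [norm_pos_iff.2 he0]

/-- Two lattice vectors of norm less than `1` have determinant less than `1` in absolute value,
hence `0`; proportional primitive vectors agree up to sign. -/
theorem count_primVectors_ball_le {L : LatticeSpace} {r : ℝ} (hr : r ≤ 1) :
    Measure.count (Metric.ball 0 r ∩ primVectors L) ≤ {L | succMin 1 L < r}.indicator 2 L := by
  by_cases hne : (Metric.ball 0 r ∩ primVectors L).Nonempty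
  · obtain ⟨v, hvr, hv⟩ := hne
    rw [mem_ball_zero_iff] at hvr
    have hL : L ∈ {L | succMin 1 L < r} := (succMin_one_le hv.1 hv.2.1).trans_lt hvr
    rw [Set.indicator_of_mem hL]
    have hsub : Metric.ball 0 r ∩ primVectors L ⊆ (({v, -v} : Finset Plane) : Set Plane) := by
      rintro w ⟨hwr, hw⟩
      rw [mem_ball_zero_iff] at hwr
      have hd : det2 v w = 0 := by
        by_contra hd
        have h1 := (one_le_abs_det2 hv.1 hw.1 hd).trans (abs_det2_le v w)
        nlinarith [norm_nonneg v, norm_nonneg w]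
      simpa using primVectors_eq_or_eq_neg hv hw hd
    refine (measure_mono hsub).trans ?_
    rw [Measure.count_apply_finset]
    have := Finset.card_le_two (a := v) (b := -v)
    change _ ≤ (2 : ENNReal)
    exact_mod_cast this
  · rw [Set.not_nonempty_iff_eq_empty.1 hne, measure_empty]
    exact zero_le

theorem le_count_primVectors_ball {L : LatticeSpace} {r : ℝ} :
    {L | succMin 1 L < r}.indicator 1 L ≤ Measure.count (Metric.ball 0 r ∩ primVectors L) := by
  by_cases hL : succMin 1 L < r
  · rw [Set.indicator_of_mem (show L ∈ {L | succMin 1 L < r} from hL)]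
    obtain ⟨e, he, he0, h, hmin⟩ := exists_norm_eq_succMin_one L
    calc (1 : ENNReal) = Measure.count {e} := (Measure.count_singleton e).symm
      _ ≤ _ := measure_mono (Set.singleton_subset_iff.2 (Set.mem_inter
        (by rw [mem_ball_zero_iff, h]; exact hL) (mem_primVectors_of_minimal he he0 hmin)))
  · rw [Set.indicator_of_notMem (show L ∉ {L | succMin 1 L < r} from hL)]
    exact zero_le

theorem measurable_count_primVectors {E : Set Plane} (hE : MeasurableSet E) :
    Measurable fun L => Measure.count (E ∩ primVectors L) := by
  classical
  rw [measurable_iff]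
  let Pr : Set (Fin 2 → ℤ) := {k | k ≠ 0 ∧ ∀ t : ℝ, 0 < t → t < 1 →
    ¬ ∃ l : Fin 2 → ℤ, ∀ i, (l i : ℝ) = t * k i}
  -- Primitivity depends only on the integer coordinates, so the count is a sum over a fixed
  -- countable set of indicators measurable in `M`.
  have hprim : ∀ M k, point M k ∈ primVectors (mk M) ↔ k ∈ Pr := by
    intro M k
    have h0 : point M 0 = 0 := by apply Plane.ext_coord <;> simp [point_apply]
    have hmem : point M k ∈ vectors (mk M) := mem_vectors_mk.2 ⟨k, rfl⟩
    have hne : point M k ≠ 0 ↔ k ≠ 0 := by rw [← h0, (point_injective M).ne_iff]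
    have ht : ∀ t : ℝ, t • point M k ∈ vectors (mk M) ↔
        ∃ l : Fin 2 → ℤ, ∀ i, (l i : ℝ) = t * k i := by
      intro t
      rw [mem_vectors_mk]
      refine exists_congr fun l => ⟨fun h => ?_, fun h => ?_⟩
      · have e0 := congrArg (fun v : Plane => v 0) h
        have e1 := congrArg (fun v : Plane => v 1) h
        simp only [point_apply, PiLp.smul_apply, smul_eq_mul] at e0 e1
        have hd := det_eq M
        intro i
        fin_cases i
        · simp only [Fin.zero_eta]
          linear_combination M.1 1 1 * e0 - M.1 0 1 * e1 - (l 0 - t * k 0) * hd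
        · simp only [Fin.mk_one]
          linear_combination M.1 0 0 * e1 - M.1 1 0 * e0 - (l 1 - t * k 1) * hd
      · apply Plane.ext_coord <;> simp [point_apply, h] <;> ring
    simp only [primVectors, Set.mem_ofPred_eq, hmem, hne, ht, true_and, Pr]
  have heq : ∀ M, Measure.count (E ∩ primVectors (mk M)) =
      ∑' k : Fin 2 → ℤ, {k | k ∈ Pr ∧ point M k ∈ E}.indicator 1 k := by
    intro M
    have himg : E ∩ primVectors (mk M) = point M '' {k | k ∈ Pr ∧ point M k ∈ E} := by
      ext v
      constructor
      · rintro ⟨hvE, hv⟩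
        obtain ⟨k, rfl⟩ := mem_vectors_mk.1 hv.1
        exact ⟨k, ⟨(hprim M k).1 hv, hvE⟩, rfl⟩
      · rintro ⟨k, ⟨hk, hkE⟩, rfl⟩
        exact ⟨hkE, (hprim M k).2 hk⟩
    have hs : MeasurableSet {k | k ∈ Pr ∧ point M k ∈ E} := (Set.to_countable _).measurableSet
    rw [himg, Measure.count_injective_image (point_injective M), Measure.count,
      Measure.sum_apply _ hs]
    simp only [Measure.dirac_apply' _ hs]
  simp only [heq]
  refine Measurable.tsum fun k => ?_
  by_cases hk : k ∈ Pr
  · have : (fun M => {k | k ∈ Pr ∧ point M k ∈ E}.indicator (1 : (Fin 2 → ℤ) → ENNReal) k) =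
        ((fun M => point M k) ⁻¹' E).indicator 1 := by
      funext M
      simp [Set.indicator, hk]
    rw [this]
    exact measurable_one.indicator (measurable_point k hE)
  · simp [Set.indicator, hk]

/-- The intensity measure of the primitive vectors of a random lattice. -/
noncomputable def primIntensity (μ : Measure LatticeSpace) : Measure Plane :=
  μ.bind fun L => Measure.count.restrict (primVectors L)

theorem primIntensity_apply (μ : Measure LatticeSpace) {E : Set Plane} (hE : MeasurableSet E) :
    primIntensity μ E = ∫⁻ L, Measure.count (E ∩ primVectors L) ∂μ := by
  have hm : Measurable fun L => (Measure.count : Measure Plane).restrict (primVectors L) := by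
    refine Measure.measurable_of_measurable_coe _ fun s hs => ?_
    simp only [Measure.restrict_apply hs]
    exact measurable_count_primVectors hs
  rw [primIntensity, Measure.bind_apply hE hm.aemeasurable]
  simp only [Measure.restrict_apply hE]

variable {μ : Measure LatticeSpace}
  [SMulInvariantMeasure (Matrix.SpecialLinearGroup (Fin 2) ℝ) LatticeSpace μ]

theorem primIntensity_preimage (g : Matrix.SpecialLinearGroup (Fin 2) ℝ) {E : Set Plane}
    (hE : MeasurableSet E) : primIntensity μ (planeAct g ⁻¹' E) = primIntensity μ E := by
  rw [primIntensity_apply μ hE, primIntensity_apply μ ((continuous_planeAct g).measurable hE),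
    ← (measurePreserving_smul_sl2 g).lintegral_comp (measurable_count_primVectors hE)]
  refine lintegral_congr fun L => ?_
  rw [← Measure.count_injective_image (planeAct_injective g)]
  congr 1
  ext w
  constructor
  · rintro ⟨v, ⟨hv, hv'⟩, rfl⟩
    exact ⟨hv, planeAct_mem_primVectors_smul.2 hv'⟩
  · rintro ⟨hw, hw'⟩
    have h : planeAct g (planeAct g⁻¹ w) = w := by
      simpa using planeAct_inv_planeAct g⁻¹ w
    rw [← h] at hw'
    exact ⟨planeAct g⁻¹ w, ⟨by rw [Set.mem_preimage, h]; exact hw,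
      planeAct_mem_primVectors_smul.1 hw'⟩, h⟩

end LatticeSpace

/-- The truncated cone of the points `v` with `0 < v 1 < b` and `|v 0| ≤ s * v 1`. -/
def truncCone (s b : ℝ) : Set Plane := {v | 0 < v 1 ∧ v 1 < b ∧ |v 0| ≤ s * v 1}

theorem measurable_coord (i : Fin 2) : Measurable fun v : Plane => v i :=
  (show Continuous fun v : Plane => v i by fun_prop).measurable

theorem measurableSet_truncCone (s b : ℝ) : MeasurableSet (truncCone s b) := by
  have h0 := measurable_coord 0
  have h1 := measurable_coord 1
  exact (measurableSet_lt measurable_const h1).inter ((measurableSet_lt h1 measurable_const).inter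
    (measurableSet_le h0.abs (h1.const_mul s)))

/-- The horizontal strip `0 < v 1 < b`. -/
def strip (b : ℝ) : Set Plane := {v | 0 < v 1 ∧ v 1 < b}

theorem measurableSet_strip (b : ℝ) : MeasurableSet (strip b) := by
  have h1 := measurable_coord 1
  exact (measurableSet_lt measurable_const h1).inter (measurableSet_lt h1 measurable_const)

theorem planeAct_shear_apply_zero (t : ℝ) (v : Plane) : planeAct (shear t) v 0 = v 0 + t * v 1 := by
  rw [planeAct_apply]; simp [shear]

theorem planeAct_shear_apply_one (t : ℝ) (v : Plane) : planeAct (shear t) v 1 = v 1 := by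
  rw [planeAct_apply]; simp [shear]

theorem planeAct_diagSL_apply_zero {a : ℝ} (ha : 0 < a) (v : Plane) :
    planeAct (diagSL a ha) v 0 = a * v 0 := by
  rw [planeAct_apply]; simp [diagSL]

theorem planeAct_diagSL_apply_one {a : ℝ} (ha : 0 < a) (v : Plane) :
    planeAct (diagSL a ha) v 1 = v 1 / a := by
  rw [planeAct_apply]; simp [diagSL]; ring

theorem planeAct_quarterTurn_apply_zero (v : Plane) : planeAct quarterTurn v 0 = -v 1 := by
  rw [planeAct_apply]; simp [quarterTurn]

theorem planeAct_quarterTurn_apply_one (v : Plane) : planeAct quarterTurn v 1 = v 0 := by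
  rw [planeAct_apply]; simp [quarterTurn]

theorem planeAct_diagSL_preimage_strip {a : ℝ} (ha : 0 < a) :
    planeAct (diagSL a ha) ⁻¹' strip 1 = strip a := by
  ext v
  simp only [strip, Set.mem_preimage, Set.mem_ofPred_eq, planeAct_diagSL_apply_one ha,
    div_pos_iff_of_pos_right ha, div_lt_one ha]

theorem planeAct_diagSL_preimage_truncCone {a : ℝ} (ha : 0 < a) (s b : ℝ) :
    planeAct (diagSL a ha) ⁻¹' truncCone (a ^ 2 * s) b = truncCone s (a * b) := by
  ext v
  have h : a ^ 2 * s * (v 1 / a) = a * (s * v 1) := by field_simp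
  simp only [truncCone, Set.mem_preimage, Set.mem_ofPred_eq, planeAct_diagSL_apply_one ha,
    planeAct_diagSL_apply_zero ha, div_pos_iff_of_pos_right ha, div_lt_iff₀ ha, abs_mul,
    abs_of_pos ha, h, mul_le_mul_iff_right₀ ha, mul_comm b a]

/-! ### The cusp estimate -/

namespace LatticeSpace

theorem primIntensity_ball_le {μ : Measure LatticeSpace} {r : ℝ} (hr : r ≤ 1) :
    primIntensity μ (Metric.ball 0 r) ≤ 2 * μ {L | succMin 1 L < r} := by
  rw [primIntensity_apply μ measurableSet_ball]
  have hm : MeasurableSet {L : LatticeSpace | succMin 1 L < r} :=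
    measurableSet_lt (measurable_succMin (Or.inl rfl)) measurable_const
  calc _ ≤ ∫⁻ L, {L | succMin 1 L < r}.indicator 2 L ∂μ :=
        lintegral_mono fun L => count_primVectors_ball_le hr
    _ = _ := by
        rw [lintegral_indicator hm]
        exact setLIntegral_const _ _

theorem le_primIntensity_ball {μ : Measure LatticeSpace} (r : ℝ) :
    μ {L | succMin 1 L < r} ≤ primIntensity μ (Metric.ball 0 r) := by
  rw [primIntensity_apply μ measurableSet_ball]
  have hm : MeasurableSet {L : LatticeSpace | succMin 1 L < r} :=
    measurableSet_lt (measurable_succMin (Or.inl rfl)) measurable_const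
  rw [← lintegral_indicator_one hm]
  exact lintegral_mono fun L => le_count_primVectors_ball

variable {μ : Measure LatticeSpace}
  [SMulInvariantMeasure (Matrix.SpecialLinearGroup (Fin 2) ℝ) LatticeSpace μ]

theorem measure_iUnion_quarterTurn_le {E : Set Plane} (hE : MeasurableSet E) {F : Set Plane}
    (h : ∀ v ∈ F, v ∈ E ∨ planeAct quarterTurn v ∈ E ∨
      planeAct quarterTurn (planeAct quarterTurn v) ∈ E ∨
      planeAct quarterTurn (planeAct quarterTurn (planeAct quarterTurn v)) ∈ E) :
    primIntensity μ F ≤ 4 * primIntensity μ E := by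
  set J := planeAct quarterTurn
  have hJ : Measurable J := (continuous_planeAct _).measurable
  have hsub : F ⊆ E ∪ (J ⁻¹' E ∪ (J ⁻¹' (J ⁻¹' E) ∪ J ⁻¹' (J ⁻¹' (J ⁻¹' E)))) := h
  have e1 : primIntensity μ (J ⁻¹' E) = primIntensity μ E := primIntensity_preimage _ hE
  have e2 : primIntensity μ (J ⁻¹' (J ⁻¹' E)) = primIntensity μ E :=
    (primIntensity_preimage _ (hJ hE)).trans e1
  have e3 : primIntensity μ (J ⁻¹' (J ⁻¹' (J ⁻¹' E))) = primIntensity μ E :=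
    (primIntensity_preimage _ (hJ (hJ hE))).trans e2
  refine (measure_mono hsub).trans ((measure_union_le _ _).trans ?_)
  have h3 := measure_union_le (μ := primIntensity μ) (J ⁻¹' (J ⁻¹' E)) (J ⁻¹' (J ⁻¹' (J ⁻¹' E)))
  have h2 := measure_union_le (μ := primIntensity μ) (J ⁻¹' E)
    (J ⁻¹' (J ⁻¹' E) ∪ J ⁻¹' (J ⁻¹' (J ⁻¹' E)))
  rw [e2, e3] at h3
  rw [e1] at h2
  calc primIntensity μ E + _ ≤ primIntensity μ E + (primIntensity μ E +
        (primIntensity μ E + primIntensity μ E)) := by gcongr; exact h2.trans (by gcongr)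
    _ = 4 * primIntensity μ E := by ring

/-- The law of the slope `v 0 / v 1` on the strip `0 < v 1 < 1`. -/
noncomputable def slopeMeasure (μ : Measure LatticeSpace) : Measure ℝ :=
  ((primIntensity μ).restrict (strip 1)).map fun v => v 0 / v 1

theorem measurable_slope : Measurable fun v : Plane => v 0 / v 1 :=
  (measurable_coord 0).div (measurable_coord 1)

theorem slopeMeasure_apply (μ : Measure LatticeSpace) {A : Set ℝ} (hA : MeasurableSet A) :
    slopeMeasure μ A = primIntensity μ {v | v 0 / v 1 ∈ A ∧ v ∈ strip 1} := by
  rw [slopeMeasure, Measure.map_apply measurable_slope hA,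
    Measure.restrict_apply (measurable_slope hA)]
  rfl

/-- A shear by `t` keeps the second coordinate, hence the strip, and adds `t` to the slope. -/
theorem isAddLeftInvariant_slopeMeasure : (slopeMeasure μ).IsAddLeftInvariant := by
  refine ⟨fun t => ?_⟩
  ext A hA
  rw [Measure.map_apply (measurable_const_add t) hA, slopeMeasure_apply μ hA,
    slopeMeasure_apply μ (measurable_const_add t hA)]
  have hE : MeasurableSet {v : Plane | v 0 / v 1 ∈ A ∧ v ∈ strip 1} :=
    (measurable_slope hA).inter (measurableSet_strip 1)
  rw [← primIntensity_preimage (shear t) hE]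
  congr 1
  ext v
  simp only [Set.mem_preimage, strip, Set.mem_ofPred_eq, planeAct_shear_apply_zero,
    planeAct_shear_apply_one]
  refine and_congr_left fun hv => ?_
  have : (v 0 + t * v 1) / v 1 = t + v 0 / v 1 := by
    have := hv.1.ne'
    field_simp
    ring
  rw [this]

theorem slopeMeasure_Icc (μ : Measure LatticeSpace) (s : ℝ) :
    slopeMeasure μ (Set.Icc (-s) s) = primIntensity μ (truncCone s 1) := by
  rw [slopeMeasure_apply μ measurableSet_Icc]
  congr 1
  ext v
  simp only [truncCone, strip, Set.mem_ofPred_eq, Set.mem_Icc, ← abs_le]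
  constructor
  · rintro ⟨h, h0, h1⟩
    rw [abs_div, abs_of_pos h0, div_le_iff₀ h0] at h
    exact ⟨h0, h1, h⟩
  · rintro ⟨h0, h1, h⟩
    refine ⟨?_, h0, h1⟩
    rwa [abs_div, abs_of_pos h0, div_le_iff₀ h0]

theorem isFiniteMeasureOnCompacts_slopeMeasure [IsFiniteMeasure μ] :
    IsFiniteMeasureOnCompacts (slopeMeasure μ) := by
  have := isAddLeftInvariant_slopeMeasure (μ := μ)
  -- A diagonal matrix relates the cone of slope `1/16` and height `1` to the cone of slope `1/4`
  -- and height `1/2`. The latter lies in the unit ball, whose intensity is at most `2`; finiteness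
  -- near one slope spreads to all compact sets by translation.
  have hfin : slopeMeasure μ (Set.Icc (-(1 / 16)) (1 / 16)) ≠ ⊤ := by
    rw [slopeMeasure_Icc]
    have h2 : (0 : ℝ) < 1 / 2 := by norm_num
    have h := planeAct_diagSL_preimage_truncCone h2 (1 / 4) 1
    have heq : primIntensity μ (truncCone (1 / 16) 1) =
        primIntensity μ (truncCone (1 / 4) (1 / 2)) := by
      rw [← primIntensity_preimage (diagSL (1 / 2) h2) (measurableSet_truncCone _ _)]
      congr 1
      convert h using 2 <;> norm_num
    rw [heq]
    have hsub : truncCone (1 / 4) (1 / 2) ⊆ Metric.ball 0 1 := by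
      rintro v ⟨h0, h1, h⟩
      rw [mem_ball_zero_iff]
      have hsq : ‖v‖ ^ 2 < 1 ^ 2 := by
        rw [Plane.norm_sq_eq, ← sq_abs (v 0)]
        nlinarith [abs_nonneg (v 0)]
      exact lt_of_pow_lt_pow_left₀ 2 zero_le_one hsq
    refine ne_top_of_le_ne_top ?_ ((measure_mono hsub).trans (primIntensity_ball_le le_rfl))
    exact ENNReal.mul_ne_top (by simp) (measure_ne_top _ _)
  refine ⟨fun K hK => ?_⟩
  refine measure_lt_top_of_isCompact_of_isAddLeftInvariant' (U := Set.Icc (-(1 / 16)) (1 / 16))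
    ?_ hfin hK
  rw [interior_Icc]
  exact ⟨0, by norm_num⟩

theorem exists_primIntensity_truncCone [IsProbabilityMeasure μ] : ∃ c : NNReal, c ≠ 0 ∧
    ∀ r : ℝ, 0 < r → primIntensity μ (truncCone 1 r) = c * ENNReal.ofReal (2 * r ^ 2) := by
  have h1 := isAddLeftInvariant_slopeMeasure (μ := μ)
  have h2 := isFiniteMeasureOnCompacts_slopeMeasure (μ := μ)
  have hsmul := Measure.isAddLeftInvariant_eq_smul (slopeMeasure μ) volume
  set c := Measure.addHaarScalarFactor (slopeMeasure μ) volume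
  refine ⟨c, fun hc => ?_, fun r hr => ?_⟩
  -- If the constant were `0`, dilating the strip and applying quarter turns would give zero
  -- intensity to all nonzero vectors, although every lattice has a primitive vector.
  · have h0 : slopeMeasure μ = 0 := by rw [hsmul, hc, zero_smul]
    have hs1 : primIntensity μ (strip 1) = 0 := by
      have := slopeMeasure_apply μ MeasurableSet.univ
      rw [h0] at this
      simpa using this.symm
    have hupper : primIntensity μ {v | 0 < v 1} = 0 := by
      refine measure_mono_null (t := ⋃ n : ℕ, strip (n + 1)) (fun v hv => ?_)
        (measure_iUnion_null fun n => ?_)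
      · obtain ⟨n, hn⟩ := exists_nat_gt (v 1)
        exact Set.mem_iUnion.2 ⟨n, hv, hn.trans (by linarith)⟩
      · have hn : (0 : ℝ) < n + 1 := by positivity
        rw [← planeAct_diagSL_preimage_strip hn, primIntensity_preimage _ (measurableSet_strip 1), hs1]
    have hne0 : primIntensity μ {0}ᶜ = 0 := by
      have h := measure_iUnion_quarterTurn_le (μ := μ) (E := {v | 0 < v 1}) (F := {0}ᶜ)
        (measurableSet_lt measurable_const (measurable_coord 1)) fun v hv => by
          simp only [Set.mem_ofPred_eq, planeAct_quarterTurn_apply_one,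
            planeAct_quarterTurn_apply_zero]
          by_contra! hcon
          exact hv (Plane.ext_coord (by simp; linarith) (by simp; linarith))
      rw [hupper, mul_zero] at h
      exact le_antisymm h zero_le
    rw [primIntensity_apply μ (measurableSet_singleton 0).compl,
      lintegral_eq_zero_iff (measurable_count_primVectors (measurableSet_singleton 0).compl)] at hne0
    obtain ⟨L, hL⟩ := hne0.exists
    obtain ⟨e, he, he0, h, hmin⟩ := exists_norm_eq_succMin_one L
    have hmem : e ∈ ({0}ᶜ ∩ primVectors L : Set Plane) :=
      ⟨he0, mem_primVectors_of_minimal he he0 hmin⟩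
    have := measure_mono_null (Set.singleton_subset_iff.2 hmem) hL
    simp at this
  -- The cone of slope `1` and height `r` is equivalent to that of slope `r²` and height `1`, which
  -- corresponds to a slope interval of length `2r²`.
  · have hpre := planeAct_diagSL_preimage_truncCone hr 1 1
    rw [mul_one, mul_one] at hpre
    rw [← hpre, primIntensity_preimage _ (measurableSet_truncCone _ _), ← slopeMeasure_Icc, hsmul,
      Measure.smul_apply, Real.volume_Icc]
    rw [show r ^ 2 - -r ^ 2 = 2 * r ^ 2 by ring]
    rfl

/-- Cusp estimate: the probability that the shortest vector has norm `< r` is comparable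
to `r ^ 2`. -/
theorem exists_measure_succMin_lt_bounds [IsProbabilityMeasure μ] : ∃ c : NNReal, c ≠ 0 ∧
    (∀ r : ℝ, 0 < r → μ {L | succMin 1 L < r} ≤ 8 * c * ENNReal.ofReal (r ^ 2)) ∧
    ∀ r : ℝ, 0 < r → r ≤ 1 → c * ENNReal.ofReal (r ^ 2) ≤ 4 * μ {L | succMin 1 L < r} := by
  obtain ⟨c, hc, h⟩ := exists_primIntensity_truncCone (μ := μ)
  refine ⟨c, hc, fun r hr => ?_, fun r hr hr1 => ?_⟩
  · have hzero : primIntensity μ {0} = 0 := by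
      rw [primIntensity_apply μ (measurableSet_singleton 0)]
      have : ∀ L : LatticeSpace, ({0} : Set Plane) ∩ primVectors L = ∅ := fun L => by
        ext v
        simp only [Set.mem_inter_iff, Set.mem_singleton_iff, Set.mem_empty_iff_false, iff_false]
        rintro ⟨rfl, hv⟩
        exact hv.2.1 rfl
      simp [this]
    -- Four quarter turns of the cone cover the punctured ball; with the value `2r²` this produces
    -- the constant `8`.
    have hball : primIntensity μ (Metric.ball 0 r \ {0}) ≤ 4 * primIntensity μ (truncCone 1 r) := by
      refine measure_iUnion_quarterTurn_le (measurableSet_truncCone _ _) fun v hv => ?_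
      have hvr : ‖v‖ < r := by simpa using hv.1
      have hb : ∀ i, |v i| < r := fun i => (PiLp.norm_apply_le v i).trans_lt hvr
      have hv0 : v ≠ 0 := hv.2
      have hne : ¬ (v 0 = 0 ∧ v 1 = 0) := fun h => hv0 (Plane.ext_coord h.1 h.2)
      obtain ⟨hb0, hb0'⟩ := abs_lt.1 (hb 0)
      obtain ⟨hb1, hb1'⟩ := abs_lt.1 (hb 1)
      simp only [truncCone, Set.mem_ofPred_eq, planeAct_quarterTurn_apply_one,
        planeAct_quarterTurn_apply_zero, one_mul, abs_neg]
      rcases le_total |v 0| |v 1| with h | h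
      · rcases lt_trichotomy (v 1) 0 with h1 | h1 | h1
        · rw [abs_of_neg h1] at h
          exact Or.inr (Or.inr (Or.inl ⟨by linarith, by linarith, h⟩))
        · rw [h1, abs_zero] at h
          exact absurd ⟨abs_nonpos_iff.1 h, h1⟩ hne
        · rw [abs_of_pos h1] at h
          exact Or.inl ⟨h1, hb1', h⟩
      · rcases lt_trichotomy (v 0) 0 with h1 | h1 | h1
        · rw [abs_of_neg h1] at h
          exact Or.inr (Or.inr (Or.inr ⟨by linarith, by linarith, h⟩))
        · rw [h1, abs_zero] at h
          exact absurd ⟨h1, abs_nonpos_iff.1 h⟩ hne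
        · rw [abs_of_pos h1] at h
          exact Or.inr (Or.inl ⟨h1, hb0', h⟩)
    calc μ {L | succMin 1 L < r} ≤ primIntensity μ (Metric.ball 0 r) := le_primIntensity_ball r
      _ ≤ primIntensity μ (Metric.ball 0 r \ {0}) + primIntensity μ {0} :=
          (measure_mono (by rw [Set.sdiff_union_self]; exact Set.subset_union_left)).trans
            (measure_union_le _ _)
      _ ≤ 4 * (c * ENNReal.ofReal (2 * r ^ 2)) := by rw [hzero, add_zero, ← h r hr]; exact hball
      _ = _ := by
          rw [ENNReal.ofReal_mul (by norm_num)]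
          norm_num
          ring
  -- The smaller cone has intensity `c r²/2`, and the ball has intensity at most twice the
  -- probability; this gives the constant `4`.
  · have hsub : truncCone 1 (r / 2) ⊆ Metric.ball 0 r := by
      rintro v ⟨h0, h1, h⟩
      rw [mem_ball_zero_iff]
      have hsq : ‖v‖ ^ 2 < r ^ 2 := by
        rw [Plane.norm_sq_eq, ← sq_abs (v 0)]
        nlinarith [abs_nonneg (v 0)]
      exact lt_of_pow_lt_pow_left₀ 2 hr.le hsq
    have h1 := (measure_mono hsub).trans (primIntensity_ball_le (μ := μ) hr1)
    rw [h (r / 2) (by positivity)] at h1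
    calc (c : ENNReal) * ENNReal.ofReal (r ^ 2)
        = 2 * (c * ENNReal.ofReal (2 * (r / 2) ^ 2)) := by
          rw [show r ^ 2 = 2 * (2 * (r / 2) ^ 2) by ring,
            ENNReal.ofReal_mul (p := 2) (q := 2 * (r / 2) ^ 2) (by norm_num)]
          norm_num
          ring
      _ ≤ 2 * (2 * μ {L | succMin 1 L < r}) := by gcongr
      _ = _ := by rw [← mul_assoc]; norm_num

/-- By the layer-cake formula the upper cusp bound gives a tail of order `t^{-2/q}`, integrable at
infinity exactly because `q < 2`. -/
theorem lintegral_succMin_rpow_lt_top [IsProbabilityMeasure μ] {q : ℝ} (hq : 0 < q) (hq2 : q < 2) :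
    ∫⁻ L, ENNReal.ofReal (succMin 1 L ^ (-q)) ∂μ < ⊤ := by
  obtain ⟨c, -, hup, -⟩ := exists_measure_succMin_lt_bounds (μ := μ)
  have hm : Measurable fun L : LatticeSpace => succMin 1 L ^ (-q) :=
    (measurable_succMin (Or.inl rfl)).pow_const _
  rw [lintegral_eq_lintegral_meas_lt μ
    (ae_of_all _ fun L => Real.rpow_nonneg (succMin_one_pos L).le _) hm.aemeasurable]
  have hbound : ∀ t : ℝ, 1 < t → μ {L | t < succMin 1 L ^ (-q)} ≤
      8 * c * ENNReal.ofReal (t ^ (-(2 / q))) := by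
    intro t ht
    have ht0 : 0 < t := by linarith
    have hset : {L | t < succMin 1 L ^ (-q)} ⊆ {L : LatticeSpace | succMin 1 L < t ^ (-(1 / q))} := by
      intro L (hL : t < succMin 1 L ^ (-q))
      have hs := succMin_one_pos L
      have h := Real.rpow_lt_rpow_of_neg ht0 hL (z := -(1 / q)) (by simpa using hq)
      rwa [← Real.rpow_mul hs.le, show -q * -(1 / q) = 1 by field_simp, Real.rpow_one] at h
    refine (measure_mono hset).trans ((hup _ (Real.rpow_pos_of_pos ht0 _)).trans_eq ?_)
    rw [← Real.rpow_natCast, ← Real.rpow_mul ht0.le]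
    congr 3
    push_cast
    ring
  rw [← Set.Ioc_union_Ioi_eq_Ioi (zero_le_one (α := ℝ)),
    lintegral_union measurableSet_Ioi (Set.disjoint_left.2 fun x hx hx' => not_lt.2 hx.2 hx')]
  refine ENNReal.add_lt_top.2 ⟨?_, ?_⟩
  · refine (setLIntegral_mono measurable_const fun t _ => prob_le_one (μ := μ)).trans_lt ?_
    simp
  · refine (setLIntegral_mono (by fun_prop) fun t ht => hbound t ht).trans_lt ?_
    rw [lintegral_const_mul _ (by fun_prop)]
    refine ENNReal.mul_lt_top (ENNReal.mul_lt_top (by simp) (by simp)) ?_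
    have hint : IntegrableOn (fun t : ℝ => t ^ (-(2 / q))) (Set.Ioi 1) :=
      integrableOn_Ioi_rpow_of_lt (by rw [neg_lt_neg_iff, one_lt_div hq]; exact hq2) one_pos
    exact hint.lintegral_lt_top

/-- Were the integral finite, its parts over the shrinking sets `‖L‖₁ < r_n` would tend to `0`. The
lower cusp bound keeps each part at least `r_n^{-2} · c r_n²/4 = c/4`. -/
theorem lintegral_succMin_rpow_neg_two_eq_top [IsProbabilityMeasure μ] {α : ℝ} (hα : 0 < α) :
    ∫⁻ L in {L | succMin 1 L < α}, ENNReal.ofReal (succMin 1 L ^ (-2 : ℝ)) ∂μ = ⊤ := by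
  obtain ⟨c, hc, hup, hlow⟩ := exists_measure_succMin_lt_bounds (μ := μ)
  by_contra hfin
  have hms : ∀ r : ℝ, MeasurableSet {L : LatticeSpace | succMin 1 L < r} := fun r =>
    measurableSet_lt (measurable_succMin (Or.inl rfl)) measurable_const
  set f : LatticeSpace → ENNReal := fun L => ENNReal.ofReal (succMin 1 L ^ (-2 : ℝ)) with hf
  set ν := μ.restrict {L | succMin 1 L < α} with hν
  let r : ℕ → ℝ := fun n => min α 1 / (n + 1)
  have hr0 : ∀ n, 0 < r n := fun n => div_pos (lt_min hα one_pos) (by positivity)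
  have hrle : ∀ n, r n ≤ min α 1 := fun n =>
    div_le_self (lt_min hα one_pos).le (by linarith [n.cast_nonneg (α := ℝ)])
  have hrt : Tendsto r atTop (𝓝 0) :=
    tendsto_const_nhds.div_atTop (tendsto_atTop_add_const_right _ _ tendsto_natCast_atTop_atTop)
  have hmeas : Tendsto (fun n => ν {L | succMin 1 L < r n}) atTop (𝓝 0) := by
    have h0 : Tendsto (fun n => 8 * c * ENNReal.ofReal (r n ^ 2)) atTop (𝓝 0) := by
      have := ENNReal.Tendsto.const_mul (a := 8 * (c : ENNReal))
        (ENNReal.tendsto_ofReal (hrt.pow 2)) (Or.inr (ENNReal.mul_ne_top (by simp) (by simp)))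
      simpa using this
    exact tendsto_of_tendsto_of_tendsto_of_le_of_le tendsto_const_nhds h0 (fun _ => zero_le)
      fun n => (Measure.restrict_apply_le _ _).trans (hup _ (hr0 n))
  have hlim := tendsto_setLIntegral_zero hfin hmeas
  have hge : ∀ n, (c : ENNReal) / 4 ≤ ∫⁻ L in {L | succMin 1 L < r n}, f L ∂ν := by
    intro n
    have hrn := hr0 n
    have hsub : {L : LatticeSpace | succMin 1 L < r n} ⊆ {L | succMin 1 L < α} := fun L hL =>
      lt_of_lt_of_le hL ((hrle n).trans (min_le_left _ _))
    have hrr : ν.restrict {L | succMin 1 L < r n} = μ.restrict {L | succMin 1 L < r n} := by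
      rw [hν, Measure.restrict_restrict (hms _), Set.inter_eq_left.2 hsub]
    rw [hrr]
    have h1 : ∫⁻ _ in {L : LatticeSpace | succMin 1 L < r n}, ENNReal.ofReal (r n ^ (-2 : ℝ)) ∂μ ≤
        ∫⁻ L in {L | succMin 1 L < r n}, f L ∂μ := by
      refine setLIntegral_mono' (hms _) fun L (hL : succMin 1 L < r n) => ?_
      exact ENNReal.ofReal_le_ofReal
        (Real.rpow_le_rpow_of_nonpos (succMin_one_pos L) hL.le (by norm_num))
    rw [setLIntegral_const] at h1
    refine le_trans ?_ h1
    have h2 := hlow (r n) hrn ((hrle n).trans (min_le_right _ _))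
    refine ENNReal.div_le_of_le_mul ?_
    calc (c : ENNReal) = ENNReal.ofReal (r n ^ (-2 : ℝ)) * (c * ENNReal.ofReal (r n ^ 2)) := by
          rw [mul_left_comm, ← ENNReal.ofReal_mul (by positivity), Real.rpow_neg hrn.le]
          norm_num
          rw [inv_mul_cancel₀ (by positivity)]
          simp
      _ ≤ ENNReal.ofReal (r n ^ (-2 : ℝ)) * (4 * μ {L | succMin 1 L < r n}) := by gcongr
      _ = _ := by ring
  have := ge_of_tendsto' hlim hge
  simp [hc] at this

end LatticeSpace

/-! ### The variance as a function of the lattice -/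

theorem summable_int_prod_rpow : Summable fun k : ℤ × ℤ =>
    |(k.1 : ℝ)| ^ (-(3 / 2) : ℝ) * |(k.2 : ℝ)| ^ (-(3 / 2) : ℝ) := by
  have h : Summable fun n : ℤ => |(n : ℝ)| ^ (-(3 / 2) : ℝ) :=
    Real.summable_abs_int_rpow (by norm_num)
  exact h.mul_of_nonneg h (fun n => by positivity) fun n => by positivity

/-- The index of `e₁(L)`. -/
def firstIndex : PrimIndex := ⟨(1, 0), by simp [PrimIndex, isCoprime_one_left]⟩

instance instInfinitePrimIndex : Infinite PrimIndex :=
  Infinite.of_injective (fun n : ℤ => (⟨(1, n), by simp [PrimIndex, isCoprime_one_left]⟩ : PrimIndex))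
    fun m n h => congrArg (fun k : PrimIndex => k.1.2) h

theorem primIndex_cases (k : PrimIndex) : k.1 = (1, 0) ∨ k.1 = (0, 1) ∨ (k.1.1 ≠ 0 ∧ k.1.2 ≠ 0) := by
  obtain ⟨⟨a, b⟩, hcop, ha, h0⟩ := k
  simp only at hcop ha h0 ⊢
  by_cases ha0 : a = 0
  · exact Or.inr (Or.inl (by rw [ha0, h0 ha0]))
  · by_cases hb0 : b = 0
    · rw [hb0, isCoprime_zero_right, Int.isUnit_iff] at hcop
      rcases hcop with h | h
      · exact Or.inl (by rw [h, hb0])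
      · omega
    · exact Or.inr (Or.inr ⟨ha0, hb0⟩)

namespace LatticeSpace

variable {L : LatticeSpace}

theorem IsGeneric.norm_minVec_one (hL : IsGeneric L) : ‖minVec 1 L‖ = succMin 1 L :=
  (minVec_spec (hL.existsUnique_succMin (Or.inl rfl))).2.2

theorem combVec_firstIndex : combVec L (firstIndex : ℤ × ℤ) = minVec 1 L := by
  simp [combVec, firstIndex]

theorem IsGeneric.combVec_ne_zero (hL : IsGeneric L) (k : PrimIndex) : combVec L k ≠ 0 := by
  obtain ⟨ha, hab, -, -⟩ := hL.minVec_reduced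
  have hb : 0 < ‖minVec 2 L‖ := ha.trans_le hab
  have h := hL.norm_combVec_sq_ge k
  rw [← norm_pos_iff]
  by_contra hcon
  have h0 : ‖combVec L k‖ = 0 := le_antisymm (not_lt.1 hcon) (norm_nonneg _)
  rw [h0] at h
  have h1 : 0 < ((k.1.1 : ℝ) ^ 2 * ‖minVec 1 L‖ ^ 2 + (k.1.2 : ℝ) ^ 2 * ‖minVec 2 L‖ ^ 2) / 2 := by
    rcases primIndex_cases k with hk | hk | hk
    · rw [hk]; simp; positivity
    · rw [hk]; simp; positivity
    · have := hk.1
      have := hk.2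
      positivity
  norm_num at h
  linarith

/-- Only the index of `e₁` feels the cusp. Since `‖e₁‖ ≤ ‖e₂‖` and `‖e₁‖‖e₂‖ ≥ 1`, the vector `e₂`
has norm at least `1`; off the axes the arithmetic-geometric inequality gives `‖e_k‖² ≥ |k₁k₂|`. On
the axes the last term is `0`, as a negative real power of `0` is `0`. -/
theorem IsGeneric.norm_combVec_rpow_le (hL : IsGeneric L) (k : PrimIndex) :
    ‖combVec L k‖ ^ (-3 : ℝ) ≤ (if k.1 = (1, 0) then succMin 1 L ^ (-3 : ℝ) else 0) +
      (if k.1 = (0, 1) then 1 else 0) +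
      |(k.1.1 : ℝ)| ^ (-(3 / 2) : ℝ) * |(k.1.2 : ℝ)| ^ (-(3 / 2) : ℝ) := by
  obtain ⟨ha, hab, hab1, -⟩ := hL.minVec_reduced
  have hge := hL.norm_combVec_sq_ge k
  have ha' := hL.norm_minVec_one
  rcases primIndex_cases k with hk | hk | hk
  · rw [hk]
    simp [combVec, ha']
  · rw [hk]
    have hb : 1 ≤ ‖minVec 2 L‖ := by
      by_contra! hb
      nlinarith [norm_nonneg (minVec 2 L)]
    have : ‖minVec 2 L‖ ^ (-3 : ℝ) ≤ 1 := Real.rpow_le_one_of_one_le_of_nonpos hb (by norm_num)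
    simpa [combVec] using this
  · have h1 : (k : ℤ × ℤ) ≠ (1, 0) := fun h => hk.2 (by rw [h])
    have h2 : (k : ℤ × ℤ) ≠ (0, 1) := fun h => hk.1 (by rw [h])
    rw [if_neg h1, if_neg h2, zero_add, zero_add,
      ← Real.mul_rpow (abs_nonneg _) (abs_nonneg _)]
    set x : ℝ := |(k.1.1 : ℝ)| with hx
    set y : ℝ := |(k.1.2 : ℝ)| with hy
    have hx0 : 0 < x := abs_pos.2 (by exact_mod_cast hk.1)
    have hy0 : 0 < y := abs_pos.2 (by exact_mod_cast hk.2)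
    rw [← sq_abs (k.1.1 : ℝ), ← sq_abs (k.1.2 : ℝ), ← hx, ← hy] at hge
    have hxy : x * y ≤ ‖combVec L k‖ ^ 2 := by
      have h3 : x * y * 1 ≤ x * y * (‖minVec 1 L‖ * ‖minVec 2 L‖) := by gcongr
      nlinarith [sq_nonneg (x * ‖minVec 1 L‖ - y * ‖minVec 2 L‖)]
    have h4 : ‖combVec L k‖ ^ (-3 : ℝ) = (‖combVec L k‖ ^ 2) ^ (-(3 / 2) : ℝ) := by
      rw [← Real.rpow_natCast, ← Real.rpow_mul (norm_nonneg _)]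
      norm_num
    rw [h4]
    exact Real.rpow_le_rpow_of_nonpos (by positivity) hxy (by norm_num)

theorem exists_sum_norm_combVec_le : ∃ C : ℝ, 0 < C ∧ ∀ L : LatticeSpace, IsGeneric L →
    ∀ F : Finset PrimIndex, ∑ k ∈ F, ‖combVec L k‖ ^ (-3 : ℝ) ≤ C * (succMin 1 L ^ (-3 : ℝ) + 1) := by
  classical
  set h : ℤ × ℤ → ℝ := fun k => |(k.1 : ℝ)| ^ (-(3 / 2) : ℝ) * |(k.2 : ℝ)| ^ (-(3 / 2) : ℝ) with hh
  have h0 : ∀ k, 0 ≤ h k := fun k => by simp only [hh]; positivity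
  have hsum : 0 ≤ ∑' k, h k := tsum_nonneg h0
  refine ⟨1 + ∑' k, h k, by positivity, fun L hL F => ?_⟩
  have ha : 0 ≤ succMin 1 L ^ (-3 : ℝ) := Real.rpow_nonneg (succMin_one_pos L).le _
  have hsingle : ∀ (c : ℤ × ℤ) (r : ℝ), 0 ≤ r → ∑ k ∈ F, (if k.1 = c then r else 0) ≤ r := by
    intro c r hr
    rw [← Finset.sum_filter, Finset.sum_const, nsmul_eq_mul]
    have hcard : (F.filter fun k => k.1 = c).card ≤ 1 := Finset.card_le_one.2 fun a ha b hb =>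
      Subtype.ext ((Finset.mem_filter.1 ha).2.trans (Finset.mem_filter.1 hb).2.symm)
    have : ((F.filter fun k => k.1 = c).card : ℝ) ≤ 1 := by exact_mod_cast hcard
    nlinarith
  calc ∑ k ∈ F, ‖combVec L k‖ ^ (-3 : ℝ)
      ≤ ∑ k ∈ F, ((if k.1 = (1, 0) then succMin 1 L ^ (-3 : ℝ) else 0) +
        (if k.1 = (0, 1) then 1 else 0) + h k) :=
        Finset.sum_le_sum fun k _ => hL.norm_combVec_rpow_le k
    _ ≤ succMin 1 L ^ (-3 : ℝ) + 1 + ∑' k, h k := by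
        rw [Finset.sum_add_distrib, Finset.sum_add_distrib]
        refine add_le_add (add_le_add (hsingle _ _ ha) (hsingle _ _ zero_le_one)) ?_
        have hmap : ∑ k ∈ F, h k = ∑ k ∈ F.map (Function.Embedding.subtype (· ∈ PrimIndex)), h k :=
          (Finset.sum_map F (Function.Embedding.subtype (· ∈ PrimIndex)) h).symm
        rw [hmap]
        exact summable_int_prod_rpow.sum_le_tsum _ fun k _ => h0 k
    _ ≤ _ := by nlinarith

/-- The terms of the convergent series `∑ ‖e_k‖^{-3}` tend to `0`, so only finitely many of the
norms are bounded by `A`. -/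
theorem IsGeneric.finite_norm_combVec_le (hL : IsGeneric L) (A : ℝ) :
    {k : PrimIndex | ‖combVec L k‖ ≤ A}.Finite := by
  obtain ⟨C, -, hC⟩ := exists_sum_norm_combVec_le
  have hs : Summable fun k : PrimIndex => ‖combVec L k‖ ^ (-3 : ℝ) :=
    summable_of_sum_le (fun k => by positivity) (hC L hL)
  have hpos : 0 < max A 1 ^ (-3 : ℝ) := by positivity
  have hev := hs.tendsto_cofinite_zero.eventually (Iio_mem_nhds hpos)
  refine Set.Finite.subset (Filter.eventually_cofinite.1 hev) fun k (hk : ‖combVec L k‖ ≤ A) => ?_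
  refine not_lt.2 (Real.rpow_le_rpow_of_nonpos (norm_pos_iff.2 (hL.combVec_ne_zero k))
    (hk.trans (le_max_left _ _)) (by norm_num))

end LatticeSpace

/-! ### Moments of the limit -/

theorem integrable_abs_rpow_of_lintegral_lt_top {Y : Type*} [MeasurableSpace Y] {m : Measure Y}
    {S : Y → ℝ} (hS : AEMeasurable S m) {p : ℝ}
    (h : ∫⁻ x, ENNReal.ofReal (|S x| ^ p) ∂m < ⊤) : Integrable (fun x => |S x| ^ p) m := by
  refine ⟨(hS.abs.pow_const p).aestronglyMeasurable, ?_⟩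
  rw [hasFiniteIntegral_iff_ofReal (ae_of_all _ fun x => by positivity)]
  exact h

namespace LatticeSpace

/-- The shape of the variance of the random sums as a function of the lattice. -/
noncomputable def cuspBound (C : ℝ) (L : LatticeSpace) : ℝ := C * (succMin 1 L ^ (-3 : ℝ) + 1)

theorem cuspBound_pos {C : ℝ} (hC : 0 < C) (L : LatticeSpace) : 0 < cuspBound C L := by
  have := Real.rpow_pos_of_pos (succMin_one_pos L) (-3)
  unfold cuspBound
  positivity

theorem lintegral_withDensity_lt_top {μ ν : Measure LatticeSpace} {σ : LatticeSpace → ℝ}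
    (hσ_bdd : ∃ C : ℝ, ∀ L, σ L ≤ C) (hσ_meas : Measurable σ)
    (hν : ν = μ.withDensity fun L => ENNReal.ofReal (σ L)) {f : LatticeSpace → ENNReal}
    (hf : Measurable f) (h : ∫⁻ L, f L ∂μ < ⊤) : ∫⁻ L, f L ∂ν < ⊤ := by
  obtain ⟨C, hC⟩ := hσ_bdd
  rw [hν, lintegral_withDensity_eq_lintegral_mul _ hσ_meas.ennreal_ofReal hf]
  calc ∫⁻ L, ((fun L => ENNReal.ofReal (σ L)) * f) L ∂μ ≤ ∫⁻ L, ENNReal.ofReal C * f L ∂μ :=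
        lintegral_mono fun L => by
          simp only [Pi.mul_apply]
          exact mul_le_mul_left (ENNReal.ofReal_le_ofReal (hC L)) _
    _ = ENNReal.ofReal C * ∫⁻ L, f L ∂μ := lintegral_const_mul _ hf
    _ < ⊤ := ENNReal.mul_lt_top ENNReal.ofReal_lt_top h

theorem cuspBound_rpow_le {C K p : ℝ} (hC : 0 < C) (hp : 0 ≤ p) (L : LatticeSpace) :
    (cuspBound C L * K ^ 2) ^ (p / 2) ≤
      (2 * C * K ^ 2) ^ (p / 2) * (succMin 1 L ^ (-(3 * p / 2)) + 1) := by
  have hs := succMin_one_pos L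
  set a := succMin 1 L ^ (-3 : ℝ) with ha
  have ha0 : 0 < a := Real.rpow_pos_of_pos hs _
  have hap : succMin 1 L ^ (-(3 * p / 2)) = a ^ (p / 2) := by
    rw [ha, ← Real.rpow_mul hs.le]; ring_nf
  have hp2 : 0 ≤ p / 2 := by positivity
  have h1 : cuspBound C L * K ^ 2 ≤ 2 * C * K ^ 2 * max a 1 := by
    have h2 : a + 1 ≤ 2 * max a 1 := by linarith [le_max_left a 1, le_max_right a 1]
    calc cuspBound C L * K ^ 2 = C * K ^ 2 * (a + 1) := by rw [cuspBound]; ring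
      _ ≤ C * K ^ 2 * (2 * max a 1) := by gcongr
      _ = _ := by ring
  have h0 : 0 ≤ cuspBound C L * K ^ 2 := mul_nonneg (cuspBound_pos hC L).le (sq_nonneg K)
  refine (Real.rpow_le_rpow h0 h1 hp2).trans ?_
  rw [Real.mul_rpow (by positivity) (by positivity), hap]
  gcongr
  rcases le_total a 1 with h | h
  · rw [max_eq_right h, Real.one_rpow]
    linarith [Real.rpow_pos_of_pos ha0 (p / 2)]
  · rw [max_eq_left h]
    linarith

theorem lintegral_cuspBound_lt_top {μ ν : Measure LatticeSpace} [IsProbabilityMeasure μ]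
    [SMulInvariantMeasure (Matrix.SpecialLinearGroup (Fin 2) ℝ) LatticeSpace μ]
    {σ : LatticeSpace → ℝ} (hσ_bdd : ∃ C : ℝ, ∀ L, σ L ≤ C) (hσ_meas : Measurable σ)
    (hν : ν = μ.withDensity fun L => ENNReal.ofReal (σ L)) {C K p c : ℝ} (hC : 0 < C) (hc : 0 ≤ c)
    (hp0 : 0 < p) (hp : p < 4 / 3) :
    ∫⁻ L, ENNReal.ofReal (c * (cuspBound C L * K ^ 2) ^ (p / 2)) ∂ν < ⊤ := by
  have hm : Measurable fun L : LatticeSpace => succMin 1 L ^ (-(3 * p / 2)) :=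
    (measurable_succMin (Or.inl rfl)).pow_const _
  have hle : ∀ L, ENNReal.ofReal (c * (cuspBound C L * K ^ 2) ^ (p / 2)) ≤
      ENNReal.ofReal (c * (2 * C * K ^ 2) ^ (p / 2)) *
        (ENNReal.ofReal (succMin 1 L ^ (-(3 * p / 2))) + 1) := by
    intro L
    have h0 := Real.rpow_nonneg (succMin_one_pos L).le (-(3 * p / 2))
    rw [← ENNReal.ofReal_one, ← ENNReal.ofReal_add h0 zero_le_one,
      ← ENNReal.ofReal_mul (by positivity), mul_assoc]
    exact ENNReal.ofReal_le_ofReal (mul_le_mul_of_nonneg_left (cuspBound_rpow_le hC hp0.le L) hc)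
  refine (lintegral_mono hle).trans_lt ?_
  refine lintegral_withDensity_lt_top hσ_bdd hσ_meas hν
    ((hm.ennreal_ofReal.add_const 1).const_mul _) ?_
  rw [lintegral_const_mul _ (hm.ennreal_ofReal.add_const 1), lintegral_add_right _ measurable_const]
  refine ENNReal.mul_lt_top ENNReal.ofReal_lt_top (ENNReal.add_lt_top.2 ⟨?_, by simp⟩)
  -- The exponent is `3p/2`, so `p < 4/3` is exactly the condition `3p/2 < 2` of the cusp estimate.
  exact lintegral_succMin_rpow_lt_top (by positivity) (by linarith)

theorem lintegral_cuspBound_lt_top_of_away {ν : Measure LatticeSpace} [IsProbabilityMeasure ν]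
    {C K p c α : ℝ} (hC : 0 < C) (hc : 0 ≤ c) (hp0 : 0 ≤ p) (hα : 0 < α)
    (hν : ν {L | succMin 1 L < α} = 0) :
    ∫⁻ L, ENNReal.ofReal (c * (cuspBound C L * K ^ 2) ^ (p / 2)) ∂ν < ⊤ := by
  have hae : ∀ᵐ L ∂ν, ENNReal.ofReal (c * (cuspBound C L * K ^ 2) ^ (p / 2)) ≤
      ENNReal.ofReal (c * ((C * (α ^ (-3 : ℝ) + 1)) * K ^ 2) ^ (p / 2)) := by
    filter_upwards [measure_eq_zero_iff_ae_notMem.1 hν] with L hL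
    have hL : α ≤ succMin 1 L := not_lt.1 hL
    have h1 : succMin 1 L ^ (-3 : ℝ) ≤ α ^ (-3 : ℝ) :=
      Real.rpow_le_rpow_of_nonpos hα hL (by norm_num)
    have h0 := (cuspBound_pos hC L).le
    refine ENNReal.ofReal_le_ofReal (mul_le_mul_of_nonneg_left ?_ hc)
    refine Real.rpow_le_rpow (by positivity) ?_ (by positivity)
    unfold cuspBound
    gcongr
  refine (lintegral_mono_ae hae).trans_lt ?_
  simp

/-- The conclusions on the random sums, for an abstract system of weights on the lattice. -/
theorem exists_lattice_series_limit {ι Ω : Type*} [Countable ι] [Infinite ι]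
    {μ ν : Measure LatticeSpace} [IsProbabilityMeasure μ]
    [SMulInvariantMeasure (Matrix.SpecialLinearGroup (Fin 2) ℝ) LatticeSpace μ]
    [IsProbabilityMeasure ν] {σ : LatticeSpace → ℝ} (hσ_meas : Measurable σ)
    (hσ_bdd : ∃ C : ℝ, ∀ L, σ L ≤ C)
    (hν : ν = μ.withDensity fun L => ENNReal.ofReal (σ L))
    [MeasurableSpace Ω] {P : Measure Ω} [IsProbabilityMeasure P] {Z : ι → Ω → ℝ} {K : ℝ}
    (hZm : ∀ i, Measurable (Z i)) (hZi : iIndepFun Z P)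
    (hZs : ∀ i, P.map (Z i) = P.map fun ω => -Z i ω)
    (hK : 0 < K) (hZK : ∀ i, ∀ᵐ ω ∂P, |Z i ω| ≤ K)
    (idx : ι → PrimIndex) (hidx : ∀ k, (idx ⁻¹' {k}).Finite)
    {w : ι → LatticeSpace → ℝ} (hw : ∀ i, AEMeasurable (w i) ν) {C : ℝ} (hC : 0 < C)
    (hwC : ∀ L, IsGeneric L → ∀ F : Finset ι, ∑ i ∈ F, w i L ^ 2 ≤ cuspBound C L)
    {i₀ : ι} (hZ0 : ¬ ∀ᵐ ω ∂P, Z i₀ ω = 0) {m : ℝ} (hm : 0 < m)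
    (hw0 : ∀ L, IsGeneric L → m * succMin 1 L ^ (-(3 / 2) : ℝ) ≤ |w i₀ L|) :
    ∃ S : Ω × LatticeSpace → ℝ, AEMeasurable S (P.prod ν) ∧
      (∀ᵐ x ∂P.prod ν, Tendsto (truncSum (fun i => ‖combVec x.2 (idx i)‖) (w · x.2) (Z · x.1))
        atTop (𝓝 (S x))) ∧
      (P.prod ν).map S = (P.prod ν).map (fun x => -S x) ∧
      (Integrable S (P.prod ν) ∧ ∫ x, S x ∂(P.prod ν) = 0) ∧
      (∀ κ : ℝ, 0 ≤ κ → κ < 1 / 3 → Integrable (fun x => |S x| ^ (1 + κ)) (P.prod ν)) ∧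
      ((∃ m > 0, ∃ α > 0, ∀ L : LatticeSpace, L.succMin 1 < α → m ≤ σ L) →
        ¬ Integrable (fun x => |S x| ^ (4 / 3 : ℝ)) (P.prod ν)) ∧
      ((∃ α > 0, ν {L : LatticeSpace | L.succMin 1 < α} = 0) →
        ∀ p : ℝ, 1 ≤ p → Integrable (fun x => |S x| ^ p) (P.prod ν)) := by
  have hgen : ∀ᵐ L ∂ν, IsGeneric L := by
    rw [hν]
    exact (withDensity_absolutelyContinuous _ _).ae_le (ae_isGeneric (μ := μ))
  obtain ⟨S, hSm, hS, hSs, hup, hlow⟩ := exists_series_limit hZm hZi hZs hK hZK (ν := ν)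
    (N := fun i L => ‖combVec L (idx i)‖) (w := w) (B := cuspBound C)
    (fun i => (aemeasurable_combVec hgen _).norm) hw
    (hgen.mono fun L hL A => by
      have : {i | ‖combVec L (idx i)‖ ≤ A} = idx ⁻¹' {k : PrimIndex | ‖combVec L k‖ ≤ A} := rfl
      rw [this]
      exact (hL.finite_norm_combVec_le A).preimage' fun k _ => hidx k)
    (cuspBound_pos hC) (hgen.mono hwC)
  have hcon : ∀ p : ℝ, 0 ≤ p → 0 ≤ p ^ p * (2 * Real.exp (1 / 2)) := fun p hp => by positivity
  have hmom : ∀ p : ℝ, 0 < p → p < 4 / 3 → Integrable (fun x => |S x| ^ p) (P.prod ν) :=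
    fun p hp0 hp => integrable_abs_rpow_of_lintegral_lt_top hSm ((hup p hp0.le).trans_lt
      (lintegral_cuspBound_lt_top hσ_bdd hσ_meas hν hC (hcon p hp0.le) hp0 hp))
  have hSint : Integrable S (P.prod ν) := by
    have h := hmom 1 one_pos (by norm_num)
    simp only [Real.rpow_one] at h
    exact (integrable_norm_iff hSm.aestronglyMeasurable).1 h
  refine ⟨S, hSm, hS, hSs, ⟨hSint, integral_eq_zero_of_map_neg_eq hSm hSs⟩,
    fun κ h0 h1 => hmom _ (by linarith) (by linarith), ?_, ?_⟩
  · rintro ⟨m', hm', α, hα, hσ⟩ hint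
    have hfin : ∫⁻ x, ENNReal.ofReal (|S x| ^ (4 / 3 : ℝ)) ∂P.prod ν < ⊤ := by
      have := hint.2
      rwa [hasFiniteIntegral_iff_ofReal (ae_of_all _ fun x => by positivity)] at this
    -- A finite moment of `S` would make the moment of the single term `i₀` finite. That moment
    -- factors into a nonzero moment of `Z i₀` and an integral of the weight, which is shown to
    -- diverge.
    have hfin' := (hlow i₀ (4 / 3) (by norm_num)).trans_lt (ENNReal.mul_lt_top (by simp) hfin)
    have hsplit : ∀ x : Ω × LatticeSpace, ENNReal.ofReal (|w i₀ x.2 * Z i₀ x.1| ^ (4 / 3 : ℝ)) =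
        ENNReal.ofReal (|Z i₀ x.1| ^ (4 / 3 : ℝ)) * ENNReal.ofReal (|w i₀ x.2| ^ (4 / 3 : ℝ)) := by
      intro x
      rw [← ENNReal.ofReal_mul (by positivity), abs_mul,
        Real.mul_rpow (abs_nonneg _) (abs_nonneg _), mul_comm]
    have hZpow : Measurable fun ω => ENNReal.ofReal (|Z i₀ ω| ^ (4 / 3 : ℝ)) :=
      ((hZm i₀).abs.pow_const _).ennreal_ofReal
    simp only [hsplit] at hfin'
    rw [lintegral_prod_mul hZpow.aemeasurable ((hw i₀).abs.pow_const _).ennreal_ofReal] at hfin'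
    have hZne : ∫⁻ ω, ENNReal.ofReal (|Z i₀ ω| ^ (4 / 3 : ℝ)) ∂P ≠ 0 := by
      intro h
      rw [lintegral_eq_zero_iff hZpow] at h
      refine hZ0 (h.mono fun ω hω => ?_)
      have h1 : |Z i₀ ω| ^ (4 / 3 : ℝ) ≤ 0 := ENNReal.ofReal_eq_zero.1 hω
      have h2 : |Z i₀ ω| ^ (4 / 3 : ℝ) = 0 := le_antisymm h1 (by positivity)
      exact abs_eq_zero.1 ((Real.rpow_eq_zero (abs_nonneg _) (by norm_num)).1 h2)
    have hwtop : ∫⁻ L, ENNReal.ofReal (|w i₀ L| ^ (4 / 3 : ℝ)) ∂ν = ⊤ := by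
      have hmeas : Measurable fun L : LatticeSpace => ENNReal.ofReal (succMin 1 L ^ (-2 : ℝ)) :=
        ((measurable_succMin (Or.inl rfl)).pow_const _).ennreal_ofReal
      have hset : MeasurableSet {L : LatticeSpace | succMin 1 L < α} :=
        measurableSet_lt (measurable_succMin (Or.inl rfl)) measurable_const
      have h1 : ∫⁻ L, ENNReal.ofReal (m ^ (4 / 3 : ℝ)) * ENNReal.ofReal (succMin 1 L ^ (-2 : ℝ)) ∂ν ≤
          ∫⁻ L, ENNReal.ofReal (|w i₀ L| ^ (4 / 3 : ℝ)) ∂ν := by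
        refine lintegral_mono_ae (hgen.mono fun L hL => ?_)
        have hs := succMin_one_pos L
        rw [← ENNReal.ofReal_mul (by positivity)]
        refine ENNReal.ofReal_le_ofReal ?_
        -- Since `(3/2)(4/3) = 2`, the weight raised to the power `4/3` is at least a multiple of
        -- `‖L‖₁^{-2}`, the borderline non-integrable power.
        have h2 := Real.rpow_le_rpow (by positivity) (hw0 L hL) (by norm_num : (0 : ℝ) ≤ 4 / 3)
        rw [Real.mul_rpow hm.le (by positivity), ← Real.rpow_mul hs.le] at h2
        norm_num at h2 ⊢
        exact h2
      rw [lintegral_const_mul _ hmeas] at h1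
      have h3 : ∫⁻ L, ENNReal.ofReal (succMin 1 L ^ (-2 : ℝ)) ∂ν = ⊤ := by
        rw [hν, lintegral_withDensity_eq_lintegral_mul _ hσ_meas.ennreal_ofReal hmeas, eq_top_iff]
        calc (⊤ : ENNReal) = ENNReal.ofReal m' *
              ∫⁻ L in {L | succMin 1 L < α}, ENNReal.ofReal (succMin 1 L ^ (-2 : ℝ)) ∂μ := by
              rw [lintegral_succMin_rpow_neg_two_eq_top hα,
                ENNReal.mul_top (ENNReal.ofReal_pos.2 hm').ne']
          _ = ∫⁻ L in {L | succMin 1 L < α},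
                ENNReal.ofReal m' * ENNReal.ofReal (succMin 1 L ^ (-2 : ℝ)) ∂μ :=
              (lintegral_const_mul _ hmeas).symm
          _ ≤ ∫⁻ L in {L | succMin 1 L < α}, ((fun L => ENNReal.ofReal (σ L)) *
                fun L => ENNReal.ofReal (succMin 1 L ^ (-2 : ℝ))) L ∂μ := by
              refine setLIntegral_mono' hset fun L hL => ?_
              simp only [Pi.mul_apply]
              exact mul_le_mul_left (ENNReal.ofReal_le_ofReal (hσ L hL)) _
          _ ≤ _ := setLIntegral_le_lintegral _ _
      rw [h3, ENNReal.mul_top (ENNReal.ofReal_pos.2 (by positivity)).ne'] at h1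
      exact top_le_iff.1 h1
    rw [hwtop, ENNReal.mul_top hZne] at hfin'
    exact lt_irrefl _ hfin'
  · rintro ⟨α, hα, hνα⟩ p hp
    have hp0 : 0 ≤ p := by linarith
    exact integrable_abs_rpow_of_lintegral_lt_top hSm ((hup p hp0).trans_lt
      (lintegral_cuspBound_lt_top_of_away hC (hcon p hp0) hp0 hα hνα))

/-! ### Application to the two types of sums -/

section Weights

variable {D : Set Plane} {c : ℝ → Plane}

/-- The weight of the vector `s • e_k(L)`, for a sign `s`. -/
noncomputable def vecWeight (D : Set Plane) (c : ℝ → Plane) (s : ℝ) (k : PrimIndex)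
    (L : LatticeSpace) : ℝ :=
  normalRadius D c (s • combVec L k) / ‖combVec L k‖ ^ (3 / 2 : ℝ)

theorem aemeasurable_vecWeight {T : ℝ} (hD : IsAnalyticOval D c T) {ν : Measure LatticeSpace}
    (hν : ∀ᵐ L ∂ν, IsGeneric L) (s : ℝ) (k : PrimIndex) : AEMeasurable (vecWeight D c s k) ν := by
  have h := aemeasurable_combVec hν k
  exact (hD.measurable_normalRadius.comp_aemeasurable (h.const_smul s)).div (h.norm.pow_const _)

theorem vecWeight_sq_le {M : ℝ} (hM : ∀ ξ, 0 ≤ normalRadius D c ξ ∧ normalRadius D c ξ ≤ M)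
    (s : ℝ) (k : PrimIndex) (L : LatticeSpace) :
    vecWeight D c s k L ^ 2 ≤ M ^ 2 * ‖combVec L k‖ ^ (-3 : ℝ) := by
  have h1 : (‖combVec L k‖ ^ (3 / 2 : ℝ)) ^ 2 = ‖combVec L k‖ ^ (3 : ℝ) := by
    rw [← Real.rpow_natCast (‖combVec L k‖ ^ (3 / 2 : ℝ)), ← Real.rpow_mul (norm_nonneg _)]
    norm_num
  rw [vecWeight, div_pow, h1, Real.rpow_neg (norm_nonneg _), ← div_eq_mul_inv]
  have := hM (s • combVec L k)
  gcongr
  · exact this.1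
  · exact this.2

theorem IsGeneric.vecWeight_firstIndex_ge {L : LatticeSpace} (hL : IsGeneric L) {m : ℝ}
    (hm : ∀ ξ ≠ 0, m ≤ normalRadius D c ξ) :
    m * succMin 1 L ^ (-(3 / 2) : ℝ) ≤ |vecWeight D c 1 firstIndex L| := by
  have hne := hL.combVec_ne_zero firstIndex
  refine le_trans ?_ (le_abs_self _)
  have hnorm : ‖combVec L (firstIndex : ℤ × ℤ)‖ = succMin 1 L := by
    rw [combVec_firstIndex, hL.norm_minVec_one]
  rw [vecWeight, one_smul, hnorm, Real.rpow_neg (succMin_one_pos L).le, ← div_eq_mul_inv]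
  have := succMin_one_pos L
  gcongr
  exact hm _ hne

end Weights

end LatticeSpace

theorem symSum_eq_truncSum {Ω : Type*} (D : Set Plane) (c : ℝ → Plane) (Z : PrimIndex → Ω → ℝ)
    (A : ℝ) (x : Ω × LatticeSpace) :
    symSum D c Z A x = truncSum (fun k : PrimIndex => ‖x.2.combVec k‖)
      (LatticeSpace.vecWeight D c 1 · x.2) (Z · x.1) A := by
  refine finsum_mem_congr rfl fun k _ => ?_
  simp only [LatticeSpace.vecWeight, one_smul]
  ring

/-- Both copies of an index carry the same norm, so truncation keeps or drops them together.
Genericity makes the truncated sum finite, so that it can be split. -/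
theorem nonsymSum_eq_truncSum {Ω : Type*} (D : Set Plane) (c : ℝ → Plane) (Z : PrimIndex → Ω → ℝ)
    (A : ℝ) (x : (Ω × Ω) × LatticeSpace) (hx : x.2.IsGeneric) :
    nonsymSum D c Z A x = truncSum (fun i : PrimIndex ⊕ PrimIndex => ‖x.2.combVec (Sum.elim id id i : PrimIndex)‖)
      (fun i => Sum.elim (LatticeSpace.vecWeight D c 1 · x.2)
        (LatticeSpace.vecWeight D c (-1) · x.2) i)
      (fun i => Sum.elim (Z · x.1.1) (Z · x.1.2) i) A := by
  have hfin := hx.finite_norm_combVec_le A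
  have hset : {i : PrimIndex ⊕ PrimIndex | ‖x.2.combVec (Sum.elim id id i : PrimIndex)‖ ≤ A} =
      ((hfin.toFinset.disjSum hfin.toFinset : Finset _) : Set (PrimIndex ⊕ PrimIndex)) := by
    ext i
    rcases i with i | i <;> simp
  rw [truncSum_eq_sum _ _ hset, Finset.sum_disjSum, ← Finset.sum_add_distrib, nonsymSum]
  have hset' : PrimIndexLE A x.2 = (hfin.toFinset : Set PrimIndex) := by
    ext k
    simp [PrimIndexLE]
  rw [hset', finsum_mem_coe_finset]
  refine Finset.sum_congr rfl fun k _ => ?_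
  simp only [Sum.elim_inl, Sum.elim_inr, LatticeSpace.vecWeight, one_smul, neg_one_smul]
  ring

theorem proposition15
    -- the invariant (Haar) probability measure on the space of unimodular lattices
    (μ₂ : Measure LatticeSpace) [IsProbabilityMeasure μ₂]
    [SMulInvariantMeasure (Matrix.SpecialLinearGroup (Fin 2) ℝ) LatticeSpace μ₂]
    -- the probability measure with bounded density `σ`
    (σ : LatticeSpace → ℝ) (hσ_meas : Measurable σ) (hσ_nonneg : ∀ L, 0 ≤ σ L)
    (hσ_bdd : ∃ C : ℝ, ∀ L, σ L ≤ C)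
    (ν : Measure LatticeSpace) [IsProbabilityMeasure ν]
    (hν : ν = μ₂.withDensity fun L => ENNReal.ofReal (σ L))
    -- the oval `D` with boundary curve `c`
    (D : Set Plane) (c : ℝ → Plane) (T : ℝ) (hD : IsAnalyticOval D c T)
    -- the random weights
    {Ω : Type*} [MeasurableSpace Ω] (P : Measure Ω) [IsProbabilityMeasure P]
    (Z : PrimIndex → Ω → ℝ) (hZ_meas : ∀ k, Measurable (Z k))
    (hZ_indep : iIndepFun Z P)
    (hZ_ident : ∀ j k, IdentDistrib (Z j) (Z k) P P)
    (hZ_symm : ∀ k, P.map (Z k) = P.map fun ω => -Z k ω)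
    (hZ_supp : ∀ k, ∃ K : Set ℝ, IsCompact K ∧ ∀ᵐ ω ∂P, Z k ω ∈ K)
    (hZ_ne : ∀ k, ¬ ∀ᵐ ω ∂P, Z k ω = 0) :
    (∃ S : Ω × LatticeSpace → ℝ, AEMeasurable S (P.prod ν) ∧
      (∀ᵐ x ∂(P.prod ν), Tendsto (fun A : ℝ => symSum D c Z A x) atTop (𝓝 (S x))) ∧
      (P.prod ν).map S = (P.prod ν).map (fun x => -S x) ∧
      (Integrable S (P.prod ν) ∧ ∫ x, S x ∂(P.prod ν) = 0) ∧
      (∀ κ : ℝ, 0 ≤ κ → κ < 1 / 3 → Integrable (fun x => |S x| ^ (1 + κ)) (P.prod ν)) ∧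
      ((∃ m > 0, ∃ α > 0, ∀ L : LatticeSpace, L.succMin 1 < α → m ≤ σ L) →
        ¬ Integrable (fun x => |S x| ^ (4 / 3 : ℝ)) (P.prod ν)) ∧
      ((∃ α > 0, ν {L : LatticeSpace | L.succMin 1 < α} = 0) →
        ∀ p : ℝ, 1 ≤ p → Integrable (fun x => |S x| ^ p) (P.prod ν))) ∧
    (∃ S : (Ω × Ω) × LatticeSpace → ℝ, AEMeasurable S ((P.prod P).prod ν) ∧
      (∀ᵐ x ∂((P.prod P).prod ν),
        Tendsto (fun A : ℝ => nonsymSum D c Z A x) atTop (𝓝 (S x))) ∧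
      ((P.prod P).prod ν).map S = ((P.prod P).prod ν).map (fun x => -S x) ∧
      (Integrable S ((P.prod P).prod ν) ∧ ∫ x, S x ∂((P.prod P).prod ν) = 0) ∧
      (∀ κ : ℝ, 0 ≤ κ → κ < 1 / 3 →
        Integrable (fun x => |S x| ^ (1 + κ)) ((P.prod P).prod ν)) ∧
      ((∃ m > 0, ∃ α > 0, ∀ L : LatticeSpace, L.succMin 1 < α → m ≤ σ L) →
        ¬ Integrable (fun x => |S x| ^ (4 / 3 : ℝ)) ((P.prod P).prod ν)) ∧
      ((∃ α > 0, ν {L : LatticeSpace | L.succMin 1 < α} = 0) →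
        ∀ p : ℝ, 1 ≤ p → Integrable (fun x => |S x| ^ p) ((P.prod P).prod ν))) := by
  classical
  obtain ⟨m, M, hm, hM, hlow, hbd⟩ := hD.exists_normalRadius_bounds
  obtain ⟨C, hC, hsum⟩ := LatticeSpace.exists_sum_norm_combVec_le
  have hgen : ∀ᵐ L ∂ν, L.IsGeneric := by
    rw [hν]
    exact (withDensity_absolutelyContinuous _ _).ae_le (LatticeSpace.ae_isGeneric (μ := μ₂))
  -- A bound for one coefficient serves for all because they share one law; the maximum with `1`
  -- keeps it positive.
  obtain ⟨K, hK, hZK⟩ : ∃ K : ℝ, 0 < K ∧ ∀ k, ∀ᵐ ω ∂P, |Z k ω| ≤ K := by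
    obtain ⟨s, hs, hZs⟩ := hZ_supp firstIndex
    obtain ⟨R, hR⟩ := hs.isBounded.exists_norm_le
    refine ⟨max R 1, by positivity, fun k => ?_⟩
    refine (hZ_ident firstIndex k).ae_snd (p := fun x => |x| ≤ max R 1)
      (measurableSet_le (measurable_id (α := ℝ)).abs measurable_const) ?_
    filter_upwards [hZs] with ω hω
    exact (hR _ hω).trans (le_max_left _ _)
  have hwsum : ∀ s : ℝ, ∀ L : LatticeSpace, L.IsGeneric → ∀ F : Finset PrimIndex,
      ∑ k ∈ F, LatticeSpace.vecWeight D c s k L ^ 2 ≤ LatticeSpace.cuspBound (M ^ 2 * C) L := by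
    intro s L hL F
    calc ∑ k ∈ F, LatticeSpace.vecWeight D c s k L ^ 2
        ≤ ∑ k ∈ F, M ^ 2 * ‖L.combVec k‖ ^ (-3 : ℝ) :=
          Finset.sum_le_sum fun k _ => LatticeSpace.vecWeight_sq_le hbd s k L
      _ = M ^ 2 * ∑ k ∈ F, ‖L.combVec k‖ ^ (-3 : ℝ) := by rw [Finset.mul_sum]
      _ ≤ M ^ 2 * (C * (L.succMin 1 ^ (-3 : ℝ) + 1)) := by
          gcongr
          exact hsum L hL F
      _ = _ := by rw [LatticeSpace.cuspBound]; ring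
  constructor
  · obtain ⟨S, hSm, hS, h⟩ := LatticeSpace.exists_lattice_series_limit hσ_meas hσ_bdd hν hZ_meas
      hZ_indep hZ_symm hK hZK id (fun k => Set.finite_singleton k)
      (w := LatticeSpace.vecWeight D c 1) (LatticeSpace.aemeasurable_vecWeight hD hgen 1)
      (by positivity) (hwsum 1) (hZ_ne firstIndex) hm fun L hL => hL.vecWeight_firstIndex_ge hlow
    refine ⟨S, hSm, ?_, h⟩
    filter_upwards [hS] with x hx
    exact hx.congr fun A => (symSum_eq_truncSum D c Z A x).symm
  · let Z' : PrimIndex ⊕ PrimIndex → Ω × Ω → ℝ := fun i x => Sum.elim (Z · x.1) (Z · x.2) i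
    let w : PrimIndex ⊕ PrimIndex → LatticeSpace → ℝ := fun i L =>
      Sum.elim (LatticeSpace.vecWeight D c 1 · L) (LatticeSpace.vecWeight D c (-1) · L) i
    have hZ'm : ∀ i, Measurable (Z' i) := by
      rintro (k | k)
      · exact (hZ_meas k).comp measurable_fst
      · exact (hZ_meas k).comp measurable_snd
    have hZ's : ∀ i, (P.prod P).map (Z' i) = (P.prod P).map fun x => -Z' i x := by
      have hcomp : ∀ (f : Ω × Ω → Ω), MeasurePreserving f (P.prod P) P → ∀ k,
          (P.prod P).map (fun x => Z k (f x)) = (P.prod P).map fun x => -Z k (f x) := by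
        intro f hf k
        have h1 := Measure.map_map (μ := P.prod P) (hZ_meas k) hf.measurable
        have h2 := Measure.map_map (μ := P.prod P) (hZ_meas k).neg hf.measurable
        rw [hf.map_eq] at h1 h2
        exact h1.symm.trans ((hZ_symm k).trans h2)
      rintro (k | k)
      · exact hcomp _ measurePreserving_fst k
      · exact hcomp _ measurePreserving_snd k
    have hZ'K : ∀ i, ∀ᵐ x ∂P.prod P, |Z' i x| ≤ K := by
      rintro (k | k)
      · exact Measure.quasiMeasurePreserving_fst.ae (hZK k)
      · exact Measure.quasiMeasurePreserving_snd.ae (hZK k)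
    have hw : ∀ i, AEMeasurable (w i) ν := by
      rintro (k | k)
      · exact LatticeSpace.aemeasurable_vecWeight hD hgen 1 k
      · exact LatticeSpace.aemeasurable_vecWeight hD hgen (-1) k
    have hwC : ∀ L : LatticeSpace, L.IsGeneric → ∀ F : Finset (PrimIndex ⊕ PrimIndex),
        ∑ i ∈ F, w i L ^ 2 ≤ LatticeSpace.cuspBound (2 * (M ^ 2 * C)) L := by
      intro L hL F
      rw [← Finset.toLeft_disjSum_toRight (u := F), Finset.sum_disjSum]
      have h1 := hwsum 1 L hL F.toLeft
      have h2 := hwsum (-1) L hL F.toRight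
      -- Each copy of `Π` contributes the variance bound of the first sum, whence the factor `2`.
      have h3 : LatticeSpace.cuspBound (2 * (M ^ 2 * C)) L =
          LatticeSpace.cuspBound (M ^ 2 * C) L + LatticeSpace.cuspBound (M ^ 2 * C) L := by
        simp only [LatticeSpace.cuspBound]; ring
      rw [h3]
      exact add_le_add h1 h2
    have hZ0 : ¬ ∀ᵐ x ∂P.prod P, Z' (Sum.inl firstIndex) x = 0 := by
      intro h
      have hset : MeasurableSet {ω | Z firstIndex ω = 0} :=
        hZ_meas firstIndex (measurableSet_singleton 0)
      refine hZ_ne firstIndex ?_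
      rw [← (measurePreserving_fst (μ := P) (ν := P)).map_eq]
      exact (ae_map_iff measurable_fst.aemeasurable hset).2 h
    obtain ⟨S, hSm, hS, h⟩ := LatticeSpace.exists_lattice_series_limit hσ_meas hσ_bdd hν hZ'm
      (iIndepFun_sumElim_prod hZ_meas hZ_indep) hZ's hK hZ'K (Sum.elim id id)
      (fun k => (Set.toFinite {Sum.inl k, Sum.inr k}).subset fun i hi => by
        rcases i with i | i
        · exact Or.inl (congrArg Sum.inl hi)
        · exact Or.inr (congrArg Sum.inr hi))
      hw (by positivity) hwC hZ0 hm fun L hL => hL.vecWeight_firstIndex_ge hlow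
    refine ⟨S, hSm, ?_, h⟩
    filter_upwards [hS, Measure.quasiMeasurePreserving_snd.ae hgen] with x hx hxg
    exact hx.congr fun A => (nonsymSum_eq_truncSum D c Z A x hxg).symm
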